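/- **Theorem 5.1.** Let $n\ge 2$ and $\alpha\ge 2$. Let $X_0:\mathbb S^n\to\mathbb R^{n+1}$ be a smooth immersion parametrizing a closed hypersurface $\mathcal M_0$ that is starshaped with respect to the origin, i.e. $\langle X_0,\nu_0\rangle>0$ for the outer unit normal $\nu_0$, and 2-convex, i.e. its principal curvatures $\kappa=(\kappa_1,\dots,\kappa_n)$ (with respect to $\nu_0$, positive on round spheres) satisfy $\sigma_1(\kappa)>0$ and $\sigma_2(\kappa)>0$ at every point, where $\sigma_k(\kappa)=\binom nk^{-1}\sum_{i_1<\dots<i_k}\kappa_{i_1}\cdots\kappa_{i_k}$. Then there is a constant $C$, depending only on $n$, $\alpha$ and the initial hypersurface, such that the following holds. Let $0<T\le\infty$ and let $X:\mathbb S^n\times[0,T)\to\mathbb R^{n+1}$ be a smooth family of immersed 2-convex hypersurfaces, with unit normal $\nu$ varying smoothly in $(x,t)$ and $\nu(\cdot,0)=\nu_0$, that solves the normalized flow $$\frac{\partial X}{\partial t}=-\sigma_2^{1/2}\,r^{\alpha}\,\nu+X,\qquad X(\cdot,0)=X_0,$$ where $r=|X|$ and $\sigma_2=\sigma_2(\kappa)$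 is evaluated at the principal curvatures of the evolving hypersurface with respect to $\nu$. Then the second fundamental form $A$ of $X(\cdot,t)$ satisfies $$|A|(x,t)\le C\qquad\text{for all }(x,t)\in\mathbb S^n\times[0,T).$$ In particular $C$ does not depend on $T$. -/

import Mathlib

open scoped Manifold ContDiff

noncomputable section

namespace NormalizedFlow

/-- The ambient Euclidean space `ℝⁿ⁺¹`. -/
abbrev Amb (n : ℕ) : Type := EuclideanSpace ℝ (Fin (n + 1))

/-- The round unit sphere `𝕊ⁿ ⊂ ℝⁿ⁺¹`, the parameter manifold of all hypersurfaces. -/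
abbrev Sph (n : ℕ) : Type := Metric.sphere (0 : Amb n) 1

variable {n : ℕ}

/-- `∂ᵢ f` at `x`, for a map `f : 𝕊ⁿ → ℝⁿ⁺¹`: the differential of `f` applied to the `i`-th vector
of the coordinate basis of the tangent space `T_x 𝕊ⁿ`. -/
def partialD (f : Sph n → Amb n) (x : Sph n) (i : Fin n) : Amb n :=
  mvfderiv (𝓡 n) f x (EuclideanSpace.single i (1 : ℝ) : EuclideanSpace ℝ (Fin n))

/-- The induced metric (first fundamental form) `g_{ij} = ⟨∂ᵢ X, ∂ⱼ X⟩`. -/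
def firstForm (X : Sph n → Amb n) (x : Sph n) : Matrix (Fin n) (Fin n) ℝ :=
  Matrix.of fun i j => inner ℝ (partialD X x i) (partialD X x j)

/-- The second fundamental form `h_{ij} = ⟨∂ᵢ ν, ∂ⱼ X⟩ = -⟨∂ᵢ∂ⱼ X, ν⟩` with respect to the unit
normal field `ν` (positive definite on round spheres with the outer normal). -/
def secondForm (X ν : Sph n → Amb n) (x : Sph n) : Matrix (Fin n) (Fin n) ℝ :=
  Matrix.of fun i j => inner ℝ (partialD ν x i) (partialD X x j)

/-- The matrix `g⁻¹ h` of the Weingarten map. -/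
def weingarten (X ν : Sph n → Amb n) (x : Sph n) : Matrix (Fin n) (Fin n) ℝ :=
  (firstForm X x)⁻¹ * secondForm X ν x

/-- The principal curvatures `κ₁, …, κₙ`: the solutions `κ` of `det (h - κ g) = 0`, with
multiplicity. -/
def principalCurvatures (X ν : Sph n → Amb n) (x : Sph n) : Multiset ℝ :=
  (weingarten X ν x).charpoly.roots

/-- The normalized `k`-th mean curvature: the `k`-th elementary symmetric polynomial of the
principal curvatures divided by `n.choose k`. -/
def sigma (k : ℕ) (X ν : Sph n → Amb n) (x : Sph n) : ℝ :=
  (principalCurvatures X ν x).esymm k / (n.choose k : ℝ)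

/-- `F = σ₂^{1/2}`. -/
def speedF (X ν : Sph n → Amb n) (x : Sph n) : ℝ := Real.sqrt (sigma 2 X ν x)

/-- The norm `|A|` of the second fundamental form: `|A|² = g^{ik} g^{jl} h_{ij} h_{kl}`. -/
def normA (X ν : Sph n → Amb n) (x : Sph n) : ℝ :=
  Real.sqrt (∑ i, ∑ j, ∑ k, ∑ l,
    (firstForm X x)⁻¹ i k * (firstForm X x)⁻¹ j l * secondForm X ν x i j * secondForm X ν x k l)

/-- `X` is an immersion and `ν` is a unit normal field along it. -/
structure IsImmersedWithNormal (X ν : Sph n → Amb n) : Prop where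
  immersion : ∀ x, Function.Injective (mvfderiv (𝓡 n) X x)
  norm_normal : ∀ x, ‖ν x‖ = 1
  normal : ∀ x i, inner ℝ (ν x) (partialD X x i) = 0

/-- 2-convexity: everywhere the principal curvatures lie in the Gårding cone
`Γ₂ = {σ₁ > 0, σ₂ > 0}`. -/
def TwoConvex (X ν : Sph n → Amb n) : Prop :=
  ∀ x, 0 < sigma 1 X ν x ∧ 0 < sigma 2 X ν x

/-- `X₀` parametrizes a smooth, closed, 2-convex hypersurface which is starshaped with respect to
the origin, and `ν₀` is its outer unit normal. Starshapedness with outer normal `ν₀` is the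
positivity of the support function `⟨X₀, ν₀⟩`. -/
structure IsInitialHypersurface (X₀ ν₀ : Sph n → Amb n) : Prop where
  smooth : ContMDiff (𝓡 n) 𝓘(ℝ, Amb n) ∞ X₀
  smooth_normal : ContMDiff (𝓡 n) 𝓘(ℝ, Amb n) ∞ ν₀
  immersed : IsImmersedWithNormal X₀ ν₀
  twoConvex : TwoConvex X₀ ν₀
  starshaped : ∀ x, 0 < inner ℝ (X₀ x) (ν₀ x)

/-- `X`, with unit normal `ν`, is a smooth family of 2-convex hypersurfaces on `𝕊ⁿ × [0, T)` which
solves the normalized flow `∂ₜ X = -σ₂^{1/2} r^α ν + X`, `r = |X|`, with initial data `X₀` with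
outer normal `ν₀`. Since `ν` is continuous in time, it is the outer normal for all times. -/
structure IsSolution (α T : ℝ) (X₀ ν₀ : Sph n → Amb n) (X ν : ℝ → Sph n → Amb n) : Prop where
  smooth : ContMDiffOn (𝓘(ℝ, ℝ).prod (𝓡 n)) 𝓘(ℝ, Amb n) ∞
    (fun p : ℝ × Sph n => X p.1 p.2) (Set.Ico 0 T ×ˢ Set.univ)
  smooth_normal : ContMDiffOn (𝓘(ℝ, ℝ).prod (𝓡 n)) 𝓘(ℝ, Amb n) ∞
    (fun p : ℝ × Sph n => ν p.1 p.2) (Set.Ico 0 T ×ˢ Set.univ)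
  immersed : ∀ t ∈ Set.Ico 0 T, IsImmersedWithNormal (X t) (ν t)
  twoConvex : ∀ t ∈ Set.Ico 0 T, TwoConvex (X t) (ν t)
  evolution : ∀ t ∈ Set.Ico 0 T, ∀ x,
    HasDerivWithinAt (fun s => X s x)
      (-(speedF (X t) (ν t) x * ‖X t x‖ ^ α) • ν t x + X t x) (Set.Ico 0 T) t
  initial : X 0 = X₀
  initial_normal : ν 0 = ν₀

end NormalizedFlow

end

/-! The proof is a chain of four maximum principles whose constants depend only on n, α and the
initial data. Write u = ⟨X, ν⟩, h for the second fundamental form, H = tr h, F = σ₂^{1/2}, R = r^α,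
k = n(n−1) and C = H|h|² − tr h³. Since H² − |h|² = kF², 2-convexity gives |h| < H, so a bound on H
suffices (`normA_le_meanCurvature`). For the same reason H·1 − h is positive semidefinite, so Lf =
HΔf − ⟨h, ∇²f⟩, the linearization of (H² − |h|²)/2, has a sign at minima. Two algebraic facts recur:
H ≥ nF, and C dominates a multiple of F²H.

Radius (`radiusSq_le`, `le_radiusSq`). At a spatial extremum of r² the position is normal, so u² =
r². There H ≥ nF, with L at a maximum and Δ at a minimum, compares uF with 1. As α ≥ 2, r^α ≥ r²
outside the unit ball and r^α ≤ r² inside, so the flow pushes r back towards 1.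

Support function (`le_supportFunction`). At a spatial minimum of u, Lu ≥ 0 and the lower bound on C
control the gradient term X·∇F in ∂ₜu from below. What remains is u times a quadratic polynomial in
F, which is positive when u is small; α ≥ 2 is used again. Hence u cannot reach a small positive
value, and starshapedness persists.

Curvature (`meanCurvature_le`). The test function is K(u − a) − H with 2a ≤ u. Simons' identity and
the concavity of σ₂^{1/2} bound ∂ₜH from above by LH + HC and lower order terms. At a first zero the
cubic terms −KuC and HC = K(u − a)C add up to −KaC, which is quadratic in K because H ≥ Ka, while
everything else is at most linear in K. Large K therefore excludes a zero, and |A| ≤ H ≤ K(u − a) ≤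
K|X|.

All differentiation takes place in the ring of smooth space-time germs at a point. Covariant
derivatives are replaced by the derivations δ_a along the tangential parts of the ambient vectors
e_a, so h becomes a symmetric (n+1)×(n+1) matrix annihilating ν. Every geometric identity follows
algebraically from the few rules of `IsTangentialFrame` and `IsFlowFrame`; evaluation of germs at a
touching point (`IsTouching`) then turns identities into inequalities. -/

noncomputable section

namespace NormalizedFlow

/-! ### Smooth germs and their directional derivatives. -/

section Germs

variable {E : Type*} [NormedAddCommGroup E] [NormedSpace ℝ E]

/-- The algebra of functions that are smooth at `p`. -/
def smoothAt (p : E) : Subalgebra ℝ (E → ℝ) where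
  carrier := {f | ContDiffAt ℝ ∞ f p}
  mul_mem' {f g} hf hg :=
    show ContDiffAt ℝ ∞ (f * g) p from ContDiffAt.mul (show ContDiffAt ℝ ∞ f p from hf) hg
  add_mem' {f g} hf hg :=
    show ContDiffAt ℝ ∞ (f + g) p from ContDiffAt.add (show ContDiffAt ℝ ∞ f p from hf) hg
  algebraMap_mem' c := show ContDiffAt ℝ ∞ (fun _ => c) p from contDiffAt_const

/-- The ideal of functions vanishing near `p`. -/
def vanishingNear (p : E) : Ideal (smoothAt p) where
  carrier := {f | f.1 =ᶠ[nhds p] 0}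
  add_mem' {f g} hf hg := by
    filter_upwards [hf, hg] with x hx hy
    simp [hx, hy]
  zero_mem' := Filter.EventuallyEq.rfl
  smul_mem' c f hf := by
    filter_upwards [hf] with x hx
    simp [hx]

/-- The algebra of germs at `p` of smooth real functions. -/
def SmoothGerm (p : E) : Type _ := smoothAt p ⧸ vanishingNear p

instance (p : E) : CommRing (SmoothGerm p) :=
  inferInstanceAs (CommRing (smoothAt p ⧸ vanishingNear p))

instance (p : E) : Algebra ℝ (SmoothGerm p) :=
  inferInstanceAs (Algebra ℝ (smoothAt p ⧸ vanishingNear p))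

/-- The projection from smooth functions to germs. -/
def toGerm (p : E) : smoothAt p →ₐ[ℝ] SmoothGerm p :=
  Ideal.Quotient.mkₐ ℝ (vanishingNear p)

variable {p : E}

open Classical in
/-- The germ at `p` of a function (zero if the function is not smooth at `p`). -/
def germ (p : E) (f : E → ℝ) : SmoothGerm p :=
  if h : ContDiffAt ℝ ∞ f p then toGerm p ⟨f, h⟩ else 0

theorem germ_of_smooth {f : E → ℝ} (h : ContDiffAt ℝ ∞ f p) :
    germ p f = toGerm p ⟨f, h⟩ := dif_pos h

theorem exists_germ_eq (a : SmoothGerm p) : ∃ f, ContDiffAt ℝ ∞ f p ∧ germ p f = a := by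
  obtain ⟨⟨f, hf⟩, rfl⟩ := Ideal.Quotient.mkₐ_surjective ℝ (vanishingNear p) a
  exact ⟨f, hf, germ_of_smooth hf⟩

theorem germ_eq_iff {f g : E → ℝ} (hf : ContDiffAt ℝ ∞ f p) (hg : ContDiffAt ℝ ∞ g p) :
    germ p f = germ p g ↔ f =ᶠ[nhds p] g := by
  rw [germ_of_smooth hf, germ_of_smooth hg]
  refine Ideal.Quotient.eq.trans ?_
  constructor
  · intro h
    filter_upwards [show (f - g) =ᶠ[nhds p] 0 from h] with x hx
    simpa [sub_eq_zero] using hx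
  · intro h
    show (f - g) =ᶠ[nhds p] 0
    filter_upwards [h] with x hx
    simp [hx]

theorem germ_congr {f g : E → ℝ} (h : f =ᶠ[nhds p] g) : germ p f = germ p g := by
  by_cases hf : ContDiffAt ℝ ∞ f p
  · exact (germ_eq_iff hf (hf.congr_of_eventuallyEq h.symm)).2 h
  · have hg : ¬ ContDiffAt ℝ ∞ g p := fun hg => hf (hg.congr_of_eventuallyEq h)
    simp [germ, hf, hg]

theorem germ_add {f g : E → ℝ} (hf : ContDiffAt ℝ ∞ f p) (hg : ContDiffAt ℝ ∞ g p) :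
    germ p (fun x => f x + g x) = germ p f + germ p g := by
  rw [germ_of_smooth hf, germ_of_smooth hg, germ_of_smooth (hf.add hg), ← map_add]; rfl

theorem germ_mul {f g : E → ℝ} (hf : ContDiffAt ℝ ∞ f p) (hg : ContDiffAt ℝ ∞ g p) :
    germ p (fun x => f x * g x) = germ p f * germ p g := by
  rw [germ_of_smooth hf, germ_of_smooth hg, germ_of_smooth (hf.mul hg), ← map_mul]; rfl

theorem germ_const (c : ℝ) : germ p (fun _ => c) = algebraMap ℝ (SmoothGerm p) c :=
  germ_of_smooth contDiffAt_const

theorem germ_sub {f g : E → ℝ} (hf : ContDiffAt ℝ ∞ f p) (hg : ContDiffAt ℝ ∞ g p) :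
    germ p (fun x => f x - g x) = germ p f - germ p g := by
  rw [germ_of_smooth hf, germ_of_smooth hg, germ_of_smooth (hf.sub hg), ← map_sub]; rfl

theorem germ_sum {ι : Type*} (s : Finset ι) {f : ι → E → ℝ}
    (hf : ∀ i ∈ s, ContDiffAt ℝ ∞ (f i) p) :
    germ p (fun x => ∑ i ∈ s, f i x) = ∑ i ∈ s, germ p (f i) := by
  classical
  induction s using Finset.induction_on with
  | empty => simpa using germ_const (p := p) 0
  | insert i s hi ih =>
    simp only [Finset.sum_insert hi]
    rw [germ_add (hf i (by simp)) (ContDiffAt.sum fun j hj => hf j (by simp [hj])),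
      ih fun j hj => hf j (by simp [hj])]

/-- Evaluation of germs at the base point. -/
def ev (p : E) : SmoothGerm p →ₐ[ℝ] ℝ :=
  Ideal.Quotient.liftₐ (vanishingNear p)
    ((Pi.evalAlgHom ℝ (fun _ : E => ℝ) p).comp (smoothAt p).val)
    (fun a (ha : a.1 =ᶠ[nhds p] 0) => ha.self_of_nhds)

theorem ev_germ {f : E → ℝ} (hf : ContDiffAt ℝ ∞ f p) : ev p (germ p f) = f p := by
  rw [germ_of_smooth hf]; rfl

/-- Germs form a local ring: a function nonzero at the point stays nonzero nearby and has a smooth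
reciprocal. This is what makes the metric invertible over germs. -/
theorem isUnit_of_ev_ne_zero {a : SmoothGerm p} (ha : ev p a ≠ 0) : IsUnit a := by
  obtain ⟨f, hf, rfl⟩ := exists_germ_eq a
  rw [ev_germ hf] at ha
  refine IsUnit.of_mul_eq_one (germ p fun x => (f x)⁻¹) ?_
  rw [← germ_mul hf (g := fun x => (f x)⁻¹) (hf.inv ha),
    ← map_one (algebraMap ℝ (SmoothGerm p)), ← germ_const]
  apply germ_congr
  filter_upwards [hf.continuousAt.eventually_ne ha] with x hx
  exact mul_inv_cancel₀ hx

theorem contDiffAt_fderiv_apply {f : E → ℝ} (hf : ContDiffAt ℝ ∞ f p) (v : E) :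
    ContDiffAt ℝ ∞ (fun x => fderiv ℝ f x v) p :=
  (hf.fderiv_right (m := ∞) (by simp)).clm_apply contDiffAt_const

theorem eventually_differentiableAt {f : E → ℝ} (hf : ContDiffAt ℝ ∞ f p) :
    ∀ᶠ x in nhds p, DifferentiableAt ℝ f x := by
  have h1 : ContDiffAt ℝ 1 f p := hf.of_le (by simp)
  filter_upwards [h1.eventually (by simp)] with x hx
  exact hx.differentiableAt (by simp)

/-- Directional derivative of germs, as a map. -/
def germDerivFun (v : E) (a : SmoothGerm p) : SmoothGerm p :=
  germ p fun x => fderiv ℝ (exists_germ_eq a).choose x v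

/-- The derivative is defined through a chosen representative; two representatives agree near the
point, hence so do their derivatives. -/
theorem germDerivFun_germ (v : E) {f : E → ℝ} (hf : ContDiffAt ℝ ∞ f p) :
    germDerivFun v (germ p f) = germ p fun x => fderiv ℝ f x v := by
  have h := (exists_germ_eq (germ p f)).choose_spec
  apply germ_congr
  filter_upwards [((germ_eq_iff h.1 hf).1 h.2).fderiv (𝕜 := ℝ)] with x hx
  rw [hx]

/-- Directional derivative of germs. -/
def germDeriv (p v : E) : Derivation ℝ (SmoothGerm p) (SmoothGerm p) :=
  Derivation.mk'
    { toFun := germDerivFun v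
      map_add' := by
        intro a b
        obtain ⟨f, hf, rfl⟩ := exists_germ_eq a
        obtain ⟨g, hg, rfl⟩ := exists_germ_eq b
        rw [← germ_add hf hg, germDerivFun_germ v (hf.add hg), germDerivFun_germ v hf,
          germDerivFun_germ v hg,
          ← germ_add (contDiffAt_fderiv_apply hf v) (contDiffAt_fderiv_apply hg v)]
        apply germ_congr
        filter_upwards [eventually_differentiableAt hf, eventually_differentiableAt hg]
          with x hx hy
        rw [fderiv_fun_add hx hy]; rfl
      map_smul' := by
        intro c a
        obtain ⟨f, hf, rfl⟩ := exists_germ_eq a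
        rw [RingHom.id_apply, Algebra.smul_def, Algebra.smul_def, ← germ_const,
          ← germ_mul contDiffAt_const hf,
          germDerivFun_germ v (contDiffAt_const.mul hf), germDerivFun_germ v hf,
          ← germ_mul contDiffAt_const (contDiffAt_fderiv_apply hf v)]
        apply germ_congr
        filter_upwards [eventually_differentiableAt hf] with x hx
        rw [fderiv_const_mul hx]; rfl }
    (by
      intro a b
      obtain ⟨f, hf, rfl⟩ := exists_germ_eq a
      obtain ⟨g, hg, rfl⟩ := exists_germ_eq b
      simp only [LinearMap.coe_mk, AddHom.coe_mk, smul_eq_mul]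
      rw [← germ_mul hf hg, germDerivFun_germ v (hf.mul hg), germDerivFun_germ v hf,
          germDerivFun_germ v hg, ← germ_mul hf (contDiffAt_fderiv_apply hg v),
          ← germ_mul hg (contDiffAt_fderiv_apply hf v),
          ← germ_add (hf.mul (contDiffAt_fderiv_apply hg v))
            (hg.mul (contDiffAt_fderiv_apply hf v))]
      apply germ_congr
      filter_upwards [eventually_differentiableAt hf, eventually_differentiableAt hg]
          with x hx hy
      rw [fderiv_fun_mul hx hy]; rfl)

theorem germDeriv_germ (v : E) {f : E → ℝ} (hf : ContDiffAt ℝ ∞ f p) :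
    germDeriv p v (germ p f) = germ p fun x => fderiv ℝ f x v :=
  germDerivFun_germ v hf

theorem ev_germDeriv (v : E) {f : E → ℝ} (hf : ContDiffAt ℝ ∞ f p) :
    ev p (germDeriv p v (germ p f)) = fderiv ℝ f p v := by
  rw [germDeriv_germ v hf, ev_germ (contDiffAt_fderiv_apply hf v)]

theorem germDeriv_comm (v w : E) (a : SmoothGerm p) :
    germDeriv p v (germDeriv p w a) = germDeriv p w (germDeriv p v a) := by
  obtain ⟨f, hf, rfl⟩ := exists_germ_eq a
  rw [germDeriv_germ v hf, germDeriv_germ w hf, germDeriv_germ _ (contDiffAt_fderiv_apply hf _),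
    germDeriv_germ _ (contDiffAt_fderiv_apply hf _)]
  apply germ_congr
  -- Equality of germs needs symmetry of the second derivative on a whole neighbourhood, so C²
  -- regularity is spread from the base point.
  have h2 : ContDiffAt ℝ 2 f p := hf.of_le ENat.LEInfty.out
  filter_upwards [h2.eventually (by simp)] with x hx
  have hd : DifferentiableAt ℝ (fderiv ℝ f) x :=
    (hx.fderiv_right (m := 1) (by norm_num)).differentiableAt (by simp)
  have hs := hx.isSymmSndFDerivAt (by simp)
  have key : ∀ u u' : E, fderiv ℝ (fun y => fderiv ℝ f y u) x u'
      = fderiv ℝ (fderiv ℝ f) x u' u := by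
    intro u u'
    rw [fderiv_clm_apply hd (differentiableAt_const u)]
    simp
  rw [key, key]
  exact hs v w

theorem germDeriv_rpow (v : E) {f : E → ℝ} (hf : ContDiffAt ℝ ∞ f p) (h0 : f p ≠ 0) (β : ℝ) :
    germDeriv p v (germ p fun x => f x ^ β) =
      algebraMap ℝ _ β * germ p (fun x => f x ^ (β - 1)) * germDeriv p v (germ p f) := by
  have hc : ∀ γ : ℝ, ContDiffAt ℝ ∞ (fun x => f x ^ γ) p := fun γ => hf.rpow_const_of_ne h0
  have hv := contDiffAt_fderiv_apply hf v
  rw [germDeriv_germ v (hc β), germDeriv_germ v hf, ← germ_const,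
    ← germ_mul contDiffAt_const (hc _), ← germ_mul (contDiffAt_const.mul (hc _)) hv]
  apply germ_congr
  filter_upwards [eventually_differentiableAt hf, hf.continuousAt.eventually_ne h0] with x hx hx0
  rw [(hx.hasFDerivAt.rpow_const (p := β) (Or.inl hx0)).fderiv]
  simp

end Germs

/-! ### Hypersurface geometry as an algebra of tangential derivations. -/

section TangentialCalculus

variable {ι A : Type*} [Fintype ι] [DecidableEq ι] [CommRing A] [Algebra ℝ A]

/-- The rules of the tangential calculus along a hypersurface with position `X` and unit normal
`ν`: `δ a` is the derivative in the direction of the tangential part of the constant vector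
`e_a`. -/
structure IsTangentialFrame (X ν : ι → A) (δ : ι → Derivation ℝ A A) : Prop where
  norm : ∑ a, ν a * ν a = 1
  position : ∀ a b, δ a (X b) = (if a = b then 1 else 0) - ν a * ν b
  normal : ∀ f, ∑ a, ν a * δ a f = 0
  symm : ∀ a b, δ a (ν b) = δ b (ν a)
  comm : ∀ a b f, δ a (δ b f) - δ b (δ a f) =
    ∑ c, (ν a * δ b (ν c) - ν b * δ a (ν c)) * δ c f

/-- The second fundamental form in ambient coordinates. -/
def shape (ν : ι → A) (δ : ι → Derivation ℝ A A) (a b : ι) : A := δ a (ν b)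

/-- The square of the second fundamental form. -/
def shapeSq (ν : ι → A) (δ : ι → Derivation ℝ A A) (a b : ι) : A :=
  ∑ c, shape ν δ a c * shape ν δ c b

/-- The cube of the second fundamental form. -/
def shapeCube (ν : ι → A) (δ : ι → Derivation ℝ A A) (a b : ι) : A :=
  ∑ c, shape ν δ a c * shapeSq ν δ c b

/-- The mean curvature (the trace of the second fundamental form). -/
def meanCurv (ν : ι → A) (δ : ι → Derivation ℝ A A) : A := ∑ a, shape ν δ a a

/-- The squared norm of the second fundamental form. -/
def normSq (ν : ι → A) (δ : ι → Derivation ℝ A A) : A :=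
  ∑ a, ∑ b, shape ν δ a b * shape ν δ a b

/-- The trace of the cube of the second fundamental form. -/
def traceCube (ν : ι → A) (δ : ι → Derivation ℝ A A) : A :=
  ∑ a, ∑ b, shape ν δ a b * shapeSq ν δ a b

/-- The trace of the fourth power of the second fundamental form. -/
def traceFourth (ν : ι → A) (δ : ι → Derivation ℝ A A) : A :=
  ∑ a, ∑ b, shape ν δ a b * shapeCube ν δ a b

/-- The Laplacian. -/
def lap (δ : ι → Derivation ℝ A A) (f : A) : A := ∑ a, δ a (δ a f)

/-- The contraction of the Hessian with the second fundamental form. -/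
def shapeLap (ν : ι → A) (δ : ι → Derivation ℝ A A) (f : A) : A :=
  ∑ a, ∑ b, shape ν δ a b * δ a (δ b f)

/-- The support function. -/
def support (X ν : ι → A) : A := ∑ a, X a * ν a

/-- The ring of germs has zero divisors, but 2 comes from an invertible real scalar. -/
theorem eq_zero_of_two_mul_eq_zero {x : A} (h : 2 * x = 0) : x = 0 := by
  have h2 : algebraMap ℝ A (1 / 2) * 2 = 1 := by
    rw [← map_ofNat (algebraMap ℝ A) 2, ← map_mul]; norm_num
  calc x = algebraMap ℝ A (1 / 2) * (2 * x) := by rw [← mul_assoc, h2, one_mul]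
    _ = 0 := by rw [h, mul_zero]

omit [DecidableEq ι] in
theorem deriv_normSq (ν : ι → A) (δ : ι → Derivation ℝ A A) (c : ι) :
    δ c (normSq ν δ) = 2 * ∑ a, ∑ b, shape ν δ a b * δ c (shape ν δ a b) := by
  simp only [normSq, map_sum, Derivation.leibniz, smul_eq_mul, Finset.mul_sum]
  exact Finset.sum_congr rfl fun a _ => Finset.sum_congr rfl fun b _ => by ring

omit [DecidableEq ι] in
theorem lap_mul_self (δ : ι → Derivation ℝ A A) (f : A) :
    lap δ (f * f) = 2 * ∑ c, δ c f * δ c f + 2 * (f * lap δ f) := by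
  simp only [lap, Derivation.leibniz, smul_eq_mul, map_add, Finset.mul_sum,
    ← Finset.sum_add_distrib]
  exact Finset.sum_congr rfl fun a _ => by ring

omit [DecidableEq ι] in
theorem lap_normSq (ν : ι → A) (δ : ι → Derivation ℝ A A) :
    lap δ (normSq ν δ) = 2 * ∑ c, ∑ a, ∑ b, δ c (shape ν δ a b) * δ c (shape ν δ a b)
      + 2 * ∑ a, ∑ b, shape ν δ a b * lap δ (shape ν δ a b) := by
  have e : ∀ c, δ c (δ c (normSq ν δ)) = 2 * ∑ a, ∑ b, δ c (shape ν δ a b) * δ c (shape ν δ a b)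
      + 2 * ∑ a, ∑ b, shape ν δ a b * δ c (δ c (shape ν δ a b)) := fun c => by
    rw [deriv_normSq]
    simp only [Derivation.leibniz, map_sum, smul_eq_mul, Finset.sum_add_distrib, mul_add]
    have : δ c (2 : A) = 0 := by
      rw [← map_ofNat (algebraMap ℝ A) 2, Derivation.map_algebraMap]
    rw [this]; ring
  simp only [lap, e, Finset.sum_add_distrib, ← Finset.mul_sum]
  congr 2
  rw [Finset.sum_comm]
  refine Finset.sum_congr rfl fun a _ => ?_
  rw [Finset.sum_comm]
  exact Finset.sum_congr rfl fun b _ => by rw [Finset.mul_sum]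

namespace IsTangentialFrame

variable {X ν : ι → A} {δ : ι → Derivation ℝ A A} (hF : IsTangentialFrame X ν δ)
include hF

local notation "h" => shape ν δ
local notation "h2" => shapeSq ν δ
local notation "h3" => shapeCube ν δ
local notation "H" => meanCurv ν δ
local notation "N" => normSq ν δ
local notation "u" => support X ν

theorem shape_symm (a b : ι) : h a b = h b a := hF.symm a b

theorem shapeSq_symm (a b : ι) : h2 a b = h2 b a := by
  simp only [shapeSq]
  refine Finset.sum_congr rfl fun c _ => ?_
  rw [hF.shape_symm a c, hF.shape_symm c b, mul_comm]

theorem shape_normal (a : ι) : ∑ b, ν b * h a b = 0 := by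
  apply eq_zero_of_two_mul_eq_zero
  have := congrArg (δ a) hF.norm
  simp only [map_sum, Derivation.leibniz, smul_eq_mul, Derivation.map_one_eq_zero] at this
  rw [← this, Finset.mul_sum]
  exact Finset.sum_congr rfl fun b _ => by simp only [shape]; ring

theorem normal_shape (b : ι) : ∑ a, ν a * h a b = 0 := hF.normal (ν b)

theorem normal_shapeSq (b : ι) : ∑ a, ν a * h2 a b = 0 := by
  simp only [shapeSq, Finset.mul_sum]
  rw [Finset.sum_comm]
  refine Finset.sum_eq_zero fun c _ => ?_
  simp only [← mul_assoc, ← Finset.sum_mul, hF.normal_shape c, zero_mul]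

theorem shapeSq_normal (a : ι) : ∑ b, ν b * h2 a b = 0 := by
  simpa only [hF.shapeSq_symm a] using hF.normal_shapeSq a

/-- This is the commutator rule applied to ν_b. The normal terms occur because δ differentiates
ambient components instead of taking a covariant derivative. -/
theorem codazzi (a b c : ι) :
    δ c (h a b) = δ a (h c b) + ν c * h2 a b - ν a * h2 c b := by
  have := hF.comm c a (ν b)
  simp only [sub_mul, Finset.sum_sub_distrib, mul_assoc, ← Finset.mul_sum] at this
  simp only [shape, shapeSq] at *
  linear_combination this

theorem trace_shapeSq : ∑ a, h2 a a = N := by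
  simp only [shapeSq, normSq]
  exact Finset.sum_congr rfl fun a _ => Finset.sum_congr rfl fun c _ => by
    rw [hF.shape_symm c a]

/-- Differentiate hν = 0: although h is tangential, the derivative of its components is not. -/
theorem normal_deriv_shape (a c : ι) : ∑ b, ν b * δ c (h a b) = -h2 c a := by
  have := congrArg (δ c) (hF.shape_normal a)
  simp only [map_sum, Derivation.leibniz, smul_eq_mul, map_zero, Finset.sum_add_distrib] at this
  rw [eq_neg_iff_add_eq_zero, ← this]
  congr 1
  simp only [shapeSq]
  exact Finset.sum_congr rfl fun b _ => by rw [hF.shape_symm b a, mul_comm]; rfl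

theorem normal_deriv_shape' (b c : ι) : ∑ a, ν a * δ c (h a b) = -h2 c b := by
  rw [← hF.normal_deriv_shape b c]
  exact Finset.sum_congr rfl fun a _ => by rw [hF.shape_symm a b]

theorem div_shape (b : ι) : ∑ c, δ c (h c b) = δ b H - ν b * N := by
  have e : ∀ c, δ c (h c b) = δ b (h c c) + ν c * h2 c b - ν b * h2 c c := fun c => by
    rw [hF.shape_symm c b, hF.codazzi b c c, hF.shape_symm c c, hF.shapeSq_symm b c]
  simp only [e, Finset.sum_add_distrib, Finset.sum_sub_distrib, ← Finset.mul_sum,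
    hF.trace_shapeSq, hF.normal_shapeSq, meanCurv, map_sum, add_zero]

/-- Since h annihilates ν, every correction term carrying a free normal factor disappears after
contraction with h. -/
theorem shape_contract_normal (Z : ι → A) : ∑ a, ∑ b, h a b * (ν a * Z b) = 0 := by
  rw [Finset.sum_comm]
  refine Finset.sum_eq_zero fun b _ => ?_
  have := hF.normal_shape b
  calc ∑ a, h a b * (ν a * Z b) = (∑ a, ν a * h a b) * Z b := by
        rw [Finset.sum_mul]; exact Finset.sum_congr rfl fun a _ => by ring
    _ = 0 := by rw [this, zero_mul]

theorem shape_contract_normal' (Z : ι → A) : ∑ a, ∑ b, h a b * (ν b * Z a) = 0 := by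
  rw [Finset.sum_comm, ← hF.shape_contract_normal Z]
  exact Finset.sum_congr rfl fun a _ => Finset.sum_congr rfl fun b _ => by
    rw [hF.shape_symm a b]

/-- Simons' identity: apply Codazzi, commute the two derivatives, and take the divergence of h. The
terms with a factor ν_a or ν_b are left unsimplified because only the contraction with h is needed.
-/
theorem lap_shape (a b : ι) :
    lap δ (h a b) = δ a (δ b H) - N * h a b + H * h2 a b - 2 * h3 a b - ν b * δ a N
      - ν a * (∑ c, δ c (h2 c b) + ∑ c, ∑ d, h c d * δ d (h c b)) := by
  have e1 : ∀ c, δ c (δ c (h a b)) = δ c (δ a (h c b)) + h c c * h2 a b + ν c * δ c (h2 a b)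
      - h a c * h2 c b - ν a * δ c (h2 c b) := fun c => by
    rw [hF.codazzi a b c]
    simp only [map_add, map_sub, Derivation.leibniz, smul_eq_mul]
    rw [hF.shape_symm a c]
    simp only [shape]
    ring
  have e2 : ∀ c, δ c (δ a (h c b)) = δ a (δ c (h c b))
      + ∑ d, (h a d * (ν c * δ d (h c b)) - ν a * (h c d * δ d (h c b))) := fun c => by
    have := hF.comm c a (h c b)
    rw [sub_eq_iff_eq_add'] at this
    rw [this]
    congr 1
    exact Finset.sum_congr rfl fun d _ => by simp only [shape]; ring
  have e3 : ∑ c, ∑ d, h a d * (ν c * δ d (h c b)) = -h3 a b := by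
    rw [Finset.sum_comm]
    simp only [← Finset.mul_sum, hF.normal_deriv_shape', shapeCube, mul_neg,
      Finset.sum_neg_distrib]
  have e4 : ∑ c, δ a (δ c (h c b)) = δ a (δ b H) - ν b * δ a N - N * h a b := by
    rw [← map_sum, hF.div_shape]
    simp only [map_sub, Derivation.leibniz, smul_eq_mul, shape]
    ring
  simp only [lap, e1, e2, Finset.sum_add_distrib, Finset.sum_sub_distrib, e3, e4,
    ← Finset.mul_sum, ← Finset.sum_mul, hF.normal]
  simp only [meanCurv, shapeCube]
  ring

theorem shape_contract_lap_shape :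
    ∑ a, ∑ b, h a b * lap δ (h a b) =
      shapeLap ν δ H - N * N + H * traceCube ν δ - 2 * traceFourth ν δ := by
  have e : ∀ a b, h a b * lap δ (h a b) = h a b * δ a (δ b H) - N * (h a b * h a b)
      + H * (h a b * h2 a b) - 2 * (h a b * h3 a b) - h a b * (ν b * δ a N)
      - h a b * (ν a * (∑ c, δ c (h2 c b) + ∑ c, ∑ d, h c d * δ d (h c b))) := fun a b => by
    rw [hF.lap_shape]; ring
  simp only [e, Finset.sum_add_distrib, Finset.sum_sub_distrib, ← Finset.mul_sum]
  rw [hF.shape_contract_normal', hF.shape_contract_normal]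
  simp only [shapeLap, normSq, traceCube, traceFourth]
  ring

/-- The right-hand side is |h²|², the form in which normal components of the derivatives of h enter
`sum_sq_tangential`; the two occurrences cancel in `ev_speed_lap_le`. -/
theorem traceFourth_eq : traceFourth ν δ = ∑ a, ∑ b, h2 a b * h2 a b := by
  simp only [traceFourth, shapeCube, Finset.mul_sum]
  calc ∑ a, ∑ b, ∑ c, h a b * (h a c * h2 c b)
      = ∑ b, ∑ a, ∑ c, h a b * (h a c * h2 c b) := Finset.sum_comm
    _ = ∑ b, ∑ c, ∑ a, h a b * (h a c * h2 c b) :=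
        Finset.sum_congr rfl fun b _ => Finset.sum_comm
    _ = ∑ a, ∑ b, h2 a b * h2 a b := by
        refine Finset.sum_congr rfl fun b _ => Finset.sum_congr rfl fun c _ => ?_
        rw [hF.shapeSq_symm c b]
        nth_rw 2 [shapeSq]
        rw [Finset.sum_mul]
        exact Finset.sum_congr rfl fun a _ => by rw [hF.shape_symm a b]; ring

/-- The contracted Simons identity for `H² - |h|²`. -/
theorem lap_two_sigma :
    lap δ (H * H - N) = 2 * (∑ c, δ c H * δ c H - ∑ c, ∑ a, ∑ b, δ c (h a b) * δ c (h a b)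
      + 2 * traceFourth ν δ + (H * lap δ H - shapeLap ν δ H) + N * N - H * traceCube ν δ) := by
  have : lap δ (H * H - N) = lap δ (H * H) - lap δ N := by
    simp only [lap, map_sub, Finset.sum_sub_distrib]
  rw [this, lap_mul_self, lap_normSq, hF.shape_contract_lap_shape]
  ring

/-- Adding ν_a h²_cb + ν_b h²_ca to δ_c h_ab removes its normal part and leaves the covariant
derivative, so this expands |∇_c h − τh|². Its nonnegativity for τ = ∇_c H / H is the concavity of
σ₂^{1/2} along the hypersurface. -/
theorem sum_sq_tangential (c : ι) (τ : A) :
    ∑ a, ∑ b, (δ c (h a b) + ν a * h2 c b + ν b * h2 c a - τ * h a b) ^ 2 =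
      ∑ a, ∑ b, δ c (h a b) * δ c (h a b) - 2 * ∑ b, h2 c b * h2 c b - τ * δ c N
        + τ ^ 2 * N := by
  have e : ∀ a b, (δ c (h a b) + ν a * h2 c b + ν b * h2 c a - τ * h a b) ^ 2 =
      δ c (h a b) * δ c (h a b) + (ν a * ν a) * (h2 c b * h2 c b)
      + (h2 c a * h2 c a) * (ν b * ν b) + 2 * (h2 c b * (ν a * δ c (h a b)))
      + 2 * (h2 c a * (ν b * δ c (h a b))) + 2 * ((ν a * h2 c a) * (ν b * h2 c b))
      - τ * (2 * (h a b * δ c (h a b))) - 2 * τ * (h a b * (ν a * h2 c b))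
      - 2 * τ * (h a b * (ν b * h2 c a)) + τ ^ 2 * (h a b * h a b) := fun a b => by ring
  simp only [e, Finset.sum_add_distrib, Finset.sum_sub_distrib, ← Finset.mul_sum]
  rw [hF.shape_contract_normal (fun b => h2 c b), hF.shape_contract_normal' (fun b => h2 c b),
    deriv_normSq]
  have e1 : ∑ a, ∑ b, h2 c b * (ν a * δ c (h a b)) = -∑ b, h2 c b * h2 c b := by
    rw [Finset.sum_comm]
    simp only [← Finset.mul_sum, hF.normal_deriv_shape', mul_neg, Finset.sum_neg_distrib]
  rw [e1]
  simp only [hF.normal_deriv_shape, ← Finset.sum_mul, hF.norm, hF.shapeSq_normal, mul_neg,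
    Finset.sum_neg_distrib, normSq]
  ring

theorem deriv_support (a : ι) : δ a u = ∑ b, X b * h a b := by
  simp only [support, map_sum, Derivation.leibniz, smul_eq_mul, Finset.sum_add_distrib,
    hF.position, mul_sub, Finset.sum_sub_distrib]
  have : ∑ b, ν b * (ν a * ν b) = ν a := by
    calc ∑ b, ν b * (ν a * ν b) = ν a * ∑ b, ν b * ν b := by
          rw [Finset.mul_sum]; exact Finset.sum_congr rfl fun b _ => by ring
      _ = ν a := by rw [hF.norm, mul_one]
  simp [this, shape]

theorem deriv_deriv_support (a b : ι) : δ a (δ b u) = h a b + ∑ c, X c * δ a (h b c) := by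
  have e : ∑ c, h b c * δ a (X c) = h a b := by
    simp only [hF.position, mul_sub, Finset.sum_sub_distrib]
    have : ∑ c, h b c * (ν a * ν c) = 0 := by
      rw [← mul_zero (ν a), ← hF.shape_normal b, Finset.mul_sum]
      exact Finset.sum_congr rfl fun c _ => by ring
    simp [this, hF.shape_symm a b]
  rw [hF.deriv_support b]
  simp only [map_sum, Derivation.leibniz, smul_eq_mul, Finset.sum_add_distrib, e]
  ring

theorem lap_support : lap δ u = ∑ c, X c * δ c H - u * N + H := by
  simp only [lap, hF.deriv_deriv_support, Finset.sum_add_distrib]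
  rw [Finset.sum_comm]
  simp only [← Finset.mul_sum]
  have e : ∀ c, ∑ a, δ a (h a c) = δ c H - ν c * N := hF.div_shape
  simp only [e, mul_sub, Finset.sum_sub_distrib, support, meanCurv, Finset.sum_mul, mul_assoc]
  ring

/-- By Codazzi the third-order contraction ⟨h, ∇_X h⟩ is half of X·∇|h|²; the factor 2 keeps the
identity free of fractions. -/
theorem shapeLap_support :
    2 * shapeLap ν δ u = ∑ c, X c * δ c N - 2 * (u * traceCube ν δ) + 2 * N := by
  have e : ∀ a b c, δ a (h b c) = δ c (h a b) + ν a * h2 c b - ν c * h2 a b := fun a b c => by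
    rw [hF.shape_symm b c, hF.codazzi c b a, hF.shape_symm a b, hF.shape_symm b a]
  have e2 : ∀ a b, h a b * δ a (δ b u) = h a b * h a b + ∑ c, X c * (h a b * δ c (h a b))
      + h a b * (ν a * ∑ c, X c * h2 c b) - u * (h a b * h2 a b) := fun a b => by
    rw [hF.deriv_deriv_support, Finset.sum_congr rfl fun c _ => congrArg (X c * ·) (e a b c)]
    simp only [mul_add, mul_sub, Finset.sum_add_distrib, Finset.sum_sub_distrib,
      Finset.mul_sum, support, Finset.sum_mul]
    have e3 : ∀ c, h a b * (X c * δ c (h a b)) = X c * (h a b * δ c (h a b)) := fun c => by ring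
    have e4 : ∀ c, h a b * (X c * (ν a * h2 c b)) = h a b * (ν a * (X c * h2 c b)) :=
      fun c => by ring
    have e5 : ∀ c, h a b * (X c * (ν c * h2 a b)) = X c * ν c * (h a b * h2 a b) :=
      fun c => by ring
    simp only [e3, e4, e5]
    ring
  simp only [shapeLap, e2, Finset.sum_add_distrib, Finset.sum_sub_distrib]
  rw [hF.shape_contract_normal (fun b => ∑ c, X c * h2 c b)]
  simp only [deriv_normSq, ← Finset.mul_sum]
  have e6 : ∑ a, ∑ b, ∑ c, X c * (h a b * δ c (h a b))
      = ∑ c, X c * ∑ a, ∑ b, h a b * δ c (h a b) := by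
    simp only [Finset.mul_sum]
    rw [Finset.sum_comm' (t' := Finset.univ) (s' := fun _ => Finset.univ) (by simp)]
    calc _ = ∑ b, ∑ c, ∑ a, X c * (h a b * δ c (h a b)) :=
          Finset.sum_congr rfl fun _ _ => Finset.sum_comm
      _ = ∑ c, ∑ b, ∑ a, X c * (h a b * δ c (h a b)) := Finset.sum_comm
      _ = _ := Finset.sum_congr rfl fun _ _ => Finset.sum_comm
  rw [e6]
  simp only [normSq, traceCube]
  have e7 : ∑ c, X c * (2 * ∑ a, ∑ b, h a b * δ c (h a b))
      = 2 * ∑ c, X c * ∑ a, ∑ b, h a b * δ c (h a b) := by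
    rw [Finset.mul_sum]
    exact Finset.sum_congr rfl fun c _ => by ring
  rw [e7]
  ring

local notation "Q" => ∑ a, X a * X a

theorem sum_mul_deriv_position (Z : ι → A) (a : ι) :
    ∑ b, Z b * δ a (X b) = Z a - ν a * ∑ b, Z b * ν b := by
  simp only [hF.position, mul_sub, Finset.sum_sub_distrib, Finset.mul_sum]
  simp only [mul_ite, mul_one, mul_zero, Finset.sum_ite_eq, Finset.mem_univ, if_true]
  congr 1
  exact Finset.sum_congr rfl fun b _ => by ring

theorem deriv_radiusSq (a : ι) : δ a Q = 2 * (X a - u * ν a) := by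
  simp only [map_sum, Derivation.leibniz, smul_eq_mul, ← two_mul, ← Finset.mul_sum]
  rw [hF.sum_mul_deriv_position X a]
  simp only [support]; ring

theorem deriv_tangential_position (a b : ι) :
    δ a (X b - u * ν b) = (if a = b then 1 else 0) - ν a * ν b - u * h a b - ν b * δ a u := by
  simp only [map_sub, Derivation.leibniz, smul_eq_mul, hF.position, shape]
  ring

/-- The index set is ambient, so `Fintype.card ι - 1` is the dimension of the hypersurface, the
trace of the tangential projection. -/
theorem lap_radiusSq : lap δ Q = 2 * ((Fintype.card ι : A) - 1 - u * H) := by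
  have : ∀ a, δ a (δ a Q) = 2 * (1 - ν a * ν a - u * h a a - ν a * δ a u) := fun a => by
    have htwo : δ a (2 : A) = 0 := by
      rw [← map_ofNat (algebraMap ℝ A) 2, Derivation.map_algebraMap]
    rw [hF.deriv_radiusSq, Derivation.leibniz, hF.deriv_tangential_position, htwo]
    simp
  simp only [lap, this, ← Finset.mul_sum, Finset.sum_sub_distrib, hF.norm, hF.normal]
  simp [meanCurv]

theorem shapeLap_radiusSq : shapeLap ν δ Q = 2 * (H - u * N) := by
  have : ∀ a b, h a b * δ a (δ b Q) = 2 * (h a b * (if a = b then 1 else 0)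
      - h a b * (ν a * ν b) - u * (h a b * h a b) - h a b * (ν b * δ a u)) := fun a b => by
    have htwo : δ a (2 : A) = 0 := by
      rw [← map_ofNat (algebraMap ℝ A) 2, Derivation.map_algebraMap]
    rw [hF.deriv_radiusSq, Derivation.leibniz, hF.deriv_tangential_position, htwo]
    simp only [smul_eq_mul, add_zero, mul_zero]
    ring
  simp only [shapeLap, this, ← Finset.mul_sum, Finset.sum_sub_distrib,
    hF.shape_contract_normal ν, hF.shape_contract_normal' (fun a => δ a u)]
  simp [meanCurv, normSq]

theorem sum_tangential_position_sq :
    ∑ a, (X a - u * ν a) * (X a - u * ν a) = Q - u * u := by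
  have e : ∀ a, (X a - u * ν a) * (X a - u * ν a)
      = X a * X a - 2 * u * (X a * ν a) + u * u * (ν a * ν a) := fun a => by ring
  simp only [e, Finset.sum_add_distrib, Finset.sum_sub_distrib, ← Finset.mul_sum, hF.norm]
  simp only [support]; ring

end IsTangentialFrame

end TangentialCalculus

/-! ### Evolution equations along the flow. -/

section FlowFrame

variable {ι A : Type*} [Fintype ι] [DecidableEq ι] [CommRing A] [Algebra ℝ A]

/-- A tangential calculus together with a time derivative `T` along the flow
`∂ₜ X = -Ψ ν + X`. -/
structure IsFlowFrame (X ν : ι → A) (δ : ι → Derivation ℝ A A) (T : Derivation ℝ A A) (Ψ : A) :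
    Prop extends IsTangentialFrame X ν δ where
  time_position : ∀ a, T (X a) = X a - Ψ * ν a
  time_comm : ∀ a f, T (δ a f) - δ a (T f) =
    ∑ b, (T (δ a (X b)) - δ a (T (X b))) * δ b f
  time_tangent : ∀ a, ∑ b, ν b * (T (δ a (X b)) - δ a (T (X b))) = 0

namespace IsFlowFrame

variable {X ν : ι → A} {δ : ι → Derivation ℝ A A} {T : Derivation ℝ A A} {Ψ : A}
  (hF : IsFlowFrame X ν δ T Ψ)
include hF

theorem commutator_position (a b : ι) :
    T (δ a (X b)) - δ a (T (X b)) = δ a Ψ * ν b + Ψ * shape ν δ a b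
      - (if a = b then 1 else 0) + ν a * ν b - T (ν a) * ν b - ν a * T (ν b) := by
  rw [hF.time_position, hF.position, map_sub, map_sub, hF.position]
  have : T (if a = b then (1 : A) else 0) = 0 := by
    split_ifs
    · exact Derivation.map_one_eq_zero T
    · exact map_zero T
  rw [this]
  simp only [Derivation.leibniz, smul_eq_mul, shape]
  ring

theorem normal_time_normal : ∑ b, ν b * T (ν b) = 0 := by
  apply eq_zero_of_two_mul_eq_zero
  have := congrArg T hF.norm
  simp only [map_sum, Derivation.leibniz, smul_eq_mul, Derivation.map_one_eq_zero] at this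
  rw [← this, Finset.mul_sum]
  exact Finset.sum_congr rfl fun b _ => by ring

/-- The commutator of T with δ_a is tangential, so its action on X is orthogonal to ν; expanding
this orthogonality leaves exactly T ν_a = δ_a Ψ. The dilation term X of the flow does not turn the
normal. -/
theorem time_normal (a : ι) : T (ν a) = δ a Ψ := by
  have h := hF.time_tangent a
  have e : ∀ b, ν b * (T (δ a (X b)) - δ a (T (X b))) = (δ a Ψ + ν a - T (ν a)) * (ν b * ν b)
      + Ψ * (ν b * shape ν δ a b) - ν b * (if a = b then 1 else 0) - ν a * (ν b * T (ν b)) :=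
    fun b => by rw [hF.commutator_position]; ring
  simp only [e, Finset.sum_add_distrib, Finset.sum_sub_distrib, ← Finset.mul_sum,
    hF.norm, hF.shape_normal, hF.normal_time_normal] at h
  simp only [mul_ite, mul_one, mul_zero, Finset.sum_ite_eq, Finset.mem_univ, if_true] at h
  linear_combination -h

theorem time_deriv (a : ι) (f : A) : T (δ a f) = δ a (T f)
    + Ψ * ∑ b, shape ν δ a b * δ b f - δ a f - ν a * ∑ b, δ b Ψ * δ b f := by
  have h := hF.time_comm a f
  have e : ∀ b, (T (δ a (X b)) - δ a (T (X b))) * δ b f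
      = (δ a Ψ + ν a - T (ν a)) * (ν b * δ b f)
      + Ψ * (shape ν δ a b * δ b f) - (if a = b then 1 else 0) * δ b f
      - ν a * (δ b Ψ * δ b f) :=
    fun b => by rw [hF.commutator_position, hF.time_normal b]; ring
  simp only [e, Finset.sum_add_distrib, Finset.sum_sub_distrib, ← Finset.mul_sum,
    hF.normal] at h
  simp only [ite_mul, one_mul, zero_mul, Finset.sum_ite_eq, Finset.mem_univ, if_true] at h
  linear_combination h

/-- Trace of the evolution of δ_a ν_a. The term −H is the scaling weight of curvature under the
dilation part of the flow. -/
theorem time_meanCurv :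
    T (meanCurv ν δ) = lap δ Ψ + Ψ * normSq ν δ - meanCurv ν δ := by
  have e : ∀ a, T (shape ν δ a a) = δ a (δ a Ψ) + Ψ * ∑ b, shape ν δ a b * shape ν δ a b
      - shape ν δ a a - ∑ b, δ b Ψ * (ν a * shape ν δ a b) := fun a => by
    have := hF.time_deriv a (ν a)
    rw [hF.time_normal] at this
    rw [show T (shape ν δ a a) = T (δ a (ν a)) from rfl, this]
    have s : ∀ b, δ b (ν a) = shape ν δ a b := fun b => hF.symm b a
    simp only [s]
    rw [Finset.mul_sum (a := ν a)]
    congr 1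
    exact Finset.sum_congr rfl fun b _ => by ring
  have z : ∑ a, ∑ b, δ b Ψ * (ν a * shape ν δ a b) = 0 := by
    rw [Finset.sum_comm]
    refine Finset.sum_eq_zero fun b _ => ?_
    rw [← Finset.mul_sum, hF.normal_shape, mul_zero]
  simp only [meanCurv, map_sum, e, Finset.sum_add_distrib, Finset.sum_sub_distrib, z,
    ← Finset.mul_sum, sub_zero, lap, normSq]

theorem time_support :
    T (support X ν) = support X ν - Ψ + ∑ a, X a * δ a Ψ := by
  have e : ∀ a, T (X a * ν a) = X a * ν a - Ψ * (ν a * ν a) + X a * δ a Ψ := fun a => by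
    rw [Derivation.leibniz, hF.time_normal, hF.time_position]
    simp only [smul_eq_mul]; ring
  simp only [support, map_sum, e, Finset.sum_add_distrib, Finset.sum_sub_distrib,
    ← Finset.mul_sum, hF.norm, mul_one]

theorem time_radiusSq :
    T (∑ a, X a * X a) = 2 * (∑ a, X a * X a - Ψ * support X ν) := by
  have e : ∀ a, T (X a * X a) = 2 * (X a * X a) - 2 * Ψ * (X a * ν a) := fun a => by
    rw [Derivation.leibniz, hF.time_position]
    simp only [smul_eq_mul]; ring
  simp only [support, map_sum, e, Finset.sum_sub_distrib, ← Finset.mul_sum]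
  ring

end IsFlowFrame

end FlowFrame

/-! ### Constructing the frames from a parametrization. -/

section Coordinates

open Matrix

variable {ι κ A : Type*} [Fintype ι] [DecidableEq ι] [Fintype κ] [DecidableEq κ] [CommRing A]

/-- Stacking J on ν gives a square matrix with an explicit right inverse. Over a commutative ring it
is also a left inverse, and multiplying in that order splits the identity into tangential and normal
projections. -/
theorem projection_add_normal (J : Matrix κ ι A) (ν : ι → A)
    (hcard : Fintype.card ι = Fintype.card κ + 1) (hG : IsUnit (J * Jᵀ).det)
    (hJ : J *ᵥ ν = 0) (hν : ν ⬝ᵥ ν = 1) :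
    Jᵀ * (J * Jᵀ)⁻¹ * J + vecMulVec ν ν = 1 := by
  have h1 : fromRows J (replicateRow Unit ν) *
      fromCols (Jᵀ * (J * Jᵀ)⁻¹) (replicateCol Unit ν) = 1 := by
    rw [fromRows_mul_fromCols]
    have hJ' : J * replicateCol Unit ν = 0 := by
      ext i j; simpa [mul_apply, mulVec, dotProduct] using congrFun hJ i
    have hJ'' : replicateRow Unit ν * (Jᵀ * (J * Jᵀ)⁻¹) = 0 := by
      have : replicateRow Unit ν * Jᵀ = 0 := by
        have := congrArg transpose hJ'
        simpa [transpose_mul] using this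
      rw [← Matrix.mul_assoc, this, Matrix.zero_mul]
    have hn : replicateRow Unit ν * replicateCol Unit ν = 1 := by
      ext i j; simpa [mul_apply, dotProduct] using hν
    rw [hJ', hJ'', hn, ← Matrix.mul_assoc, Matrix.mul_nonsing_inv _ hG, fromBlocks_one]
  replace h1 := (mul_eq_one_comm_of_card_eq (κ ⊕ Unit) ι A (by simp [hcard])).1 h1
  rw [fromCols_mul_fromRows] at h1
  rw [← h1]
  congr 1
  ext i j; simp [mul_apply, vecMulVec_apply]

variable [Algebra ℝ A]

/-- The Jacobian of a parametrization. -/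
def jacobian (D : κ → Derivation ℝ A A) (X : ι → A) : Matrix κ ι A := of fun i a => D i (X a)

/-- The derivatives in the directions of the tangential parts of the coordinate vectors. -/
def coordFrame (D : κ → Derivation ℝ A A) (X : ι → A) (a : ι) : Derivation ℝ A A :=
  ∑ i, ((jacobian D X)ᵀ * (jacobian D X * (jacobian D X)ᵀ)⁻¹) a i • D i

omit [DecidableEq ι] in
theorem coordFrame_apply (D : κ → Derivation ℝ A A) (X : ι → A) (a : ι) (f : A) :
    coordFrame D X a f =
      (((jacobian D X)ᵀ * (jacobian D X * (jacobian D X)ᵀ)⁻¹) *ᵥ fun i => D i f) a := by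
  rw [coordFrame, ← Derivation.coeFnAddMonoidHom_apply, map_sum, Finset.sum_apply]
  rfl

variable {D : κ → Derivation ℝ A A} {X ν : ι → A}

-- A tangential field is recovered from its action on the position vector. This rewrites all
-- commutators in terms of the δ_c.
omit [DecidableEq ι] in
theorem sum_mul_coordFrame (hG : IsUnit (jacobian D X * (jacobian D X)ᵀ).det) (v : κ → A)
    (f : A) : ∑ b, (∑ i, v i * D i (X b)) * coordFrame D X b f = ∑ i, v i * D i f := by
  set J := jacobian D X
  have h1 : ∀ b, ∑ i, v i * D i (X b) = (v ᵥ* J) b := fun b => rfl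
  simp only [h1, coordFrame_apply]
  change (v ᵥ* J) ⬝ᵥ ((Jᵀ * (J * Jᵀ)⁻¹) *ᵥ fun i => D i f) = v ⬝ᵥ fun i => D i f
  rw [← dotProduct_mulVec, mulVec_mulVec, ← Matrix.mul_assoc, Matrix.mul_nonsing_inv _ hG,
    one_mulVec]

omit [DecidableEq ι] in
theorem coordFrame_commutator (D : κ → Derivation ℝ A A) (X : ι → A) (V : Derivation ℝ A A)
    (hV : ∀ i f, V (D i f) = D i (V f)) (a : ι) (f : A) :
    V (coordFrame D X a f) - coordFrame D X a (V f) =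
      ∑ i, V (((jacobian D X)ᵀ * (jacobian D X * (jacobian D X)ᵀ)⁻¹) a i) * D i f := by
  simp only [coordFrame_apply, mulVec, dotProduct, map_sum, Derivation.leibniz, smul_eq_mul, hV,
    Finset.sum_add_distrib]
  rw [add_sub_cancel_left]
  exact Finset.sum_congr rfl fun i _ => mul_comm _ _

-- The second-order parts cancel because coordinate derivatives commute, so the commutator is again
-- a tangential first-order operator.
omit [DecidableEq ι] in
theorem coordFrame_commutator_coordFrame
    (hD : ∀ i j f, D i (D j f) = D j (D i f)) (a b : ι) :
    ∃ v : κ → A, ∀ f, coordFrame D X a (coordFrame D X b f)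
      - coordFrame D X b (coordFrame D X a f) = ∑ i, v i * D i f := by
  set c := (jacobian D X)ᵀ * (jacobian D X * (jacobian D X)ᵀ)⁻¹ with hc
  refine ⟨fun i => coordFrame D X a (c b i) - coordFrame D X b (c a i), fun f => ?_⟩
  have e : ∀ a f, coordFrame D X a f = ∑ i, c a i * D i f := fun a f => coordFrame_apply D X a f
  have key : ∀ a b, coordFrame D X a (coordFrame D X b f)
      = ∑ i, coordFrame D X a (c b i) * D i f + ∑ i, ∑ j, c b i * c a j * D i (D j f) := by
    intro a b
    rw [e b f, map_sum]
    simp only [Derivation.leibniz, smul_eq_mul, Finset.sum_add_distrib]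
    rw [add_comm]
    congr 1
    · exact Finset.sum_congr rfl fun i _ => mul_comm _ _
    · refine Finset.sum_congr rfl fun i _ => ?_
      rw [e a, Finset.mul_sum]
      exact Finset.sum_congr rfl fun j _ => by rw [hD j i]; ring
  rw [key a b, key b a]
  have : ∑ i, ∑ j, c b i * c a j * D i (D j f) = ∑ i, ∑ j, c a i * c b j * D i (D j f) := by
    rw [Finset.sum_comm]
    exact Finset.sum_congr rfl fun i _ => Finset.sum_congr rfl fun j _ => by rw [hD j i]; ring
  rw [this]
  simp only [sub_mul, Finset.sum_sub_distrib]
  ring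

theorem isTangentialFrame_coordFrame (hD : ∀ i j f, D i (D j f) = D j (D i f))
    (hcard : Fintype.card ι = Fintype.card κ + 1)
    (hG : IsUnit (jacobian D X * (jacobian D X)ᵀ).det)
    (hν : ∑ a, ν a * ν a = 1) (hperp : ∀ i, ∑ a, ν a * D i (X a) = 0) :
    IsTangentialFrame X ν (coordFrame D X) := by
  set J := jacobian D X with hJdef
  have hJ : J *ᵥ ν = 0 := by
    ext i
    simpa [mulVec, dotProduct, hJdef, jacobian, mul_comm] using hperp i
  have hproj := projection_add_normal J ν hcard hG hJ hν
  have hpos : ∀ a b, coordFrame D X a (X b) = (if a = b then 1 else 0) - ν a * ν b := by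
    intro a b
    have h := congrFun (congrFun hproj a) b
    rw [Matrix.add_apply, vecMulVec_apply, Matrix.one_apply] at h
    rw [← h, add_sub_cancel_right, coordFrame_apply]
    rfl
  have hnorm : ∀ f, ∑ a, ν a * coordFrame D X a f = 0 := by
    intro f
    simp only [coordFrame_apply]
    change ν ⬝ᵥ ((Jᵀ * (J * Jᵀ)⁻¹) *ᵥ fun i => D i f) = 0
    rw [dotProduct_mulVec, ← vecMul_vecMul, vecMul_transpose, hJ, zero_vecMul, zero_dotProduct]
  have hder : ∀ a, ∑ b, ν b * coordFrame D X a (ν b) = 0 := by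
    intro a
    apply eq_zero_of_two_mul_eq_zero
    have := congrArg (coordFrame D X a) hν
    simp only [map_sum, Derivation.leibniz, smul_eq_mul, Derivation.map_one_eq_zero] at this
    rw [← this, Finset.mul_sum]
    exact Finset.sum_congr rfl fun b _ => by ring
  -- The symmetry of h is not yet available, so its defect is kept as the coefficient of ν_c;
  -- pairing with ν, to which the commutator is orthogonal, then forces it to vanish.
  have hbr : ∀ a b c, coordFrame D X a (coordFrame D X b (X c))
      - coordFrame D X b (coordFrame D X a (X c))
      = ν a * coordFrame D X b (ν c) - ν b * coordFrame D X a (ν c)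
        - (coordFrame D X a (ν b) - coordFrame D X b (ν a)) * ν c := by
    intro a b c
    have h0 : ∀ a b c : ι, coordFrame D X a (if b = c then (1 : A) else 0) = 0 := by
      intro a b c
      split_ifs
      · exact Derivation.map_one_eq_zero _
      · exact map_zero _
    rw [hpos, hpos, map_sub, map_sub, h0, h0]
    simp only [Derivation.leibniz, smul_eq_mul]
    ring
  have hsymm : ∀ a b, coordFrame D X a (ν b) = coordFrame D X b (ν a) := by
    intro a b
    obtain ⟨v, hv⟩ := coordFrame_commutator_coordFrame (X := X) hD a b
    have h0 : ∑ c, ν c * (coordFrame D X a (coordFrame D X b (X c))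
        - coordFrame D X b (coordFrame D X a (X c))) = 0 := by
      simp only [hv, Finset.mul_sum]
      rw [Finset.sum_comm]
      refine Finset.sum_eq_zero fun i _ => ?_
      rw [← mul_zero (v i), ← hperp i, Finset.mul_sum]
      exact Finset.sum_congr rfl fun c _ => by ring
    have e : ∀ c, ν c * (coordFrame D X a (coordFrame D X b (X c))
        - coordFrame D X b (coordFrame D X a (X c))) = ν a * (ν c * coordFrame D X b (ν c))
        - ν b * (ν c * coordFrame D X a (ν c))
        - (coordFrame D X a (ν b) - coordFrame D X b (ν a)) * (ν c * ν c) := fun c => by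
      rw [hbr]; ring
    simp only [e, Finset.sum_sub_distrib, ← Finset.mul_sum, hder, hν] at h0
    linear_combination -h0
  refine ⟨hν, hpos, hnorm, hsymm, fun a b f => ?_⟩
  obtain ⟨v, hv⟩ := coordFrame_commutator_coordFrame (X := X) hD a b
  rw [hv f, ← sum_mul_coordFrame hG v f]
  refine Finset.sum_congr rfl fun c _ => ?_
  rw [← hv (X c), hbr, hsymm a b, sub_self, zero_mul, sub_zero]

theorem isFlowFrame_coordFrame {T : Derivation ℝ A A} {Ψ : A}
    (hD : ∀ i j f, D i (D j f) = D j (D i f)) (hT : ∀ i f, T (D i f) = D i (T f))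
    (hcard : Fintype.card ι = Fintype.card κ + 1)
    (hG : IsUnit (jacobian D X * (jacobian D X)ᵀ).det)
    (hν : ∑ a, ν a * ν a = 1) (hperp : ∀ i, ∑ a, ν a * D i (X a) = 0)
    (hflow : ∀ a, T (X a) = X a - Ψ * ν a) :
    IsFlowFrame X ν (coordFrame D X) T Ψ where
  toIsTangentialFrame := isTangentialFrame_coordFrame hD hcard hG hν hperp
  time_position := hflow
  time_comm a f := by
    simp only [coordFrame_commutator D X T hT, sum_mul_coordFrame hG]
  time_tangent a := by
    simp only [coordFrame_commutator D X T hT, Finset.mul_sum]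
    rw [Finset.sum_comm]
    refine Finset.sum_eq_zero fun i _ => ?_
    rw [← mul_zero (T _), ← hperp i, Finset.mul_sum]
    exact Finset.sum_congr rfl fun c _ => by ring

end Coordinates

/-! ### Inequalities between traces of real matrices. -/

section RealMatrices

variable {ι : Type*} [Fintype ι]

theorem sum_sum_mul_sq_le (m k : ι → ι → ℝ) :
    (∑ a, ∑ b, m a b * k a b) ^ 2 ≤ (∑ a, ∑ b, m a b * m a b) * ∑ a, ∑ b, k a b * k a b := by
  have := Finset.sum_mul_sq_le_sq_mul_sq (Finset.univ : Finset (ι × ι))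
    (fun p => m p.1 p.2) (fun p => k p.1 p.2)
  simpa only [← Finset.univ_product_univ, Finset.sum_product, sq] using this

theorem sum_sq_matrix_sq_le (m : ι → ι → ℝ) :
    ∑ a, ∑ b, (∑ c, m a c * m c b) * (∑ c, m a c * m c b) ≤
      (∑ a, ∑ b, m a b * m a b) * ∑ a, ∑ b, m a b * m a b := by
  have h : ∀ a b, (∑ c, m a c * m c b) * (∑ c, m a c * m c b)
      ≤ (∑ c, m a c * m a c) * ∑ c, m c b * m c b := fun a b => by
    have := Finset.sum_mul_sq_le_sq_mul_sq Finset.univ (fun c => m a c) (fun c => m c b)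
    simpa only [sq] using this
  calc _ ≤ ∑ a, ∑ b, (∑ c, m a c * m a c) * ∑ c, m c b * m c b :=
        Finset.sum_le_sum fun a _ => Finset.sum_le_sum fun b _ => h a b
    _ = _ := by
        simp only [← Finset.mul_sum, ← Finset.sum_mul]
        congr 1
        exact Finset.sum_comm

theorem quadratic_form_sq_le (m : ι → ι → ℝ) (ξ : ι → ℝ) :
    (∑ a, ∑ b, m a b * (ξ a * ξ b)) ^ 2 ≤
      (∑ a, ∑ b, m a b * m a b) * (∑ a, ξ a * ξ a) ^ 2 := by
  refine (sum_sum_mul_sq_le m fun a b => ξ a * ξ b).trans_eq ?_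
  congr 1
  rw [sq, Finset.sum_mul_sum]
  exact Finset.sum_congr rfl fun a _ => Finset.sum_congr rfl fun b _ => by ring

theorem quadratic_form_le (m : ι → ι → ℝ) (ξ : ι → ℝ) {c : ℝ} (hc : 0 ≤ c)
    (hm : ∑ a, ∑ b, m a b * m a b ≤ c ^ 2) :
    ∑ a, ∑ b, m a b * (ξ a * ξ b) ≤ c * ∑ a, ξ a * ξ a := by
  have h0 : 0 ≤ ∑ a, ξ a * ξ a := Finset.sum_nonneg fun a _ => mul_self_nonneg _
  refine le_of_sq_le_sq ?_ (mul_nonneg hc h0)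
  calc _ ≤ _ := quadratic_form_sq_le m ξ
    _ ≤ c ^ 2 * (∑ a, ξ a * ξ a) ^ 2 := by gcongr
    _ = _ := by ring

/-- `H |h|² - tr h³ ≥ (H² - |h|²) H / (2 (n + 1))`. -/
theorem trace_mul_norm_sub_trace_cube_ge (m : ι → ι → ℝ)
    (hH : 0 < ∑ a, m a a) (hD : 0 < (∑ a, m a a) ^ 2 - ∑ a, ∑ b, m a b * m a b) :
    ((∑ a, m a a) ^ 2 - ∑ a, ∑ b, m a b * m a b) * (∑ a, m a a) ≤
      2 * (Fintype.card ι : ℝ) * ((∑ a, m a a) * (∑ a, ∑ b, m a b * m a b)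
        - ∑ a, ∑ b, m a b * ∑ c, m a c * m c b) := by
  classical
  set H := ∑ a, m a a
  set N := ∑ a, ∑ b, m a b * m a b with hN
  set t := ∑ a, ∑ b, m a b * ∑ c, m a c * m c b
  set d : ℝ := (Fintype.card ι : ℝ)
  have hN0 : 0 ≤ N := Finset.sum_nonneg fun a _ => Finset.sum_nonneg fun b _ =>
    mul_self_nonneg _
  set r := Real.sqrt N with hr
  have hr0 : 0 ≤ r := Real.sqrt_nonneg _
  have hrN : r ^ 2 = N := Real.sq_sqrt hN0
  have ht : t ≤ r * N := by
    refine le_of_sq_le_sq ?_ (mul_nonneg hr0 hN0)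
    calc t ^ 2 ≤ N * (N * N) := (sum_sum_mul_sq_le m _).trans
          (mul_le_mul_of_nonneg_left (sum_sq_matrix_sq_le m) hN0)
      _ = (r * N) ^ 2 := by rw [mul_pow, hrN]; ring
  -- With r = |m|, Cauchy–Schwarz gives tr m³ ≤ r³, and positivity of H² − r² and of H gives r < H.
  have hrH : r < H := by nlinarith
  have htr : H ^ 2 ≤ d * N := by
    have h1 := sum_sum_mul_sq_le m (fun a b => if a = b then 1 else 0)
    simp only [mul_ite, mul_one, mul_zero, Finset.sum_ite_eq, Finset.mem_univ, if_true] at h1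
    calc H ^ 2 ≤ _ := h1
      _ = d * N := by simp [d, hN, mul_comm]
  have hd : 0 ≤ d := by positivity
  have h2 : 2 * d * (H * N - t) ≥ 2 * d * ((H - r) * N) := by
    have : (H - r) * N ≤ H * N - t := by nlinarith
    exact mul_le_mul_of_nonneg_left this (by positivity)
  have h3 : 2 * d * ((H - r) * N) ≥ 2 * (H - r) * H ^ 2 := by nlinarith
  -- The difference of the two sides is H(H − r)².
  have h4 : 2 * (H - r) * H ^ 2 ≥ (H ^ 2 - N) * H := by
    rw [← hrN]
    have : 0 ≤ H * (H - r) ^ 2 := by positivity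
    nlinarith
  linarith

/-- The trace of a matrix annihilating a unit vector. -/
theorem trace_sq_le_of_annihilates [DecidableEq ι] (m : ι → ι → ℝ) (v : ι → ℝ)
    (hv : ∑ a, v a * v a = 1) (hm : ∀ a, ∑ b, v b * m a b = 0) :
    (∑ a, m a a) ^ 2 ≤ (Fintype.card ι - 1) * ∑ a, ∑ b, m a b * m a b := by
  -- Cauchy–Schwarz against the projection orthogonal to v, whose squared norm is one less than the
  -- number of indices; the identity would give a constant too large by one.
  have h1 := sum_sum_mul_sq_le m (fun a b => (if a = b then 1 else 0) - v a * v b)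
  have e1 : ∑ a, ∑ b, m a b * ((if a = b then 1 else 0) - v a * v b) = ∑ a, m a a := by
    refine Finset.sum_congr rfl fun a _ => ?_
    simp only [mul_sub, Finset.sum_sub_distrib, mul_ite, mul_one, mul_zero, Finset.sum_ite_eq,
      Finset.mem_univ, if_true]
    have : ∑ b, m a b * (v a * v b) = v a * ∑ b, v b * m a b := by
      rw [Finset.mul_sum]; exact Finset.sum_congr rfl fun b _ => by ring
    rw [this, hm, mul_zero, sub_zero]
  have e2 : ∑ a, ∑ b, (((if a = b then 1 else 0) - v a * v b) *
      ((if a = b then 1 else 0) - v a * v b) : ℝ) = Fintype.card ι - 1 := by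
    have : ∀ a b, (((if a = b then 1 else 0) - v a * v b) *
        ((if a = b then 1 else 0) - v a * v b) : ℝ) =
        (if a = b then 1 - 2 * (v a * v b) else 0) + v a * v a * (v b * v b) := fun a b => by
      split_ifs <;> ring
    simp only [this, Finset.sum_add_distrib, Finset.sum_ite_eq, Finset.mem_univ, if_true,
      ← Finset.mul_sum, ← Finset.sum_mul, hv, Finset.sum_sub_distrib]
    simp
    ring
  rw [e1, e2] at h1
  linarith

end RealMatrices

/-! ### Second-order conditions and ellipticity on the 2-convex cone. -/

section Ellipticity

open Matrix

variable {ι κ A : Type*} [Fintype ι] [DecidableEq ι] [Fintype κ] [DecidableEq κ] [CommRing A]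
  [Algebra ℝ A]

omit [DecidableEq ι] in
theorem map_coordFrame_eq_zero (e : A →ₐ[ℝ] ℝ) (D : κ → Derivation ℝ A A) (X : ι → A) {q : A}
    (hq : ∀ i, e (D i q) = 0) (a : ι) : e (coordFrame D X a q) = 0 := by
  simp [coordFrame_apply, mulVec, dotProduct, hq]

omit [DecidableEq ι] in
/-- At a critical point with nonnegative Hessian, contractions of the second derivatives with
nonnegative forms are nonnegative. -/
theorem contract_hessian_nonneg (e : A →ₐ[ℝ] ℝ) (D : κ → Derivation ℝ A A) (X : ι → A) {q : A}
    (hq : ∀ i, e (D i q) = 0)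
    (hess : ∀ ξ : κ → ℝ, 0 ≤ ∑ i, ∑ j, ξ i * ξ j * e (D i (D j q)))
    (P : Matrix ι ι ℝ) (hP : P.PosSemidef) :
    0 ≤ ∑ a, ∑ b, P a b * e (coordFrame D X a (coordFrame D X b q)) := by
  obtain ⟨N, v, rfl⟩ := Matrix.posSemidef_iff_eq_sum_vecMulVec.1 hP
  set C : Matrix ι κ A := (jacobian D X)ᵀ * (jacobian D X * (jacobian D X)ᵀ)⁻¹
  have e1 : ∀ a f, coordFrame D X a f = ∑ i, C a i * D i f := fun a f => coordFrame_apply D X a f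
  -- Derivatives of the frame coefficients multiply first derivatives of q, which vanish here, so
  -- only the coordinate Hessian survives.
  have e2 : ∀ a b, e (coordFrame D X a (coordFrame D X b q)) =
      ∑ i, ∑ j, e (C a i) * e (C b j) * e (D i (D j q)) := by
    intro a b
    rw [e1 b q, map_sum, map_sum, Finset.sum_comm]
    refine Finset.sum_congr rfl fun j _ => ?_
    simp only [Derivation.leibniz, smul_eq_mul, map_add, map_mul, hq, zero_mul, add_zero, e1 a,
      map_sum]
    exact Finset.sum_congr rfl fun i _ => by ring
  have e3 : ∑ a, ∑ b, (∑ k, vecMulVec (v k) (star (v k))) a b *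
      e (coordFrame D X a (coordFrame D X b q)) =
      ∑ k, ∑ i, ∑ j, (∑ a, v k a * e (C a i)) * (∑ b, v k b * e (C b j)) * e (D i (D j q)) := by
    simp only [Matrix.sum_apply, vecMulVec_apply, star_trivial, e2,
      Finset.sum_mul_sum]
    simp only [Finset.sum_mul, Finset.mul_sum]
    have c1 : ∀ f : ι → ι → Fin N → κ → κ → ℝ, ∑ a, ∑ b, ∑ k, ∑ i, ∑ j, f a b k i j =
        ∑ k, ∑ i, ∑ j, ∑ a, ∑ b, f a b k i j := fun f => by
      simp only [← Finset.sum_product']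
      exact Finset.sum_equiv
        ⟨fun p => ⟨p.2.2.1, p.2.2.2.1, p.2.2.2.2, p.1, p.2.1⟩,
          fun p => ⟨p.2.2.2.1, p.2.2.2.2, p.1, p.2.1, p.2.2.1⟩, fun _ => rfl, fun _ => rfl⟩
        (by simp) (by simp)
    refine (c1 fun a b k i j => v k a * v k b * (e (C a i) * e (C b j) * e (D i (D j q)))).trans ?_
    exact Finset.sum_congr rfl fun k _ => Finset.sum_congr rfl fun i _ =>
      Finset.sum_congr rfl fun j _ => Finset.sum_congr rfl fun a _ =>
      Finset.sum_congr rfl fun b _ => by ring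
  rw [e3]
  exact Finset.sum_nonneg fun k _ => hess fun i => ∑ a, v k a * e (C a i)

/-- First and second order conditions for `q` at a point where it first touches its minimum. -/
structure IsTouching (e : A →ₐ[ℝ] ℝ) (δ : ι → Derivation ℝ A A) (T : Derivation ℝ A A) (q : A) :
    Prop where
  critical : ∀ a, e (δ a q) = 0
  hessian : ∀ P : Matrix ι ι ℝ, P.PosSemidef → 0 ≤ ∑ a, ∑ b, P a b * e (δ a (δ b q))
  time : e (T q) ≤ 0

theorem IsTouching.lap_nonneg {e : A →ₐ[ℝ] ℝ} {δ : ι → Derivation ℝ A A} {T : Derivation ℝ A A}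
    {q : A} (hq : IsTouching e δ T q) : 0 ≤ e (lap δ q) := by
  have := hq.hessian 1 Matrix.PosSemidef.one
  simpa [Matrix.one_apply, lap] using this

/-- H·1 − h is positive semidefinite: |h| ≤ H bounds every eigenvalue of h by H. Contracting this
form with the Hessian gives the operator L. -/
theorem IsTouching.elliptic_nonneg {X ν : ι → A} {e : A →ₐ[ℝ] ℝ} {δ : ι → Derivation ℝ A A}
    {T : Derivation ℝ A A} (hF : IsTangentialFrame X ν δ)
    (hH : 0 < e (meanCurv ν δ))
    (hD : 0 < e (meanCurv ν δ * meanCurv ν δ - normSq ν δ)) {q : A}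
    (hq : IsTouching e δ T q) : 0 ≤ e (meanCurv ν δ * lap δ q - shapeLap ν δ q) := by
  classical
  set m : ι → ι → ℝ := fun a b => e (shape ν δ a b) with hm
  set H := e (meanCurv ν δ) with hHdef
  have hN : e (normSq ν δ) = ∑ a, ∑ b, m a b * m a b := by simp [normSq, hm]
  have hP : (H • (1 : Matrix ι ι ℝ) - Matrix.of m).PosSemidef := by
    refine Matrix.PosSemidef.of_dotProduct_mulVec_nonneg ?_ fun ξ => ?_
    · ext a b
      simp [Matrix.one_apply, hm, hF.shape_symm a b, eq_comm]
    · have h1 := quadratic_form_le m ξ hH.le (by rw [← hN]; simp at hD; nlinarith)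
      have e1 : star ξ ⬝ᵥ (Matrix.of m *ᵥ ξ) = ∑ a, ∑ b, m a b * (ξ a * ξ b) := by
        simp only [dotProduct, mulVec, star_trivial, Finset.mul_sum, Matrix.of_apply]
        exact Finset.sum_congr rfl fun a _ => Finset.sum_congr rfl fun b _ => by ring
      have e2 : star ξ ⬝ᵥ ((H • (1 : Matrix ι ι ℝ)) *ᵥ ξ) = H * ∑ a, ξ a * ξ a := by
        rw [smul_mulVec, one_mulVec, dotProduct_smul]; simp [dotProduct]
      rw [sub_mulVec, dotProduct_sub, e1, e2]
      linarith
  have h := hq.hessian _ hP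
  have e3 : ∑ a, ∑ b, (H • (1 : Matrix ι ι ℝ) - Matrix.of m) a b * e (δ a (δ b q)) =
      e (meanCurv ν δ * lap δ q - shapeLap ν δ q) := by
    simp only [Matrix.sub_apply, Matrix.smul_apply, Matrix.one_apply, Matrix.of_apply, sub_mul,
      Finset.sum_sub_distrib, map_sub, map_mul, lap, shapeLap, map_sum, hm, smul_eq_mul, mul_ite,
      mul_one, mul_zero, ite_mul, zero_mul, Finset.sum_ite_eq, Finset.mem_univ, if_true,
      Finset.mul_sum]
    rfl
  rwa [e3] at h

end Ellipticity

/-! ### Contradictions at touching points. -/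

section PointwiseEstimates

variable {ι A : Type*} [Fintype ι] [DecidableEq ι] [CommRing A] [Algebra ℝ A]

omit [DecidableEq ι] in
theorem lap_mul (δ : ι → Derivation ℝ A A) (f g : A) :
    lap δ (f * g) = f * lap δ g + g * lap δ f + 2 * ∑ a, δ a f * δ a g := by
  simp only [lap, Derivation.leibniz, smul_eq_mul, map_add, Finset.mul_sum,
    ← Finset.sum_add_distrib]
  exact Finset.sum_congr rfl fun a _ => by ring

omit [DecidableEq ι] in
theorem lap_algebraMap_mul (δ : ι → Derivation ℝ A A) (c : ℝ) (f : A) :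
    lap δ (algebraMap ℝ A c * f) = algebraMap ℝ A c * lap δ f := by
  simp only [lap, Derivation.leibniz, smul_eq_mul, Derivation.map_algebraMap, mul_zero, add_zero,
    Finset.mul_sum]

/-- The final arithmetic of the curvature estimate, with m = 2(n + 1), f = F, r = R, σ = s, h = H
and c = C/(n(n−1)F). Since c ≥ fh/m and h ≥ Ka, the cubic term on the left has size K²a²fr/m and
beats the right side, leaving KU + h ≤ 0. -/
theorem touching_meanCurv_arith {m f r σ S C1 a U K α h c : ℝ} (hm : 0 < m) (hf : 0 < f)
    (hr : 0 < r) (hσ : 0 ≤ σ) (hC1 : 0 ≤ C1) (ha : 0 < a) (hU : 2 * a ≤ U) (hK : 1 ≤ K)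
    (hs : σ ≤ S) (hh : h = K * (U - a))
    (hbig : m * (2 + 2 * α + S * C1) ≤ K * a ^ 2) (hpos : 0 < h) (hc : f * h / m ≤ c)
    (h5 : K * U + h + r * (K * a) * c ≤ f * r * (2 * K + σ * C1 + 2 * K * α)) : False := by
  have hK0 : 0 < K := by linarith
  have hKU : 0 < K * U := mul_pos hK0 (by linarith)
  have h7 : r * (K * a) * (f * h / m) ≤ r * (K * a) * c :=
    mul_le_mul_of_nonneg_left hc (by positivity)
  have h8 : 2 * K + σ * C1 + 2 * K * α ≤ K * a * h / m := by
    rw [le_div_iff₀ hm]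
    have b1 : σ * C1 ≤ K * (S * C1) := by
      have h1 : σ * C1 ≤ S * C1 := mul_le_mul_of_nonneg_right hs hC1
      have h0 : 0 ≤ S * C1 := le_trans (by positivity) h1
      exact h1.trans (le_mul_of_one_le_left h0 hK)
    have b2 : K * a ≤ h := by
      rw [hh]; exact mul_le_mul_of_nonneg_left (by linarith) hK0.le
    calc (2 * K + σ * C1 + 2 * K * α) * m ≤ (2 * K + K * (S * C1) + 2 * K * α) * m :=
          mul_le_mul_of_nonneg_right (by linarith) hm.le
      _ = K * (m * (2 + 2 * α + S * C1)) := by ring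
      _ ≤ K * (K * a ^ 2) := mul_le_mul_of_nonneg_left hbig hK0.le
      _ = K * a * (K * a) := by ring
      _ ≤ K * a * h := mul_le_mul_of_nonneg_left b2 (by positivity)
  have h9 : f * r * (2 * K + σ * C1 + 2 * K * α) ≤ f * r * (K * a * h / m) :=
    mul_le_mul_of_nonneg_left h8 (by positivity)
  have h10 : f * r * (K * a * h / m) = r * (K * a) * (f * h / m) := by ring
  linarith

omit [DecidableEq ι] in
theorem map_radiusSq (e : A →ₐ[ℝ] ℝ) (X : ι → A) :
    e (∑ a, X a * X a) = ∑ a, e (X a) * e (X a) := by simp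

/-- A point of a 2-convex solution of the flow: `F = σ₂^{1/2}`, `R = r^α`, `s = r⁻²`. -/
structure IsFlowPoint (e : A →ₐ[ℝ] ℝ) (n : ℕ) (α : ℝ) (X ν : ι → A) (δ : ι → Derivation ℝ A A)
    (T : Derivation ℝ A A) (F R s : A) : Prop extends IsFlowFrame X ν δ T (F * R) where
  card : Fintype.card ι = n + 1
  two_le : 2 ≤ n
  two_sigma : meanCurv ν δ * meanCurv ν δ - normSq ν δ = algebraMap ℝ A (n * (n - 1)) * (F * F)
  speed_pos : 0 < e F
  meanCurv_pos : 0 < e (meanCurv ν δ)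
  weight_pos : 0 < e R
  inv_radiusSq : s * (∑ a, X a * X a) = 1
  deriv_weight : ∀ a, δ a R = algebraMap ℝ A (α / 2) * (R * s) * δ a (∑ b, X b * X b)

namespace IsFlowPoint

variable {e : A →ₐ[ℝ] ℝ} {n : ℕ} {α : ℝ} {X ν : ι → A} {δ : ι → Derivation ℝ A A}
  {T : Derivation ℝ A A} {F R s : A} (hP : IsFlowPoint e n α X ν δ T F R s)
include hP

local notation "H" => meanCurv ν δ
local notation "N" => normSq ν δ
local notation "u" => support X ν
local notation "Q" => ∑ a, X a * X a

theorem dim_mul_pos : 0 < (n : ℝ) * (n - 1) := by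
  have : (2 : ℝ) ≤ n := by exact_mod_cast hP.two_le
  nlinarith

theorem ev_two_sigma : e H * e H - e N = n * (n - 1) * (e F * e F) := by
  have := congrArg e hP.two_sigma
  simpa using this

theorem two_sigma_pos : 0 < e (H * H - N) := by
  have := mul_pos hP.dim_mul_pos (mul_pos hP.speed_pos hP.speed_pos)
  simpa [hP.ev_two_sigma] using this

theorem normSq_le : e N ≤ e H ^ 2 := by
  have := hP.two_sigma_pos
  simp only [map_sub, map_mul] at this
  nlinarith

/-- Newton's inequality `σ₂^{1/2} ≤ σ₁`. -/
theorem dim_mul_speed_le : n * e F ≤ e H := by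
  have h := trace_sq_le_of_annihilates (fun a b => e (shape ν δ a b)) (fun a => e (ν a))
    (by simpa using congrArg e hP.norm) (fun a => by simpa using congrArg e (hP.shape_normal a))
  have hN : e N = ∑ a, ∑ b, e (shape ν δ a b) * e (shape ν δ a b) := by simp [normSq]
  have hH : e H = ∑ a, e (shape ν δ a a) := by simp [meanCurv]
  rw [← hN, ← hH, hP.card] at h
  push_cast at h
  have h2 := hP.ev_two_sigma
  have hn : (2 : ℝ) ≤ n := by exact_mod_cast hP.two_le
  refine le_of_sq_le_sq ?_ hP.meanCurv_pos.le
  have : (n - 1 : ℝ) * (n * e F) ^ 2 ≤ (n - 1) * e H ^ 2 := by nlinarith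
  exact le_of_mul_le_mul_left this (by linarith)

/-- The cubic term `F^{ij} h_{ik} h_{kj}` dominates `F H`. -/
theorem cubic_ge : n * (n - 1) * (e F * e F) * e H ≤
    2 * (n + 1) * (e H * e N - e (traceCube ν δ)) := by
  have hN : e N = ∑ a, ∑ b, e (shape ν δ a b) * e (shape ν δ a b) := by simp [normSq]
  have hH : e H = ∑ a, e (shape ν δ a a) := by simp [meanCurv]
  have ht : e (traceCube ν δ) = ∑ a, ∑ b, e (shape ν δ a b) *
      ∑ c, e (shape ν δ a c) * e (shape ν δ c b) := by simp [traceCube, shapeSq]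
  have h := trace_mul_norm_sub_trace_cube_ge (fun a b => e (shape ν δ a b))
    (by rw [← hH]; exact hP.meanCurv_pos)
    (by rw [← hH, ← hN]; have := hP.two_sigma_pos; simp only [map_sub, map_mul] at this
        linarith [sq (e H)])
  rw [← hN, ← hH, ← ht, hP.card, sq, hP.ev_two_sigma] at h
  push_cast at h
  exact h

theorem support_sq_le : e u * e u ≤ e Q := by
  have h := congrArg e (hP.sum_tangential_position_sq)
  simp only [map_sub, map_mul, map_sum] at h
  have : 0 ≤ ∑ a, (e (X a) - e u * e (ν a)) * (e (X a) - e u * e (ν a)) :=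
    Finset.sum_nonneg fun a _ => mul_self_nonneg _
  rw [map_radiusSq]
  linarith

theorem ev_inv_mul : e s * e Q = 1 := by
  rw [← map_mul, hP.inv_radiusSq, map_one]

theorem radiusSq_pos : 0 < e Q := by
  have h0 : 0 ≤ e Q := by
    rw [map_radiusSq]; exact Finset.sum_nonneg fun a _ => mul_self_nonneg _
  refine lt_of_le_of_ne h0 fun h => ?_
  have := hP.ev_inv_mul
  rw [← h] at this
  simp at this

theorem inv_radiusSq_pos : 0 < e s := by
  have := hP.ev_inv_mul
  have h := hP.radiusSq_pos
  by_contra hs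
  nlinarith

theorem support_sq_eq_of_critical (hc : ∀ a, e (δ a Q) = 0) : e u * e u = e Q := by
  have h := congrArg e (hP.sum_tangential_position_sq)
  have h2 : ∀ a, e (X a - u * ν a) = 0 := fun a => by
    have := hc a
    rw [hP.deriv_radiusSq, map_mul, map_ofNat] at this
    linarith
  have z : e (∑ a, (X a - u * ν a) * (X a - u * ν a)) = 0 := by
    rw [map_sum]
    exact Finset.sum_eq_zero fun a _ => by rw [map_mul, h2, mul_zero]
  rw [z, map_sub, map_mul] at h
  linarith

/-- No interior maximum of `r - εt` above `1`. -/
theorem false_of_touching_radius_above {q : A} (hq : IsTouching e δ T q) {ε : ℝ} (hε : 0 < ε)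
    (hδ : ∀ a, δ a q = -δ a Q) (hT : T q = algebraMap ℝ A ε - T Q)
    (hR : e Q ≤ e R) (hQ : 1 ≤ e Q) : False := by
  have hc : ∀ a, e (δ a Q) = 0 := fun a => by
    have := hq.critical a
    rw [hδ, map_neg] at this; linarith
  have hu := hP.support_sq_eq_of_critical hc
  have hell := hq.elliptic_nonneg hP.toIsTangentialFrame hP.meanCurv_pos hP.two_sigma_pos
  have e1 : H * lap δ q - shapeLap ν δ q = -(H * lap δ Q - shapeLap ν δ Q) := by
    simp only [lap, shapeLap, hδ, map_neg, Finset.sum_neg_distrib, mul_neg]; ring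
  rw [e1, hP.lap_radiusSq, hP.shapeLap_radiusSq, hP.card] at hell
  have h2 := hP.ev_two_sigma
  have hH := hP.dim_mul_speed_le
  have ht := hq.time
  rw [hT, hP.time_radiusSq] at ht
  simp only [map_sub, map_mul, map_neg, map_ofNat, map_natCast, map_one, AlgHom.commutes,
    Algebra.algebraMap_self, RingHom.id_apply] at hell ht
  push_cast at hell
  have hF := hP.speed_pos
  have hn : (2 : ℝ) ≤ n := by exact_mod_cast hP.two_le
  have hnn := hP.dim_mul_pos
  set f := e F
  set U := e u
  have h3 : (n - 1 : ℝ) * e H ≤ U * (n * (n - 1) * (f * f)) := by rw [← h2]; linarith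
  -- The elliptic inequality reads (n−1)H ≤ u·n(n−1)F²; combine it with H ≥ nF and cancel one F.
  have h4 : 1 ≤ U * f := by
    have h5 : (n * (n - 1) * f) * 1 ≤ (n * (n - 1) * f) * (U * f) := by nlinarith
    exact le_of_mul_le_mul_left h5 (by positivity)
  have hU : 0 < U := by
    by_contra hneg
    nlinarith
  have h6 : f * (U * U) ≤ f * e R := by rw [hu]; exact mul_le_mul_of_nonneg_left hR hF.le
  have h7 : U * (f * (U * U)) ≤ U * (f * e R) := mul_le_mul_of_nonneg_left h6 hU.le
  have h8 : U * U * 1 ≤ U * U * (U * f) := mul_le_mul_of_nonneg_left h4 (by positivity)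
  nlinarith

/-- No interior minimum of `r + εt` below `1`. -/
theorem false_of_touching_radius_below {q : A} (hq : IsTouching e δ T q) {ε : ℝ} (hε : 0 < ε)
    (hδ : ∀ a, δ a q = δ a Q) (hT : T q = algebraMap ℝ A ε + T Q)
    (hR : e R ≤ e Q) : False := by
  have hc : ∀ a, e (δ a Q) = 0 := fun a => by
    have := hq.critical a
    rwa [hδ] at this
  have hu := hP.support_sq_eq_of_critical hc
  have hell := hq.lap_nonneg
  have e1 : lap δ q = lap δ Q := by simp only [lap, hδ]
  rw [e1, hP.lap_radiusSq, hP.card] at hell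
  have hH := hP.dim_mul_speed_le
  have ht := hq.time
  rw [hT, hP.time_radiusSq] at ht
  simp only [map_add, map_sub, map_mul, map_ofNat, map_natCast, map_one, AlgHom.commutes,
    Algebra.algebraMap_self, RingHom.id_apply] at hell ht
  push_cast at hell
  have hF := hP.speed_pos
  have hRp := hP.weight_pos
  have hn : (2 : ℝ) ≤ n := by exact_mod_cast hP.two_le
  set f := e F
  set U := e u
  have hU : 0 < U := by
    by_contra hneg
    have : f * e R * U ≤ 0 := mul_nonpos_of_nonneg_of_nonpos (by positivity) (not_lt.1 hneg)
    nlinarith [mul_self_nonneg U]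
  -- Here the Laplacian alone suffices: uH ≤ n, and H ≥ nF.
  have h4 : U * f ≤ 1 := by
    have : n * (U * f) ≤ n * 1 := by nlinarith
    exact le_of_mul_le_mul_left this (by linarith)
  have h6 : f * e R ≤ f * (U * U) := by rw [hu]; exact mul_le_mul_of_nonneg_left hR hF.le
  have h7 : U * (f * e R) ≤ U * (f * (U * U)) := mul_le_mul_of_nonneg_left h6 hU.le
  have h8 : U * U * (U * f) ≤ U * U * 1 := mul_le_mul_of_nonneg_left h4 (by positivity)
  nlinarith

/-- The gradient terms of HΔu and ⟨h, ∇²u⟩ combine into half of X·∇(H² − |h|²), which is a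
derivative of F² alone. Neither ∇H nor ∇h survives. -/
theorem elliptic_support : 2 * (H * lap δ u - shapeLap ν δ u) =
    2 * (algebraMap ℝ A (n * (n - 1)) * (F * ∑ c, X c * δ c F))
      + 2 * (algebraMap ℝ A (n * (n - 1)) * (F * F)) - 2 * (u * (H * N - traceCube ν δ)) := by
  have hd : ∑ c, X c * δ c (H * H - N) =
      2 * (algebraMap ℝ A (n * (n - 1)) * (F * ∑ c, X c * δ c F)) := by
    rw [hP.two_sigma]
    simp only [Derivation.leibniz, Derivation.map_algebraMap, smul_eq_mul, mul_zero, add_zero,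
      Finset.mul_sum]
    exact Finset.sum_congr rfl fun c _ => by ring
  have hd2 : ∑ c, X c * δ c (H * H - N) = 2 * (H * ∑ c, X c * δ c H) - ∑ c, X c * δ c N := by
    simp only [map_sub, Derivation.leibniz, smul_eq_mul, Finset.mul_sum,
      ← Finset.sum_sub_distrib]
    exact Finset.sum_congr rfl fun c _ => by ring
  rw [← hd, hd2, ← hP.two_sigma, mul_sub, hP.shapeLap_support, hP.lap_support]
  ring

theorem ev_elliptic_support : e (H * lap δ u - shapeLap ν δ u) =
    n * (n - 1) * e F * e (∑ c, X c * δ c F)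
      + n * (n - 1) * (e F * e F) - e u * (e H * e N - e (traceCube ν δ)) := by
  have h := congrArg e hP.elliptic_support
  simp only [map_sub, map_add, map_mul, map_ofNat, AlgHom.commutes, Algebra.algebraMap_self,
    RingHom.id_apply] at h ⊢
  linarith

theorem deriv_weight' (a : ι) :
    δ a R = algebraMap ℝ A α * (R * s) * (X a - u * ν a) := by
  have : algebraMap ℝ A (α / 2) * 2 = algebraMap ℝ A α := by
    rw [← map_ofNat (algebraMap ℝ A) 2, ← map_mul]; congr 1; ring
  rw [hP.deriv_weight, hP.deriv_radiusSq, ← this]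
  ring

theorem position_mul_deriv_weight :
    ∑ a, X a * δ a R = algebraMap ℝ A α * (R * s) * (Q - u * u) := by
  have : ∀ a, X a * δ a R = algebraMap ℝ A α * (R * s) * (X a * X a - u * (X a * ν a)) :=
    fun a => by rw [hP.deriv_weight']; ring
  simp only [this, ← Finset.mul_sum, Finset.sum_sub_distrib]
  rfl

theorem ev_time_support : e (T u) = e u - e F * e R + e R * e (∑ a, X a * δ a F)
    + α * (e F * e R) * (1 - e s * (e u * e u)) := by
  have h1 : ∑ a, X a * δ a (F * R) = R * ∑ a, X a * δ a F + F * ∑ a, X a * δ a R := by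
    simp only [Derivation.leibniz, smul_eq_mul, Finset.mul_sum, ← Finset.sum_add_distrib]
    exact Finset.sum_congr rfl fun a _ => by ring
  have h2 := hP.ev_inv_mul
  rw [hP.time_support, h1, hP.position_mul_deriv_weight]
  simp only [map_sub, map_add, map_mul _ F R, map_mul _ R, map_mul _ F,
    map_mul _ (algebraMap ℝ A α * _), map_mul _ (algebraMap ℝ A α), map_mul _ u, AlgHom.commutes,
    Algebra.algebraMap_self, RingHom.id_apply]
  linear_combination (α * (e F * e R)) * h2

/-- The support function has no small interior minimum. -/
theorem false_of_touching_support (hα : 2 ≤ α) {q : A} (hq : IsTouching e δ T q)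
    (hδ : ∀ a, δ a q = δ a u) (hT : T q = T u) (hu : 0 < e u)
    (hsmall : α ^ 2 * e u ^ 2 * (e R * e s ^ 2) < 1) : False := by
  have hell := hq.elliptic_nonneg hP.toIsTangentialFrame hP.meanCurv_pos hP.two_sigma_pos
  have e1 : H * lap δ q - shapeLap ν δ q = H * lap δ u - shapeLap ν δ u := by
    simp only [lap, shapeLap, hδ]
  rw [e1, hP.ev_elliptic_support] at hell
  have ht := hq.time
  rw [hT, hP.ev_time_support] at ht
  have hcub := hP.cubic_ge
  have hH := hP.dim_mul_speed_le
  have hF := hP.speed_pos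
  have hR := hP.weight_pos
  have hs := hP.inv_radiusSq_pos
  have hk := hP.dim_mul_pos
  have hn : (2 : ℝ) ≤ n := by exact_mod_cast hP.two_le
  set f := e F
  set U := e u
  set r := e R
  set σ := e s
  set y := e (∑ c, X c * δ c F)
  set k : ℝ := n * (n - 1)
  set C := e H * e N - e (traceCube ν δ)
  -- From `cubic_ge` and H ≥ nF, using 2(n + 1) ≤ 4n.
  have hC : k * f * (f * f) ≤ 4 * C := by
    have h1 : k * (f * f) * (n * f) ≤ k * (f * f) * e H :=
      mul_le_mul_of_nonneg_left hH (by positivity)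
    have h3 : 0 ≤ k * (f * f) * f := by positivity
    nlinarith
  have hy : U * (f * f) ≤ 4 * (y + f) := by
    have : (k * f) * (U * (f * f)) ≤ (k * f) * (4 * (y + f)) := by nlinarith
    exact le_of_mul_le_mul_left this (by positivity)
  have h5 : r * (U * (f * f)) ≤ r * (4 * (y + f)) := mul_le_mul_of_nonneg_left hy hR.le
  -- The −FR in ∂ₜu and the −FR from the lower bound on R(X·∇F) are compensated by αFR; this is
  -- where α ≥ 2 enters.
  have h6 : 0 ≤ (α - 2) * (f * r) := mul_nonneg (by linarith) (by positivity)
  have h7 : U * (1 + r * (f * f) / 4 - α * (f * r) * σ * U) ≤ 0 := by nlinarith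
  set b := α * r * σ * U with hb
  have hb2 : b ^ 2 < r := by
    have : b ^ 2 = r * (α ^ 2 * U ^ 2 * (r * σ ^ 2)) := by rw [hb]; ring
    rw [this]; nlinarith
  -- Smallness of u says b² < R, so this quadratic in F lies above the square (1 − bF/2)².
  have h8 : 0 < 1 + r * (f * f) / 4 - b * f := by
    have : (b ^ 2) * (f * f) < r * (f * f) := mul_lt_mul_of_pos_right hb2 (by positivity)
    nlinarith [sq_nonneg (1 - b * f / 2)]
  have h9 : 0 < U * (1 + r * (f * f) / 4 - b * f) := mul_pos hu h8
  rw [hb] at h9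
  nlinarith

/-- The real power r^α enters only through its logarithmic derivative and s·r² = 1, so the
computation stays algebraic. -/
theorem lap_weight : 2 * lap δ R = algebraMap ℝ A α *
    (algebraMap ℝ A (α - 2) * (R * s ^ 2) * (2 * (Q - u * u))
      + R * s * (2 * ((Fintype.card ι : A) - 1 - u * H))) := by
  have hs : ∀ a, δ a s = -(s ^ 2 * δ a Q) := fun a => by
    have h := congrArg (δ a) hP.inv_radiusSq
    rw [Derivation.leibniz, Derivation.map_one_eq_zero] at h
    simp only [smul_eq_mul] at h
    linear_combination s * h - δ a s * hP.inv_radiusSq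
  have h2 : algebraMap ℝ A (α / 2) * 2 = algebraMap ℝ A α := by
    rw [← map_ofNat (algebraMap ℝ A) 2, ← map_mul]; congr 1; ring
  have h3 : algebraMap ℝ A (α - 2) = algebraMap ℝ A α - 2 := by
    rw [map_sub, map_ofNat]
  have e1 : ∀ a, 2 * δ a (δ a R) = algebraMap ℝ A α *
      (algebraMap ℝ A (α - 2) * (R * s ^ 2) * (2 * ((X a - u * ν a) * (X a - u * ν a)))
        + R * s * δ a (δ a Q)) := fun a => by
    rw [hP.deriv_weight a]
    simp only [Derivation.leibniz, Derivation.map_algebraMap, smul_eq_mul, mul_zero, add_zero,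
      hs, hP.deriv_weight a]
    rw [hP.deriv_radiusSq, h3, ← h2]
    ring
  simp only [lap, Finset.mul_sum (a := (2 : A)), e1]
  simp only [← Finset.mul_sum, Finset.sum_add_distrib, hP.sum_tangential_position_sq]
  rw [show ∑ a, δ a (δ a Q) = lap δ Q from rfl, hP.lap_radiusSq]

theorem ev_lap_weight_le (hα : 2 ≤ α) (hu : 0 < e u) :
    e (lap δ R) ≤ α * (α - 2 + n) * (e R * e s) := by
  have h := congrArg e hP.lap_weight
  rw [hP.card] at h
  have hQ := hP.ev_inv_mul
  simp only [map_mul _ (2 : A), map_mul _ (algebraMap ℝ A α), map_add, map_sub e,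
    map_mul _ (algebraMap ℝ A (α - 2) * _), map_mul _ (algebraMap ℝ A (α - 2)), map_mul _ (R * s),
    map_mul _ R, map_mul _ u, map_pow, map_ofNat, map_natCast, map_one, AlgHom.commutes,
    Algebra.algebraMap_self, RingHom.id_apply, Nat.cast_add, Nat.cast_one] at h
  have hR := hP.weight_pos
  have hs := hP.inv_radiusSq_pos
  have hH := hP.meanCurv_pos
  have h1 : 0 ≤ α * ((α - 2) * (e R * e s ^ 2) * (e u * e u)) := by
    have : 0 ≤ α - 2 := by linarith
    positivity
  have h2 : 0 ≤ α * (e R * e s) * (e u * e H) := by positivity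
  have h3 : α * ((α - 2) * (e R * e s ^ 2) * e Q) = α * ((α - 2) * (e R * e s)) := by
    linear_combination (α * ((α - 2) * (e R * e s))) * hQ
  nlinarith

/-- Write kF² = H² − |h|² in Simons' identity and bound |∇_c h|² below by expanding |∇_c h − (∇_c
H/H)h|² ≥ 0. The gradient terms do not merely have a sign: they leave the full square of ∇F − F∇H/H,
which is kept to absorb cross terms later. -/
theorem ev_speed_lap_le :
    n * (n - 1) * (e F * e (lap δ F)) ≤
      -(n * (n - 1) * ∑ c, (e (δ c F) - e F * (e (δ c H) / e H)) ^ 2)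
      + e (H * lap δ H - shapeLap ν δ H) + e H * (e H * e N - e (traceCube ν δ))
      - n * (n - 1) * (e F * e F) * e N := by
  have h1 := hP.lap_two_sigma
  rw [hP.two_sigma, lap_algebraMap_mul, lap_mul_self] at h1
  have h2 := congrArg e h1
  have hT4 := congrArg e hP.traceFourth_eq
  have hD := hP.ev_two_sigma
  have hH0 : e H ≠ 0 := hP.meanCurv_pos.ne'
  set k : ℝ := n * (n - 1)
  set t : ι → ℝ := fun c => e (δ c H) / e H with ht
  have hHt : ∀ c, e (δ c H) = e H * t c := fun c => by rw [ht]; field_simp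
  have hN : ∀ c, e (δ c N) = 2 * (e H * e (δ c H)) - 2 * k * (e F * e (δ c F)) := fun c => by
    have := congrArg (fun x => e (δ c x)) hP.two_sigma
    simp only [map_sub, Derivation.leibniz, Derivation.map_algebraMap, smul_eq_mul, mul_zero,
      add_zero, map_add, map_mul, AlgHom.commutes, Algebra.algebraMap_self,
      RingHom.id_apply] at this
    linarith
  have h3 : ∀ c, (e H * t c) * (e H * t c) - e (∑ a, ∑ b, δ c (shape ν δ a b) * δ c (shape ν δ a b))
      + 2 * e (∑ b, shapeSq ν δ c b * shapeSq ν δ c b)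
      ≤ k * (e (δ c F) * e (δ c F)) - k * (e (δ c F) - e F * t c) ^ 2 := fun c => by
    have h4 := congrArg e (hP.sum_sq_tangential c (algebraMap ℝ A (t c)))
    have h5 : 0 ≤ e (∑ a, ∑ b, (δ c (shape ν δ a b) + ν a * shapeSq ν δ c b
        + ν b * shapeSq ν δ c a - algebraMap ℝ A (t c) * shape ν δ a b) ^ 2) := by
      rw [map_sum]
      refine Finset.sum_nonneg fun a _ => ?_
      rw [map_sum]
      exact Finset.sum_nonneg fun b _ => by rw [map_pow]; positivity
    rw [h4, map_add, map_sub, map_sub, map_mul _ 2, map_mul _ (algebraMap ℝ A (t c)),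
      map_mul _ (_ ^ 2), map_pow, AlgHom.commutes, hN, hHt, map_ofNat, Algebra.algebraMap_self,
      RingHom.id_apply] at h5
    have hDt : t c ^ 2 * (e H * e H - e N) = t c ^ 2 * (k * (e F * e F)) := by rw [hD]
    linarith
  have h6 := Finset.sum_le_sum fun c (_ : c ∈ Finset.univ) => h3 c
  simp only [Finset.sum_add_distrib, Finset.sum_sub_distrib, ← Finset.mul_sum, ← map_sum] at h6
  have h7 : e (∑ c, δ c H * δ c H) = ∑ c, (e H * t c) * (e H * t c) := by
    simp only [map_sum, map_mul, hHt]
  have h8 : e (∑ c, δ c F * δ c F) = ∑ c, e (δ c F) * e (δ c F) := by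
    simp only [map_sum, map_mul]
  simp only [map_add, map_sub e, map_mul e 2, map_mul e N, map_mul e H, map_mul e F,
    map_mul e (algebraMap ℝ A k), map_ofNat, AlgHom.commutes, Algebra.algebraMap_self,
      RingHom.id_apply, h7, h8] at h2
  rw [map_sub, map_mul]
  have hDN : (e H * e H - e N) * e N = k * (e F * e F) * e N := by rw [hD]
  linarith

theorem sum_sq_deriv_weight_le :
    ∑ c, e (δ c R) ^ 2 ≤ α ^ 2 * (e R * (e R * e s)) := by
  have h : ∑ c, e (δ c R) ^ 2 = α ^ 2 * (e R * e s) ^ 2 * (e Q - e u * e u) := by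
    rw [← map_mul e u u, ← map_sub, ← hP.sum_tangential_position_sq, map_sum, Finset.mul_sum]
    refine Finset.sum_congr rfl fun c _ => ?_
    rw [hP.deriv_weight', map_mul, map_mul, map_mul, map_mul, AlgHom.commutes,
      Algebra.algebraMap_self, RingHom.id_apply]
    ring
  have h2 := hP.ev_inv_mul
  have h3 : α ^ 2 * (e R * e s) ^ 2 * e Q = α ^ 2 * (e R * (e R * e s)) := by
    linear_combination (α ^ 2 * e R ^ 2 * e s) * h2
  have h4 : 0 ≤ α ^ 2 * (e R * e s) ^ 2 * (e u * e u) :=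
    mul_nonneg (by positivity) (mul_self_nonneg _)
  rw [h]
  linarith

/-- Here ∇R·∇u = αR r⁻² h(X, X), and h(X, X) ≤ H r² because |h| ≤ H. -/
theorem sum_deriv_weight_mul_deriv_support_le (hα : 0 ≤ α) :
    ∑ c, e (δ c R) * e (δ c u) ≤ α * e R * e H := by
  have e1 : ∑ c, δ c R * δ c u =
      algebraMap ℝ A α * (R * s) * ∑ c, ∑ b, shape ν δ c b * (X c * X b) := by
    have : ∀ c, δ c R * δ c u = algebraMap ℝ A α * (R * s) * (X c * δ c u)
        - algebraMap ℝ A α * (R * s) * u * (ν c * δ c u) := fun c => by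
      rw [hP.deriv_weight']; ring
    simp only [this, Finset.sum_sub_distrib, ← Finset.mul_sum, hP.normal, mul_zero, sub_zero]
    congr 1
    refine Finset.sum_congr rfl fun c _ => ?_
    rw [hP.deriv_support, Finset.mul_sum]
    exact Finset.sum_congr rfl fun b _ => by ring
  have hN : e N = ∑ a, ∑ b, e (shape ν δ a b) * e (shape ν δ a b) := by simp [normSq]
  have h1 := quadratic_form_le (fun a b => e (shape ν δ a b)) (fun a => e (X a))
    hP.meanCurv_pos.le (by rw [← hN]; exact hP.normSq_le)
  rw [← map_radiusSq] at h1
  have h2 := hP.ev_inv_mul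
  have hR := hP.weight_pos
  have hs := hP.inv_radiusSq_pos
  have e2 := congrArg e e1
  simp only [map_mul, map_sum, AlgHom.commutes, Algebra.algebraMap_self, RingHom.id_apply] at e2
  rw [e2]
  calc _ ≤ α * (e R * e s) * (e H * e Q) := mul_le_mul_of_nonneg_left h1 (by positivity)
    _ = α * e R * e H := by linear_combination (α * e R * e H) * h2

/-- In F·∂ₜH the reaction term F²R|h|² cancels against FRΔF. The remaining danger is the cross term
2F∇F·∇R; comparing ∇F with F∇H/H and using ∇H = K∇u at the touching point turns it into a term
linear in K. -/
theorem ev_time_meanCurv_le (hα : 2 ≤ α) (hu : 0 < e u) {K : ℝ} (hK : 0 ≤ K)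
    (hδ : ∀ a, e (δ a H) = K * e (δ a u)) :
    n * (n - 1) * (e F * e (T H)) ≤ e R * (e (H * lap δ H - shapeLap ν δ H)
      + e H * (e H * e N - e (traceCube ν δ)))
      + n * (n - 1) * e F * (e F * e R * (e s * (α * (α - 2 + n) + α ^ 2) + 2 * K * α) - e H) := by
  have hF := hP.speed_pos
  have hR := hP.weight_pos
  have hH := hP.meanCurv_pos
  have hs := hP.inv_radiusSq_pos
  have hk := hP.dim_mul_pos
  have h1 := hP.ev_speed_lap_le
  have h2 := hP.ev_lap_weight_le hα hu
  have h3 := hP.sum_sq_deriv_weight_le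
  have h4 := hP.sum_deriv_weight_mul_deriv_support_le (by linarith)
  have h5 : e (T H) = e F * e (lap δ R) + e R * e (lap δ F)
      + 2 * ∑ c, e (δ c F) * e (δ c R) + e F * e R * e N - e H := by
    rw [hP.time_meanCurv, lap_mul]
    simp only [map_sub, map_add, map_mul, map_sum, map_ofNat]
  set k : ℝ := n * (n - 1)
  set t : ι → ℝ := fun c => e (δ c H) / e H with ht
  -- Young's inequality, weighted so that the square is exactly the one gained in `ev_speed_lap_le`
  -- after multiplication by R.
  have h6 : ∀ c, 2 * e F * (e (δ c F) * e (δ c R)) ≤ e R * (e (δ c F) - e F * t c) ^ 2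
      + e F ^ 2 / e R * e (δ c R) ^ 2 + 2 * e F ^ 2 * (t c * e (δ c R)) := fun c => by
    have : 0 ≤ e R * ((e (δ c F) - e F * t c) - e F / e R * e (δ c R)) ^ 2 := by positivity
    have e1 : e R * ((e (δ c F) - e F * t c) - e F / e R * e (δ c R)) ^ 2 =
        e R * (e (δ c F) - e F * t c) ^ 2 + e F ^ 2 / e R * e (δ c R) ^ 2
        + 2 * e F ^ 2 * (t c * e (δ c R)) - 2 * e F * (e (δ c F) * e (δ c R)) := by
      field_simp
      ring
    linarith
  have h7 := Finset.sum_le_sum fun c (_ : c ∈ Finset.univ) => h6 c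
  simp only [Finset.sum_add_distrib, ← Finset.mul_sum] at h7
  have h8 : e F ^ 2 / e R * ∑ c, e (δ c R) ^ 2 ≤ e F ^ 2 * (α ^ 2 * (e R * e s)) := by
    calc _ ≤ e F ^ 2 / e R * (α ^ 2 * (e R * (e R * e s))) :=
          mul_le_mul_of_nonneg_left h3 (by positivity)
      _ = _ := by field_simp
  have h9 : ∑ c, t c * e (δ c R) ≤ K * (α * e R) := by
    have : ∑ c, t c * e (δ c R) = K / e H * ∑ c, e (δ c R) * e (δ c u) := by
      rw [Finset.mul_sum]
      exact Finset.sum_congr rfl fun c _ => by rw [ht]; simp only [hδ]; ring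
    rw [this]
    calc _ ≤ K / e H * (α * e R * e H) := mul_le_mul_of_nonneg_left h4 (by positivity)
      _ = _ := by field_simp
  have h10 : 2 * e F ^ 2 * ∑ c, t c * e (δ c R) ≤ 2 * e F ^ 2 * (K * (α * e R)) :=
    mul_le_mul_of_nonneg_left h9 (by positivity)
  have h11 : e F ^ 2 * e (lap δ R) ≤ e F ^ 2 * (α * (α - 2 + n) * (e R * e s)) :=
    mul_le_mul_of_nonneg_left h2 (by positivity)
  have h12 := mul_le_mul_of_nonneg_left h1 hR.le
  have h13 : k * (e F ^ 2 * e (lap δ R) + 2 * e F * ∑ c, e (δ c F) * e (δ c R)) ≤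
      k * (e F ^ 2 * (α * (α - 2 + n) * (e R * e s))
        + (e R * ∑ c, (e (δ c F) - e F * t c) ^ 2 + e F ^ 2 * (α ^ 2 * (e R * e s))
        + 2 * e F ^ 2 * (K * (α * e R)))) :=
    mul_le_mul_of_nonneg_left (by linarith) hk.le
  rw [h5]
  linarith

/-- `K (u - a) - H` has no interior zero minimum for large `K`. -/
theorem false_of_touching_meanCurv (hα : 2 ≤ α) {q : A} (hq : IsTouching e δ T q) {K a S : ℝ}
    (hδ : ∀ c, δ c q = algebraMap ℝ A K * δ c u - δ c H)
    (hT : T q = algebraMap ℝ A K * T u - T H)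
    (hHu : e H = K * (e u - a)) (ha : 0 < a) (hu : 2 * a ≤ e u) (hK : 1 ≤ K) (hs : e s ≤ S)
    (hbig : 2 * (n + 1) * (2 + 2 * α + S * (α * (α - 2 + n) + α ^ 2)) ≤ K * a ^ 2) : False := by
  have hu0 : 0 < e u := by linarith
  have hell := hq.elliptic_nonneg hP.toIsTangentialFrame hP.meanCurv_pos hP.two_sigma_pos
  have e1 : H * lap δ q - shapeLap ν δ q = algebraMap ℝ A K * (H * lap δ u - shapeLap ν δ u)
      - (H * lap δ H - shapeLap ν δ H) := by
    simp only [lap, shapeLap, hδ, map_sub, Derivation.leibniz, Derivation.map_algebraMap,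
      smul_eq_mul, mul_zero, add_zero, Finset.sum_sub_distrib, mul_sub, ← Finset.mul_sum]
    simp only [mul_left_comm _ (algebraMap ℝ A K), ← Finset.mul_sum]
    ring
  rw [e1, map_sub, map_mul, AlgHom.commutes, hP.ev_elliptic_support] at hell
  have ht := hq.time
  rw [hT, map_sub, map_mul, AlgHom.commutes, hP.ev_time_support] at ht
  have hc : ∀ c, e (δ c H) = K * e (δ c u) := fun c => by
    have := hq.critical c
    rw [hδ, map_sub, map_mul, AlgHom.commutes] at this
    simp only [Algebra.algebraMap_self, RingHom.id_apply] at this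
    linarith
  have hTH := hP.ev_time_meanCurv_le hα hu0 (by linarith) hc
  have hcub := hP.cubic_ge
  have hF := hP.speed_pos
  have hR := hP.weight_pos
  have hH := hP.meanCurv_pos
  have hs0 := hP.inv_radiusSq_pos
  have hk := hP.dim_mul_pos
  have hn : (2 : ℝ) ≤ n := by exact_mod_cast hP.two_le
  have hsu : e s * (e u * e u) ≤ 1 := by
    rw [← hP.ev_inv_mul]; exact mul_le_mul_of_nonneg_left hP.support_sq_le hs0.le
  simp only [Algebra.algebraMap_self, RingHom.id_apply] at hell ht
  set f := e F
  set U := e u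
  set r := e R
  set σ := e s
  set y := e (∑ c, X c * δ c F)
  set k : ℝ := n * (n - 1)
  set C := e H * e N - e (traceCube ν δ)
  set L := e (H * lap δ H - shapeLap ν δ H)
  set C1 := α * (α - 2 + n) + α ^ 2
  have hC1 : 0 ≤ C1 := by
    have : 0 ≤ α - 2 + n := by linarith
    positivity
  have h1 : 0 ≤ K * (α * (f * r) * (1 - σ * (U * U))) := by
    have : 0 ≤ 1 - σ * (U * U) := by linarith
    have : 0 ≤ α := by linarith
    have : 0 ≤ K := by linarith
    positivity
  have h2 : k * f * (K * (U - f * r + r * y)) ≤ k * (f * e (T H)) := by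
    have : K * (U - f * r + r * y) ≤ e (T H) := by nlinarith
    have := mul_le_mul_of_nonneg_left this (show 0 ≤ k * f by positivity)
    linarith
  -- The elliptic inequality contributes −KuC and H C equals K(u − a)C, so only −KaC remains; this
  -- is the reason for shifting u by a.
  have h3 : r * (L + e H * C) ≤ r * (K * (k * f * y + k * (f * f)) - K * a * C) := by
    apply mul_le_mul_of_nonneg_left _ hR.le
    rw [hHu]
    linarith
  -- The terms in y = X·∇F from ∂ₜu and from L cancel, so no derivative of the curvature is left.
  have h4 : k * f * (K * U + e H + r * (K * a) * C / (k * f))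
      ≤ k * f * (f * r * (2 * K + σ * C1 + 2 * K * α)) := by
    have : k * f * (r * (K * a) * C / (k * f)) = r * (K * a) * C := by field_simp
    rw [mul_add, this]
    linarith
  have h5 := le_of_mul_le_mul_left h4 (by positivity)
  have h6 : f * e H / (2 * (n + 1)) ≤ C / (k * f) := by
    rw [div_le_div_iff₀ (by positivity) (by positivity)]
    linarith
  rw [mul_div_assoc] at h5
  exact touching_meanCurv_arith (by positivity) hF hR hs0.le hC1 ha hu hK hs hHu
    hbig hH (h6.trans' (le_of_eq (by ring))) h5

end IsFlowPoint

end PointwiseEstimates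

/-! ### Principal curvatures versus the ambient second fundamental form. -/

section Curvatures

open Matrix

theorem two_mul_esymm_two (s : Multiset ℝ) :
    2 * s.esymm 2 = s.sum ^ 2 - (s.map fun x => x ^ 2).sum := by
  induction s using Multiset.induction_on with
  | empty => simp [Multiset.esymm, Multiset.powersetCard_zero_right]
  | cons a s ih =>
    have h1 : (a ::ₘ s).esymm 2 = s.esymm 2 + a * s.sum := by
      have : Multiset.powersetCard 2 (a ::ₘ s) = Multiset.powersetCard 2 s +
          (Multiset.powersetCard 1 s).map (Multiset.cons a) := Multiset.powersetCard_cons 1 a s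
      rw [Multiset.esymm, this]
      have h2 : (Multiset.map (fun x => a * x) s).sum = a * s.sum := by
        rw [Multiset.sum_map_mul_left, Multiset.map_id']
      simp [Multiset.esymm, Multiset.powersetCard_one, Multiset.map_map, h2]
    rw [h1, mul_add, ih]
    simp
    ring

theorem esymm_one_eq_sum (s : Multiset ℝ) : s.esymm 1 = s.sum := by
  simp [Multiset.esymm, Multiset.powersetCard_one, Multiset.map_map]

theorem sum_sq_eigenvalues {ι : Type*} [Fintype ι] [DecidableEq ι] {A : Matrix ι ι ℝ}
    (hA : A.IsHermitian) : ∑ i, hA.eigenvalues i ^ 2 = (A * A).trace := by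
  have h : A * A = Unitary.conjStarAlgAut ℝ _ hA.eigenvectorUnitary
      (diagonal (RCLike.ofReal ∘ hA.eigenvalues) * diagonal (RCLike.ofReal ∘ hA.eigenvalues)) := by
    rw [map_mul, ← hA.spectral_theorem]
  rw [h, Unitary.conjStarAlgAut_apply, trace_mul_comm, ← Matrix.mul_assoc]
  simp [trace, sq]

/-- Power sums of the roots of the characteristic polynomial of `C Jᵀ`, if `Jᵀ C` is symmetric. -/
theorem roots_charpoly_power_sums {n : ℕ} (C J : Matrix (Fin n) (Fin (n + 1)) ℝ)
    (hs : (Jᵀ * C).IsHermitian) :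
    (C * Jᵀ).charpoly.roots.sum = (Jᵀ * C).trace ∧
      ((C * Jᵀ).charpoly.roots.map fun x => x ^ 2).sum = (Jᵀ * C * (Jᵀ * C)).trace := by
  -- The ambient matrix has one extra eigenvalue 0, in the normal direction. Being symmetric it has
  -- only real eigenvalues, so no principal curvature is lost when taking real roots.
  have h1 := charpoly_mul_comm_of_le Jᵀ C (by simp)
  have h2 : (Jᵀ * C).charpoly.roots = 0 ::ₘ (C * Jᵀ).charpoly.roots := by
    rw [h1, Polynomial.roots_mul]
    · simp
    · exact mul_ne_zero (pow_ne_zero _ Polynomial.X_ne_zero) (charpoly_monic _).ne_zero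
  rw [hs.roots_charpoly_eq_eigenvalues] at h2
  constructor
  · have := congrArg Multiset.sum h2
    rw [Multiset.sum_cons, zero_add] at this
    rw [← this, hs.trace_eq_sum_eigenvalues]
    rfl
  · have := congrArg (fun s => (Multiset.map (fun x : ℝ => x ^ 2) s).sum) h2
    simp only [Multiset.map_cons, Multiset.sum_cons] at this
    rw [← sum_sq_eigenvalues hs]
    rw [Multiset.map_map] at this
    rw [zero_pow two_ne_zero, zero_add] at this
    rw [← this]
    rfl

variable {n : ℕ}

/-- The Jacobian matrix of a map from the sphere. -/
def jac (f : Sph n → Amb n) (x : Sph n) : Matrix (Fin n) (Fin (n + 1)) ℝ :=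
  of fun i a => partialD f x i a

/-- The second fundamental form as a matrix in the ambient coordinates. -/
def ambShape (J B : Matrix (Fin n) (Fin (n + 1)) ℝ) : Matrix (Fin (n + 1)) (Fin (n + 1)) ℝ :=
  Jᵀ * ((J * Jᵀ)⁻¹ * B)

theorem firstForm_eq (X : Sph n → Amb n) (x : Sph n) :
    firstForm X x = jac X x * (jac X x)ᵀ := by
  ext i j
  simp [firstForm, jac, mul_apply, PiLp.inner_apply, mul_comm]

theorem secondForm_eq (X ν : Sph n → Amb n) (x : Sph n) :
    secondForm X ν x = jac ν x * (jac X x)ᵀ := by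
  ext i j
  simp [secondForm, jac, mul_apply, PiLp.inner_apply, mul_comm]

theorem mul_ambShape {J B : Matrix (Fin n) (Fin (n + 1)) ℝ} (hJ : IsUnit (J * Jᵀ).det) :
    J * ambShape J B = B := by
  rw [ambShape, ← Matrix.mul_assoc, ← Matrix.mul_assoc, mul_nonsing_inv _ hJ, Matrix.one_mul]

theorem vecMul_ambShape {J B : Matrix (Fin n) (Fin (n + 1)) ℝ} {ν : Fin (n + 1) → ℝ}
    (hν : J *ᵥ ν = 0) : ν ᵥ* ambShape J B = 0 := by
  rw [ambShape, ← vecMul_vecMul, vecMul_transpose, hν, zero_vecMul]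

/-- Two equations determine the ambient form: its tangential rows are the derivatives of ν and its
normal row is zero. This makes it independent of the coordinates used for the rows. -/
theorem eq_ambShape {J B : Matrix (Fin n) (Fin (n + 1)) ℝ} (hJ : IsUnit (J * Jᵀ).det)
    {ν : Fin (n + 1) → ℝ} (hν : J *ᵥ ν = 0) (hνν : ν ⬝ᵥ ν = 1)
    {M : Matrix (Fin (n + 1)) (Fin (n + 1)) ℝ} (h1 : J * M = B) (h2 : ν ᵥ* M = 0) :
    M = ambShape J B := by
  have hp := projection_add_normal J ν (by simp) hJ hν hνν
  have h3 : vecMulVec ν ν * M = 0 := by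
    rw [vecMulVec_mul, h2]; ext i j; simp [vecMulVec_apply]
  calc M = (Jᵀ * (J * Jᵀ)⁻¹ * J + vecMulVec ν ν) * M := by rw [hp, Matrix.one_mul]
    _ = ambShape J B := by
        rw [Matrix.add_mul, h3, add_zero, Matrix.mul_assoc, h1, ambShape, Matrix.mul_assoc]

/-- JJᵀ is the Gram matrix of the images of the basis vectors, which are linearly independent. -/
theorem isUnit_det_of_injective (L : EuclideanSpace ℝ (Fin n) →ₗ[ℝ] Amb n)
    (hL : Function.Injective L) (J : Matrix (Fin n) (Fin (n + 1)) ℝ)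
    (hJ : ∀ i a, J i a = L (EuclideanSpace.single i 1) a) : IsUnit (J * Jᵀ).det := by
  have hli : LinearIndependent ℝ fun i => L (EuclideanSpace.single i (1 : ℝ)) := by
    have h := (EuclideanSpace.basisFun (Fin n) ℝ).toBasis.linearIndependent.map' L
      (LinearMap.ker_eq_bot.2 hL)
    have e : (L ∘ (EuclideanSpace.basisFun (Fin n) ℝ).toBasis) =
        fun i => L (EuclideanSpace.single i (1 : ℝ)) := by ext i; simp
    rwa [e] at h
  have h2 := (det_gram_ne_zero_iff_linearIndependent (𝕜 := ℝ)).2 hli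
  have h3 : gram ℝ (fun i => L (EuclideanSpace.single i (1 : ℝ))) = J * Jᵀ := by
    ext i j
    simp [mul_apply, PiLp.inner_apply, hJ, mul_comm]
  rw [h3] at h2
  exact h2.isUnit

/-- The second fundamental form of a hypersurface in ambient coordinates. -/
def shapeMat (X ν : Sph n → Amb n) (x : Sph n) : Matrix (Fin (n + 1)) (Fin (n + 1)) ℝ :=
  ambShape (jac X x) (jac ν x)

/-- The mean curvature. -/
def meanCurvature (X ν : Sph n → Amb n) (x : Sph n) : ℝ := ∑ a, shapeMat X ν x a a

/-- The squared norm of the second fundamental form. -/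
def shapeNormSq (X ν : Sph n → Amb n) (x : Sph n) : ℝ :=
  ∑ a, ∑ b, shapeMat X ν x a b * shapeMat X ν x a b

variable {X ν : Sph n → Amb n}

theorem principalCurvatures_eq (x : Sph n) : principalCurvatures X ν x =
    ((jac X x * (jac X x)ᵀ)⁻¹ * jac ν x * (jac X x)ᵀ).charpoly.roots := by
  rw [principalCurvatures, weingarten, firstForm_eq, secondForm_eq, Matrix.mul_assoc]

theorem shapeMat_mul_self_trace {x : Sph n} (hs : (shapeMat X ν x).IsSymm) :
    (shapeMat X ν x * shapeMat X ν x).trace = shapeNormSq X ν x := by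
  simp only [trace, diag_apply, mul_apply, shapeNormSq]
  exact Finset.sum_congr rfl fun a _ => Finset.sum_congr rfl fun b _ => by
    rw [hs.apply a b]

theorem sigma_one_eq {x : Sph n} (hs : (shapeMat X ν x).IsSymm) :
    sigma 1 X ν x = meanCurvature X ν x / n := by
  have h := (roots_charpoly_power_sums ((jac X x * (jac X x)ᵀ)⁻¹ * jac ν x) (jac X x)
    (by ext i j; exact hs.apply i j)).1
  rw [sigma, esymm_one_eq_sum, principalCurvatures_eq, h, Nat.choose_one_right]
  rfl

theorem sigma_two_eq {x : Sph n} (hs : (shapeMat X ν x).IsSymm) :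
    sigma 2 X ν x = (meanCurvature X ν x ^ 2 - shapeNormSq X ν x) / (n * (n - 1)) := by
  have h := roots_charpoly_power_sums ((jac X x * (jac X x)ᵀ)⁻¹ * jac ν x) (jac X x)
    (by ext i j; exact hs.apply i j)
  have h2 := two_mul_esymm_two (principalCurvatures X ν x)
  rw [principalCurvatures_eq, h.1, h.2] at h2
  have h3 : (shapeMat X ν x * shapeMat X ν x).trace = shapeNormSq X ν x :=
    shapeMat_mul_self_trace hs
  have h4 : 2 * (principalCurvatures X ν x).esymm 2 =
      meanCurvature X ν x ^ 2 - shapeNormSq X ν x := by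
    rw [principalCurvatures_eq, h2, ← h3]; rfl
  rw [sigma, ← h4, Nat.cast_choose_two]
  field_simp

theorem normA_eq {x : Sph n} (hJ : IsUnit (jac X x * (jac X x)ᵀ).det)
    (hs : (shapeMat X ν x).IsSymm) :
    normA X ν x = Real.sqrt (shapeNormSq X ν x) := by
  rw [normA]
  congr 1
  rw [← shapeMat_mul_self_trace hs]
  set J := jac X x with hJd
  set B := jac ν x
  set G := (J * Jᵀ)⁻¹ with hG
  have hK : secondForm X ν x = B * Jᵀ := secondForm_eq X ν x
  have hKs : (B * Jᵀ)ᵀ = B * Jᵀ := by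
    have h1 : J * shapeMat X ν x = B := mul_ambShape hJ
    rw [← h1, transpose_mul, transpose_mul, hs.eq, transpose_transpose, Matrix.mul_assoc]
  have hGs : Gᵀ = G := by rw [hG, transpose_nonsing_inv, transpose_mul, transpose_transpose]
  rw [firstForm_eq, hK, ← hJd, ← hG]
  have e1 : shapeMat X ν x * shapeMat X ν x = Jᵀ * (G * (B * Jᵀ) * G * B) := by
    simp only [shapeMat, ambShape, Matrix.mul_assoc]; rfl
  rw [e1, trace_mul_comm, Matrix.mul_assoc _ B Jᵀ]
  have e2 : ∀ i j, (G * (B * Jᵀ) * G) i j = ∑ k, ∑ l, G i k * (B * Jᵀ) k l * G l j := by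
    intro i j
    simp only [mul_apply (N := G) (M := G * (B * Jᵀ)), mul_apply (M := G) (N := B * Jᵀ),
      Finset.sum_mul]
    exact Finset.sum_comm
  have e3 : (G * (B * Jᵀ) * G * (B * Jᵀ)).trace =
      ∑ i, ∑ j, (G * (B * Jᵀ) * G) i j * (B * Jᵀ) j i := by
    simp only [trace, diag_apply, mul_apply (M := G * (B * Jᵀ) * G)]
  rw [e3]
  refine Finset.sum_congr rfl fun i _ => Finset.sum_congr rfl fun j _ => ?_
  rw [e2, Finset.sum_mul]
  refine Finset.sum_congr rfl fun k _ => ?_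
  rw [Finset.sum_mul]
  refine Finset.sum_congr rfl fun l _ => ?_
  rw [← hKs, transpose_apply, hKs, show G j l = G l j from congrFun (congrFun hGs l) j]
  ring

end Curvatures

/-! ### Smooth families in a fixed chart. -/

section Charts

open Matrix

variable {n : ℕ}

/-- `X` with unit normal `ν` is a smooth family of immersed hypersurfaces on `𝕊ⁿ × [0, T)`. -/
structure IsSmoothFamily (T : ℝ) (X ν : ℝ → Sph n → Amb n) : Prop where
  smooth : ContMDiffOn (𝓘(ℝ, ℝ).prod (𝓡 n)) 𝓘(ℝ, Amb n) ∞
    (fun p : ℝ × Sph n => X p.1 p.2) (Set.Ico 0 T ×ˢ Set.univ)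
  smooth_normal : ContMDiffOn (𝓘(ℝ, ℝ).prod (𝓡 n)) 𝓘(ℝ, Amb n) ∞
    (fun p : ℝ × Sph n => ν p.1 p.2) (Set.Ico 0 T ×ˢ Set.univ)
  immersed : ∀ t ∈ Set.Ico 0 T, IsImmersedWithNormal (X t) (ν t)

/-- The inverse of the chart at `x₀`. -/
def param (x₀ : Sph n) : EuclideanSpace ℝ (Fin n) → Sph n := (extChartAt (𝓡 n) x₀).symm

/-- The target of the chart at `x₀`. -/
def paramDomain (x₀ : Sph n) : Set (EuclideanSpace ℝ (Fin n)) := (extChartAt (𝓡 n) x₀).target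

theorem isOpen_paramDomain (x₀ : Sph n) : IsOpen (paramDomain x₀) := isOpen_extChartAt_target x₀

theorem contMDiffOn_param (x₀ : Sph n) :
    ContMDiffOn 𝓘(ℝ, EuclideanSpace ℝ (Fin n)) (𝓡 n) ∞ (param x₀) (paramDomain x₀) :=
  contMDiffOn_extChartAt_symm x₀

/-- One invertible change of coordinates L serves all maps f at once, so the Jacobians of X and ν
transform by the same matrix. -/
theorem fderiv_comp_param (x₀ : Sph n) {z : EuclideanSpace ℝ (Fin n)} (hz : z ∈ paramDomain x₀) :
    ∃ L : EuclideanSpace ℝ (Fin n) →L[ℝ] EuclideanSpace ℝ (Fin n), Function.Injective L ∧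
      ∀ f : Sph n → Amb n, MDifferentiableAt (𝓡 n) 𝓘(ℝ, Amb n) f (param x₀ z) →
        ∀ v, fderiv ℝ (f ∘ param x₀) z v =
          mvfderiv (𝓡 n) f (param x₀ z) (L v : EuclideanSpace ℝ (Fin n)) := by
  have hinv := isInvertible_mfderivWithin_extChartAt_symm (I := 𝓡 n) (x := x₀) hz
  rw [ModelWithCorners.range_eq_univ, mfderivWithin_univ] at hinv
  refine ⟨mfderiv 𝓘(ℝ, EuclideanSpace ℝ (Fin n)) (𝓡 n) (param x₀) z, ?_, ?_⟩
  · obtain ⟨e, he⟩ := hinv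
    intro v w hvw
    refine e.injective ?_
    have h1 : ∀ v, e v = mfderiv 𝓘(ℝ, EuclideanSpace ℝ (Fin n)) (𝓡 n) (param x₀) z v :=
      fun v => congrArg (fun l => l v) he
    exact (h1 v).trans (Eq.trans hvw (h1 w).symm)
  · intro f hf v
    have hp : MDifferentiableAt 𝓘(ℝ, EuclideanSpace ℝ (Fin n)) (𝓡 n) (param x₀) z :=
      ((contMDiffOn_param x₀).contMDiffAt ((isOpen_paramDomain x₀).mem_nhds hz)).mdifferentiableAt
        (by simp)
    rw [← mfderiv_eq_fderiv, mfderiv_comp z hf hp]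
    rfl

/-- The Jacobian of `f` in the chart at `x₀`. -/
def chartJac (x₀ : Sph n) (f : Sph n → Amb n) (z : EuclideanSpace ℝ (Fin n)) :
    Matrix (Fin n) (Fin (n + 1)) ℝ :=
  of fun i a => fderiv ℝ (f ∘ param x₀) z (EuclideanSpace.single i 1) a

theorem chartJac_eq_mul (x₀ : Sph n) {z : EuclideanSpace ℝ (Fin n)} (hz : z ∈ paramDomain x₀) :
    ∃ Q : Matrix (Fin n) (Fin n) ℝ, ∀ f : Sph n → Amb n,
      MDifferentiableAt (𝓡 n) 𝓘(ℝ, Amb n) f (param x₀ z) →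
        chartJac x₀ f z = Q * jac f (param x₀ z) := by
  obtain ⟨L, -, hL⟩ := fderiv_comp_param x₀ hz
  refine ⟨of fun i j => L (EuclideanSpace.single i 1) j, fun f hf => ?_⟩
  ext i a
  set D : EuclideanSpace ℝ (Fin n) →L[ℝ] Amb n := mvfderiv (𝓡 n) f (param x₀ z) with hD
  have h1 : L (EuclideanSpace.single i 1) =
      ∑ j, L (EuclideanSpace.single i 1) j • EuclideanSpace.single j (1 : ℝ) := by
    have := (EuclideanSpace.basisFun (Fin n) ℝ).sum_repr (L (EuclideanSpace.single i 1))
    simpa using this.symm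
  have h2 : chartJac x₀ f z i a = D (L (EuclideanSpace.single i 1)) a := by
    rw [chartJac, of_apply, hL f hf]; rfl
  rw [h2, h1, map_sum, WithLp.ofLp_sum, Finset.sum_apply, mul_apply]
  refine Finset.sum_congr rfl fun j _ => ?_
  rw [map_smul]
  rfl

theorem isUnit_det_chartJac (x₀ : Sph n) {z : EuclideanSpace ℝ (Fin n)} (hz : z ∈ paramDomain x₀)
    {X ν : Sph n → Amb n} (hX : MDifferentiableAt (𝓡 n) 𝓘(ℝ, Amb n) X (param x₀ z))
    (him : IsImmersedWithNormal X ν) :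
    IsUnit (chartJac x₀ X z * (chartJac x₀ X z)ᵀ).det := by
  obtain ⟨L, hinj, hL⟩ := fderiv_comp_param x₀ hz
  refine isUnit_det_of_injective (fderiv ℝ (X ∘ param x₀) z : _ →ₗ[ℝ] _) ?_ _ fun i a => rfl
  intro v w hvw
  have h : fderiv ℝ (X ∘ param x₀) z v = fderiv ℝ (X ∘ param x₀) z w := hvw
  rw [hL X hX, hL X hX] at h
  exact hinj (him.immersion _ h)

theorem isUnit_det_jac {X ν : Sph n → Amb n} (him : IsImmersedWithNormal X ν) (x : Sph n) :
    IsUnit (jac X x * (jac X x)ᵀ).det := by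
  have h := him.immersion x
  exact isUnit_det_of_injective
    (mvfderiv (𝓡 n) X x : EuclideanSpace ℝ (Fin n) →L[ℝ] Amb n).toLinearMap
    h _ fun i a => rfl

theorem jac_mulVec_normal {X ν : Sph n → Amb n} (him : IsImmersedWithNormal X ν) (x : Sph n) :
    jac X x *ᵥ (ν x) = 0 := by
  ext i
  have := him.normal x i
  simpa [PiLp.inner_apply, mulVec, dotProduct, jac, mul_comm] using this

theorem normal_dotProduct {X ν : Sph n → Amb n} (him : IsImmersedWithNormal X ν) (x : Sph n) :
    (ν x : Fin (n + 1) → ℝ) ⬝ᵥ ν x = 1 := by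
  have h : inner ℝ (ν x) (ν x) = 1 := by
    rw [real_inner_self_eq_norm_sq, him.norm_normal x, one_pow]
  rw [← h, PiLp.inner_apply]
  simp only [dotProduct]
  exact Finset.sum_congr rfl fun i _ => by simp [sq]

theorem chartJac_mulVec_normal (x₀ : Sph n) {z : EuclideanSpace ℝ (Fin n)}
    (hz : z ∈ paramDomain x₀) {X ν : Sph n → Amb n}
    (hX : MDifferentiableAt (𝓡 n) 𝓘(ℝ, Amb n) X (param x₀ z))
    (him : IsImmersedWithNormal X ν) :
    chartJac x₀ X z *ᵥ (ν (param x₀ z)) = 0 := by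
  obtain ⟨Q, hQ⟩ := chartJac_eq_mul x₀ hz
  rw [hQ X hX, ← mulVec_mulVec, jac_mulVec_normal him, mulVec_zero]

/-- Passing between the fixed chart and the intrinsic differential multiplies both Jacobians on the
left by the same matrix, which preserves the equations characterizing the ambient form. -/
theorem eq_shapeMat (x₀ : Sph n) {z : EuclideanSpace ℝ (Fin n)}
    (hz : z ∈ paramDomain x₀) {X ν : Sph n → Amb n}
    (hX : MDifferentiableAt (𝓡 n) 𝓘(ℝ, Amb n) X (param x₀ z))
    (hν : MDifferentiableAt (𝓡 n) 𝓘(ℝ, Amb n) ν (param x₀ z))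
    (him : IsImmersedWithNormal X ν) {M : Matrix (Fin (n + 1)) (Fin (n + 1)) ℝ}
    (h1 : chartJac x₀ X z * M = chartJac x₀ ν z)
    (h2 : (ν (param x₀ z) : Fin (n + 1) → ℝ) ᵥ* M = 0) :
    shapeMat X ν (param x₀ z) = M := by
  have hJ := isUnit_det_chartJac x₀ hz hX him
  have hn := chartJac_mulVec_normal x₀ hz hX him
  have hd := normal_dotProduct him (param x₀ z)
  rw [eq_ambShape hJ hn hd h1 h2]
  refine eq_ambShape hJ hn hd ?_ (vecMul_ambShape (jac_mulVec_normal him _))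
  obtain ⟨Q, hQ⟩ := chartJac_eq_mul x₀ hz
  rw [hQ X hX, hQ ν hν, Matrix.mul_assoc, shapeMat, mul_ambShape (isUnit_det_jac him _)]

theorem shapeMat_eq_ambShape (x₀ : Sph n) {z : EuclideanSpace ℝ (Fin n)}
    (hz : z ∈ paramDomain x₀) {X ν : Sph n → Amb n}
    (hX : MDifferentiableAt (𝓡 n) 𝓘(ℝ, Amb n) X (param x₀ z))
    (hν : MDifferentiableAt (𝓡 n) 𝓘(ℝ, Amb n) ν (param x₀ z))
    (him : IsImmersedWithNormal X ν) :
    shapeMat X ν (param x₀ z) = ambShape (chartJac x₀ X z) (chartJac x₀ ν z) :=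
  eq_shapeMat x₀ hz hX hν him (mul_ambShape (isUnit_det_chartJac x₀ hz hX him))
    (vecMul_ambShape (chartJac_mulVec_normal x₀ hz hX him))

/-- A family of maps from the sphere in the chart at `x₀`. -/
def chartFamily (x₀ : Sph n) (X : ℝ → Sph n → Amb n) (q : ℝ × EuclideanSpace ℝ (Fin n)) : Amb n :=
  X q.1 (param x₀ q.2)

theorem contDiffOn_chartFamily {T : ℝ} {X : ℝ → Sph n → Amb n}
    (hX : ContMDiffOn (𝓘(ℝ, ℝ).prod (𝓡 n)) 𝓘(ℝ, Amb n) ∞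
      (fun p : ℝ × Sph n => X p.1 p.2) (Set.Ico 0 T ×ˢ Set.univ)) (x₀ : Sph n) :
    ContDiffOn ℝ ∞ (chartFamily x₀ X) (Set.Ico 0 T ×ˢ paramDomain x₀) := by
  rw [← contMDiffOn_iff_contDiffOn]
  have h1 : ContMDiffOn 𝓘(ℝ, ℝ × EuclideanSpace ℝ (Fin n)) (𝓘(ℝ, ℝ).prod (𝓡 n)) ∞
      (fun q : ℝ × EuclideanSpace ℝ (Fin n) => (q.1, param x₀ q.2))
      (Set.Ico 0 T ×ˢ paramDomain x₀) := by
    refine ContMDiffOn.prodMk ?_ ?_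
    · exact contDiff_fst.contMDiff.contMDiffOn
    · exact (contMDiffOn_param x₀).comp (contDiff_snd.contMDiff.contMDiffOn) fun q hq => hq.2
  exact hX.comp h1 fun q hq => ⟨hq.1, Set.mem_univ _⟩

theorem contMDiff_slice {T : ℝ} {X : ℝ → Sph n → Amb n}
    (hX : ContMDiffOn (𝓘(ℝ, ℝ).prod (𝓡 n)) 𝓘(ℝ, Amb n) ∞
      (fun p : ℝ × Sph n => X p.1 p.2) (Set.Ico 0 T ×ˢ Set.univ)) {t : ℝ} (ht : t ∈ Set.Ico 0 T) :
    ContMDiff (𝓡 n) 𝓘(ℝ, Amb n) ∞ (X t) := by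
  rw [← contMDiffOn_univ]
  have h1 : ContMDiffOn (𝓡 n) (𝓘(ℝ, ℝ).prod (𝓡 n)) ∞
      (fun x : Sph n => ((t, x) : ℝ × Sph n)) Set.univ :=
    contMDiffOn_const.prodMk contMDiffOn_id
  exact hX.comp h1 fun x _ => ⟨ht, Set.mem_univ _⟩

theorem fderivWithin_chartFamily {T : ℝ} {X : ℝ → Sph n → Amb n}
    (hX : ContMDiffOn (𝓘(ℝ, ℝ).prod (𝓡 n)) 𝓘(ℝ, Amb n) ∞
      (fun p : ℝ × Sph n => X p.1 p.2) (Set.Ico 0 T ×ˢ Set.univ)) (x₀ : Sph n)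
    {q : ℝ × EuclideanSpace ℝ (Fin n)} (hq : q ∈ Set.Ico 0 T ×ˢ paramDomain x₀)
    (v : EuclideanSpace ℝ (Fin n)) :
    fderivWithin ℝ (chartFamily x₀ X) (Set.Ico 0 T ×ˢ paramDomain x₀) q (0, v) =
      fderiv ℝ (X q.1 ∘ param x₀) q.2 v := by
  have h1 : HasFDerivWithinAt (chartFamily x₀ X)
      (fderivWithin ℝ (chartFamily x₀ X) (Set.Ico 0 T ×ˢ paramDomain x₀) q)
      (Set.Ico 0 T ×ˢ paramDomain x₀) q :=
    ((contDiffOn_chartFamily hX x₀).differentiableOn (by simp) q hq).hasFDerivWithinAt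
  have h2 : HasFDerivWithinAt (fun z : EuclideanSpace ℝ (Fin n) => (q.1, z))
      (ContinuousLinearMap.inr ℝ ℝ (EuclideanSpace ℝ (Fin n))) (paramDomain x₀) q.2 :=
    (hasFDerivAt_prodMk_right q.1 q.2).hasFDerivWithinAt
  have h3 := HasFDerivWithinAt.comp (t := Set.Ico 0 T ×ˢ paramDomain x₀) q.2 h1 h2
    fun z hz => ⟨hq.1, hz⟩
  have h4 := h3.hasFDerivAt ((isOpen_paramDomain x₀).mem_nhds hq.2)
  have h5 : HasFDerivAt (X q.1 ∘ param x₀) _ q.2 := h4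
  rw [h5.fderiv]
  simp

theorem continuousOn_chartJac {T : ℝ} {X : ℝ → Sph n → Amb n}
    (hX : ContMDiffOn (𝓘(ℝ, ℝ).prod (𝓡 n)) 𝓘(ℝ, Amb n) ∞
      (fun p : ℝ × Sph n => X p.1 p.2) (Set.Ico 0 T ×ˢ Set.univ)) (x₀ : Sph n) :
    ContinuousOn (fun q : ℝ × EuclideanSpace ℝ (Fin n) => chartJac x₀ (X q.1) q.2)
      (Set.Ico 0 T ×ˢ paramDomain x₀) := by
  rcases le_or_gt T 0 with hT | hT
  · simp [Set.Ico_eq_empty (not_lt.2 hT)]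
  -- Time 0 is a boundary point of the domain; unique differentiability there keeps the estimates
  -- continuous up to the initial time.
  have hu : UniqueDiffOn ℝ (Set.Ico 0 T ×ˢ paramDomain x₀) :=
    (uniqueDiffOn_Ico 0 T).prod (isOpen_paramDomain x₀).uniqueDiffOn
  have hc := (contDiffOn_chartFamily hX x₀).continuousOn_fderivWithin hu (by simp)
  refine continuousOn_pi.2 fun i => continuousOn_pi.2 fun a => ?_
  have h1 : ContinuousOn (fun q => fderivWithin ℝ (chartFamily x₀ X)
      (Set.Ico 0 T ×ˢ paramDomain x₀) q (0, EuclideanSpace.single i 1) a)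
      (Set.Ico 0 T ×ˢ paramDomain x₀) := by
    have h2 := hc.clm_apply (continuousOn_const (c := ((0 : ℝ), EuclideanSpace.single i (1 : ℝ))))
    exact (EuclideanSpace.proj (𝕜 := ℝ) a).continuous.comp_continuousOn h2
  refine h1.congr fun q hq => ?_
  exact congrArg (fun w : Amb n => w a)
    (fderivWithin_chartFamily hX x₀ hq (EuclideanSpace.single i 1)).symm

variable {T : ℝ} {X ν : ℝ → Sph n → Amb n}

/-- The coordinate basis at x comes from the chart at x and can jump with x, so continuity is
checked in the chart at a fixed x₀ and transferred by chart independence. -/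
theorem IsSmoothFamily.continuousOn_shapeMat (hF : IsSmoothFamily T X ν) :
    ContinuousOn (fun p : ℝ × Sph n => shapeMat (X p.1) (ν p.1) p.2)
      (Set.Ico 0 T ×ˢ Set.univ) := by
  rintro ⟨t₀, x₀⟩ ⟨ht₀, -⟩
  have hJ := continuousOn_chartJac hF.smooth x₀
  have hB := continuousOn_chartJac hF.smooth_normal x₀
  have hz₀ : extChartAt (𝓡 n) x₀ x₀ ∈ paramDomain x₀ := mem_extChartAt_target x₀
  have hc : ContinuousWithinAt (fun q : ℝ × EuclideanSpace ℝ (Fin n) =>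
      ambShape (chartJac x₀ (X q.1) q.2) (chartJac x₀ (ν q.1) q.2))
      (Set.Ico 0 T ×ˢ paramDomain x₀) (t₀, extChartAt (𝓡 n) x₀ x₀) := by
    have hj := hJ _ (Set.mk_mem_prod ht₀ hz₀)
    have hb := hB _ (Set.mk_mem_prod ht₀ hz₀)
    have hjt : ContinuousWithinAt (fun q : ℝ × EuclideanSpace ℝ (Fin n) =>
        (chartJac x₀ (X q.1) q.2)ᵀ) (Set.Ico 0 T ×ˢ paramDomain x₀)
        (t₀, extChartAt (𝓡 n) x₀ x₀) :=
      (Continuous.matrix_transpose continuous_id).continuousAt.comp_continuousWithinAt hj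
    have hmul : ∀ {l m k : Type} [Fintype m]
        {f : ℝ × EuclideanSpace ℝ (Fin n) → Matrix l m ℝ}
        {g : ℝ × EuclideanSpace ℝ (Fin n) → Matrix m k ℝ} {s q},
        ContinuousWithinAt f s q → ContinuousWithinAt g s q →
        ContinuousWithinAt (fun q => f q * g q) s q := by
      intro l m k _ f g s q hf hg
      have : Continuous fun p : Matrix l m ℝ × Matrix m k ℝ => p.1 * p.2 :=
        continuous_fst.matrix_mul continuous_snd
      exact this.continuousAt.comp_continuousWithinAt (hf.prodMk hg)
    have hG := hmul hj hjt
    have hdet := isUnit_det_chartJac x₀ hz₀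
      ((contMDiff_slice hF.smooth ht₀).mdifferentiableAt (by simp)) (hF.immersed t₀ ht₀)
    have hinv : ContinuousWithinAt (fun q : ℝ × EuclideanSpace ℝ (Fin n) =>
        (chartJac x₀ (X q.1) q.2 * (chartJac x₀ (X q.1) q.2)ᵀ)⁻¹)
        (Set.Ico 0 T ×ˢ paramDomain x₀) (t₀, extChartAt (𝓡 n) x₀ x₀) :=
      ContinuousAt.comp_continuousWithinAt (g := fun M : Matrix (Fin n) (Fin n) ℝ => M⁻¹)
        (continuousAt_matrix_inv _ (NormedRing.inverse_continuousAt hdet.unit)) hG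
    exact hmul hjt (hmul hinv hb)
  have hmap : ContinuousWithinAt (fun p : ℝ × Sph n => (p.1, extChartAt (𝓡 n) x₀ p.2))
      (Set.Ico 0 T ×ˢ (extChartAt (𝓡 n) x₀).source) (t₀, x₀) := by
    have := (continuousAt_extChartAt (I := 𝓡 n) x₀)
    exact (continuousAt_fst.prodMk
      (ContinuousAt.comp (x := (t₀, x₀)) this continuousAt_snd)).continuousWithinAt
  have hmaps : Set.MapsTo (fun p : ℝ × Sph n => (p.1, extChartAt (𝓡 n) x₀ p.2))
      (Set.Ico 0 T ×ˢ (extChartAt (𝓡 n) x₀).source) (Set.Ico 0 T ×ˢ paramDomain x₀) :=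
    fun p hp => ⟨hp.1, (extChartAt (𝓡 n) x₀).map_source hp.2⟩
  have h1 := ContinuousWithinAt.comp (x := (t₀, x₀)) hc hmap hmaps
  have h2 : ContinuousWithinAt (fun p : ℝ × Sph n => shapeMat (X p.1) (ν p.1) p.2)
      (Set.Ico 0 T ×ˢ (extChartAt (𝓡 n) x₀).source) (t₀, x₀) := by
    have key : ∀ p ∈ Set.Ico 0 T ×ˢ (extChartAt (𝓡 n) x₀).source,
        shapeMat (X p.1) (ν p.1) p.2 = ambShape (chartJac x₀ (X p.1) (extChartAt (𝓡 n) x₀ p.2))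
          (chartJac x₀ (ν p.1) (extChartAt (𝓡 n) x₀ p.2)) := by
      intro p hp
      have hx : param x₀ (extChartAt (𝓡 n) x₀ p.2) = p.2 := (extChartAt (𝓡 n) x₀).left_inv hp.2
      have := shapeMat_eq_ambShape x₀ (z := extChartAt (𝓡 n) x₀ p.2)
        ((extChartAt (𝓡 n) x₀).map_source hp.2)
        ((contMDiff_slice hF.smooth hp.1).mdifferentiableAt (by simp))
        ((contMDiff_slice hF.smooth_normal hp.1).mdifferentiableAt (by simp))
        (hF.immersed p.1 hp.1)
      rwa [hx] at this
    exact h1.congr key (key _ ⟨ht₀, mem_extChartAt_source x₀⟩)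
  refine h2.mono_of_mem_nhdsWithin ?_
  rw [nhdsWithin_prod_eq, nhdsWithin_univ]
  exact Filter.prod_mem_prod self_mem_nhdsWithin (extChartAt_source_mem_nhds x₀)

end Charts

/-! ### From a smooth family to frames over germs. -/

section GermsOfFamilies

open Matrix

variable {n : ℕ}

/-- Space-time coordinates. -/
abbrev ChartSpace (n : ℕ) : Type := ℝ × EuclideanSpace ℝ (Fin n)

/-- The coordinates of `(t₀, x₀)` in the chart at `x₀`. -/
def chartPoint (t₀ : ℝ) (x₀ : Sph n) : ChartSpace n := (t₀, extChartAt (𝓡 n) x₀ x₀)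

theorem param_chartPoint (t₀ : ℝ) (x₀ : Sph n) : param x₀ (chartPoint t₀ x₀).2 = x₀ :=
  extChartAt_to_inv (I := 𝓡 n) x₀

/-- The germs of the components of a family of maps from the sphere. -/
def familyGerm (t₀ : ℝ) (x₀ : Sph n) (X : ℝ → Sph n → Amb n) (a : Fin (n + 1)) :
    SmoothGerm (chartPoint t₀ x₀) :=
  germ (chartPoint t₀ x₀) fun q => chartFamily x₀ X q a

/-- The coordinate derivatives in space. -/
def spaceDeriv (p : ChartSpace n) (i : Fin n) : Derivation ℝ (SmoothGerm p) (SmoothGerm p) :=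
  germDeriv p (0, EuclideanSpace.single i 1)

/-- The coordinate derivative in time. -/
def timeDeriv (p : ChartSpace n) : Derivation ℝ (SmoothGerm p) (SmoothGerm p) :=
  germDeriv p (1, 0)

/-- The tangential derivatives along a family of hypersurfaces. -/
def familyFrame (t₀ : ℝ) (x₀ : Sph n) (X : ℝ → Sph n → Amb n) (a : Fin (n + 1)) :
    Derivation ℝ (SmoothGerm (chartPoint t₀ x₀)) (SmoothGerm (chartPoint t₀ x₀)) :=
  coordFrame (spaceDeriv _) (familyGerm t₀ x₀ X) a

variable {T : ℝ} {X ν : ℝ → Sph n → Amb n} {t₀ : ℝ} {x₀ : Sph n}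

theorem eventually_mem_domain (ht₀ : t₀ ∈ Set.Ioo 0 T) :
    ∀ᶠ q in nhds (chartPoint t₀ x₀), q ∈ Set.Ioo 0 T ×ˢ paramDomain x₀ :=
  (isOpen_Ioo.prod (isOpen_paramDomain x₀)).mem_nhds ⟨ht₀, mem_extChartAt_target x₀⟩

theorem contDiffAt_chartFamily
    (hX : ContMDiffOn (𝓘(ℝ, ℝ).prod (𝓡 n)) 𝓘(ℝ, Amb n) ∞
      (fun p : ℝ × Sph n => X p.1 p.2) (Set.Ico 0 T ×ˢ Set.univ)) (x₀ : Sph n)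
    {q : ChartSpace n} (hq : q ∈ Set.Ioo 0 T ×ˢ paramDomain x₀) :
    ContDiffAt ℝ ∞ (chartFamily x₀ X) q :=
  (contDiffOn_chartFamily hX x₀).contDiffAt
    (Filter.mem_of_superset ((isOpen_Ioo.prod (isOpen_paramDomain x₀)).mem_nhds hq)
      (Set.prod_mono Set.Ioo_subset_Ico_self subset_rfl))

theorem contDiffAt_component
    (hX : ContMDiffOn (𝓘(ℝ, ℝ).prod (𝓡 n)) 𝓘(ℝ, Amb n) ∞
      (fun p : ℝ × Sph n => X p.1 p.2) (Set.Ico 0 T ×ˢ Set.univ)) (x₀ : Sph n)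
    {q : ChartSpace n} (hq : q ∈ Set.Ioo 0 T ×ˢ paramDomain x₀) (a : Fin (n + 1)) :
    ContDiffAt ℝ ∞ (fun q => chartFamily x₀ X q a) q :=
  (EuclideanSpace.proj (𝕜 := ℝ) a : Amb n →L[ℝ] ℝ).contDiff.contDiffAt.comp q
    (contDiffAt_chartFamily hX x₀ hq)

theorem fderiv_component
    (hX : ContMDiffOn (𝓘(ℝ, ℝ).prod (𝓡 n)) 𝓘(ℝ, Amb n) ∞
      (fun p : ℝ × Sph n => X p.1 p.2) (Set.Ico 0 T ×ˢ Set.univ)) (x₀ : Sph n)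
    {q : ChartSpace n} (hq : q ∈ Set.Ioo 0 T ×ˢ paramDomain x₀) (a : Fin (n + 1))
    (v : ChartSpace n) :
    fderiv ℝ (fun q => chartFamily x₀ X q a) q v = fderiv ℝ (chartFamily x₀ X) q v a := by
  have h1 := ((contDiffAt_chartFamily hX x₀ hq).differentiableAt (by simp)).hasFDerivAt
  have h2 := (EuclideanSpace.proj (𝕜 := ℝ) a : Amb n →L[ℝ] ℝ).hasFDerivAt.comp q h1
  exact congrArg (fun l : ChartSpace n →L[ℝ] ℝ => l v) h2.fderiv

theorem fderiv_component_space
    (hX : ContMDiffOn (𝓘(ℝ, ℝ).prod (𝓡 n)) 𝓘(ℝ, Amb n) ∞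
      (fun p : ℝ × Sph n => X p.1 p.2) (Set.Ico 0 T ×ˢ Set.univ)) (x₀ : Sph n)
    {q : ChartSpace n} (hq : q ∈ Set.Ioo 0 T ×ˢ paramDomain x₀) (a : Fin (n + 1)) (i : Fin n) :
    fderiv ℝ (fun q => chartFamily x₀ X q a) q (0, EuclideanSpace.single i 1) =
      chartJac x₀ (X q.1) q.2 i a := by
  have hS : Set.Ico 0 T ×ˢ paramDomain x₀ ∈ nhds q :=
    Filter.mem_of_superset ((isOpen_Ioo.prod (isOpen_paramDomain x₀)).mem_nhds hq)
      (Set.prod_mono Set.Ioo_subset_Ico_self subset_rfl)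
  rw [fderiv_component hX x₀ hq, ← fderivWithin_of_mem_nhds hS,
    fderivWithin_chartFamily hX x₀ (mem_of_mem_nhds hS)]
  rfl

theorem contDiffAt_chartJac
    (hX : ContMDiffOn (𝓘(ℝ, ℝ).prod (𝓡 n)) 𝓘(ℝ, Amb n) ∞
      (fun p : ℝ × Sph n => X p.1 p.2) (Set.Ico 0 T ×ˢ Set.univ)) (ht₀ : t₀ ∈ Set.Ioo 0 T)
    (i : Fin n) (a : Fin (n + 1)) :
    ContDiffAt ℝ ∞ (fun q : ChartSpace n => chartJac x₀ (X q.1) q.2 i a) (chartPoint t₀ x₀) := by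
  have hev := eventually_mem_domain (x₀ := x₀) ht₀
  refine (contDiffAt_fderiv_apply (contDiffAt_component hX x₀ hev.self_of_nhds a)
    (0, EuclideanSpace.single i 1)).congr_of_eventuallyEq ?_
  filter_upwards [hev] with q hq
  exact (fderiv_component_space hX x₀ hq a i).symm

theorem spaceDeriv_familyGerm
    (hX : ContMDiffOn (𝓘(ℝ, ℝ).prod (𝓡 n)) 𝓘(ℝ, Amb n) ∞
      (fun p : ℝ × Sph n => X p.1 p.2) (Set.Ico 0 T ×ˢ Set.univ)) (ht₀ : t₀ ∈ Set.Ioo 0 T)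
    (i : Fin n) (a : Fin (n + 1)) :
    spaceDeriv _ i (familyGerm t₀ x₀ X a) =
      germ _ fun q : ChartSpace n => chartJac x₀ (X q.1) q.2 i a := by
  have hev := eventually_mem_domain (x₀ := x₀) ht₀
  rw [spaceDeriv, familyGerm, germDeriv_germ _ (contDiffAt_component hX x₀ hev.self_of_nhds a)]
  apply germ_congr
  filter_upwards [hev] with q hq
  exact fderiv_component_space hX x₀ hq a i

theorem spaceDeriv_comm (p : ChartSpace n) (i j : Fin n) (f : SmoothGerm p) :
    spaceDeriv p i (spaceDeriv p j f) = spaceDeriv p j (spaceDeriv p i f) :=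
  germDeriv_comm _ _ f

theorem timeDeriv_comm (p : ChartSpace n) (i : Fin n) (f : SmoothGerm p) :
    timeDeriv p (spaceDeriv p i f) = spaceDeriv p i (timeDeriv p f) :=
  germDeriv_comm _ _ f

namespace IsSmoothFamily

variable (hF : IsSmoothFamily T X ν)
include hF

theorem isUnit_det (ht₀ : t₀ ∈ Set.Ioo 0 T) :
    IsUnit (jacobian (spaceDeriv _) (familyGerm t₀ x₀ X) *
      (jacobian (spaceDeriv _) (familyGerm t₀ x₀ X))ᵀ).det := by
  have hev := (eventually_mem_domain (x₀ := x₀) ht₀).self_of_nhds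
  apply isUnit_of_ev_ne_zero
  have e1 : (jacobian (spaceDeriv _) (familyGerm t₀ x₀ X)).map (ev (chartPoint t₀ x₀)) =
      chartJac x₀ (X t₀) (chartPoint t₀ x₀).2 := by
    ext i a
    rw [Matrix.map_apply, jacobian, of_apply, spaceDeriv_familyGerm hF.smooth ht₀,
      ev_germ (contDiffAt_chartJac hF.smooth ht₀ i a)]
    rfl
  have e2 : ev (chartPoint t₀ x₀) (jacobian (spaceDeriv _) (familyGerm t₀ x₀ X) *
      (jacobian (spaceDeriv _) (familyGerm t₀ x₀ X))ᵀ).det =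
      (chartJac x₀ (X t₀) (chartPoint t₀ x₀).2 *
        (chartJac x₀ (X t₀) (chartPoint t₀ x₀).2)ᵀ).det := by
    rw [AlgHom.map_det, ← e1]
    congr 1
    ext i j
    simp [mul_apply]
  rw [e2]
  exact (isUnit_det_chartJac x₀ hev.2 ((contMDiff_slice hF.smooth
    (Set.Ioo_subset_Ico_self ht₀)).mdifferentiableAt (by simp))
    (hF.immersed t₀ (Set.Ioo_subset_Ico_self ht₀))).ne_zero

theorem sum_normal_sq (ht₀ : t₀ ∈ Set.Ioo 0 T) :
    ∑ a, familyGerm t₀ x₀ ν a * familyGerm t₀ x₀ ν a = 1 := by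
  have hev := eventually_mem_domain (x₀ := x₀) ht₀
  have hs := fun a => contDiffAt_component hF.smooth_normal x₀ hev.self_of_nhds a
  simp only [familyGerm, ← fun a => germ_mul (hs a) (hs a)]
  rw [← germ_sum _ fun a _ => (hs a).mul (hs a),
    ← map_one (algebraMap ℝ (SmoothGerm (chartPoint t₀ x₀))), ← germ_const]
  apply germ_congr
  filter_upwards [hev] with q hq
  exact normal_dotProduct (hF.immersed q.1 (Set.Ioo_subset_Ico_self hq.1)) _

theorem sum_normal_mul_deriv (ht₀ : t₀ ∈ Set.Ioo 0 T) (i : Fin n) :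
    ∑ a, familyGerm t₀ x₀ ν a * spaceDeriv _ i (familyGerm t₀ x₀ X a) = 0 := by
  have hev := eventually_mem_domain (x₀ := x₀) ht₀
  have hs := fun a => contDiffAt_component hF.smooth_normal x₀ hev.self_of_nhds a
  have hj := fun a => contDiffAt_chartJac (x₀ := x₀) hF.smooth ht₀ i a
  simp only [spaceDeriv_familyGerm hF.smooth ht₀]
  simp only [familyGerm, ← fun a => germ_mul (hs a) (hj a)]
  rw [← germ_sum _ fun a _ => (hs a).mul (hj a),
    ← map_zero (algebraMap ℝ (SmoothGerm (chartPoint t₀ x₀))), ← germ_const]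
  apply germ_congr
  filter_upwards [hev] with q hq
  have := congrFun (chartJac_mulVec_normal x₀ hq.2 ((contMDiff_slice hF.smooth
    (Set.Ioo_subset_Ico_self hq.1)).mdifferentiableAt (by simp))
    (hF.immersed q.1 (Set.Ioo_subset_Ico_self hq.1))) i
  rw [← show (chartJac x₀ (X q.1) q.2 *ᵥ ν q.1 (param x₀ q.2)) i = 0 from this]
  simp only [mulVec, dotProduct, chartFamily]
  exact Finset.sum_congr rfl fun a _ => mul_comm _ _

theorem isTangentialFrame (ht₀ : t₀ ∈ Set.Ioo 0 T) :
    IsTangentialFrame (familyGerm t₀ x₀ X) (familyGerm t₀ x₀ ν) (familyFrame t₀ x₀ X) :=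
  isTangentialFrame_coordFrame (fun i j f => spaceDeriv_comm _ i j f) (by simp)
    (hF.isUnit_det ht₀) (hF.sum_normal_sq ht₀) (hF.sum_normal_mul_deriv ht₀)

theorem isFlowFrame (ht₀ : t₀ ∈ Set.Ioo 0 T) {Ψ : SmoothGerm (chartPoint t₀ x₀)}
    (hflow : ∀ a, timeDeriv _ (familyGerm t₀ x₀ X a) =
      familyGerm t₀ x₀ X a - Ψ * familyGerm t₀ x₀ ν a) :
    IsFlowFrame (familyGerm t₀ x₀ X) (familyGerm t₀ x₀ ν) (familyFrame t₀ x₀ X)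
      (timeDeriv _) Ψ :=
  isFlowFrame_coordFrame (fun i j f => spaceDeriv_comm _ i j f)
    (fun i f => timeDeriv_comm _ i f) (by simp)
    (hF.isUnit_det ht₀) (hF.sum_normal_sq ht₀) (hF.sum_normal_mul_deriv ht₀) hflow

/-- The germ of the ambient second fundamental form. -/
theorem shape_germ (ht₀ : t₀ ∈ Set.Ioo 0 T) (a b : Fin (n + 1)) :
    ContDiffAt ℝ ∞ (fun q : ChartSpace n => shapeMat (X q.1) (ν q.1) (param x₀ q.2) a b)
        (chartPoint t₀ x₀) ∧
      germ (chartPoint t₀ x₀)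
        (fun q : ChartSpace n => shapeMat (X q.1) (ν q.1) (param x₀ q.2) a b) =
        shape (familyGerm t₀ x₀ ν) (familyFrame t₀ x₀ X) a b := by
  have hev := eventually_mem_domain (x₀ := x₀) ht₀
  have hs := fun a => contDiffAt_component hF.smooth_normal x₀ hev.self_of_nhds a
  have hj := fun i a => contDiffAt_chartJac (x₀ := x₀) hF.smooth ht₀ i a
  have hb := fun i a => contDiffAt_chartJac (x₀ := x₀) hF.smooth_normal ht₀ i a
  -- Choose smooth representatives of the abstract shape entries; the two characterizing equations
  -- hold as germs, hence near the point, and identify these representatives with the geometric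
  -- form.
  choose f hf hfe using fun a b =>
    exists_germ_eq (shape (familyGerm t₀ x₀ ν) (familyFrame t₀ x₀ X) a b)
  have h1 : ∀ i b, ∀ᶠ q in nhds (chartPoint t₀ x₀),
      ∑ a, chartJac x₀ (X q.1) q.2 i a * f a b q = chartJac x₀ (ν q.1) q.2 i b := by
    intro i b
    have h := sum_mul_coordFrame (hF.isUnit_det (x₀ := x₀) ht₀) (Pi.single i 1)
      (familyGerm t₀ x₀ ν b)
    have e1 : ∀ f : Fin n → SmoothGerm (chartPoint t₀ x₀),
        ∑ j, (Pi.single i 1 : Fin n → SmoothGerm (chartPoint t₀ x₀)) j * f j = f i := by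
      intro f
      rw [Finset.sum_eq_single i (fun j _ hji => by simp [hji]) (by simp)]
      simp
    simp only [e1] at h
    have h' : ∑ a, spaceDeriv _ i (familyGerm t₀ x₀ X a) *
        shape (familyGerm t₀ x₀ ν) (familyFrame t₀ x₀ X) a b =
        spaceDeriv _ i (familyGerm t₀ x₀ ν b) := h
    simp only [spaceDeriv_familyGerm hF.smooth ht₀, spaceDeriv_familyGerm hF.smooth_normal ht₀,
      ← hfe, ← fun a => germ_mul (hj i a) (hf a b)] at h'
    rw [← germ_sum _ fun a _ => (hj i a).mul (hf a b)] at h'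
    exact (germ_eq_iff (ContDiffAt.sum fun a _ => (hj i a).mul (hf a b)) (hb i b)).1 h'
  have h2 : ∀ b, ∀ᶠ q in nhds (chartPoint t₀ x₀),
      ∑ a, chartFamily x₀ ν q a * f a b q = 0 := by
    intro b
    have h := (hF.isTangentialFrame (x₀ := x₀) ht₀).normal_shape b
    change ∑ a, germ _ (fun q => chartFamily x₀ ν q a) *
        shape (familyGerm t₀ x₀ ν) (familyFrame t₀ x₀ X) a b = 0 at h
    simp only [← hfe, ← fun a => germ_mul (hs a) (hf a b)] at h
    rw [← germ_sum _ fun a _ => (hs a).mul (hf a b),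
      ← map_zero (algebraMap ℝ (SmoothGerm (chartPoint t₀ x₀))),
      ← germ_const] at h
    exact (germ_eq_iff (ContDiffAt.sum fun a _ => (hs a).mul (hf a b)) contDiffAt_const).1 h
  have h3 : ∀ᶠ q in nhds (chartPoint t₀ x₀),
      shapeMat (X q.1) (ν q.1) (param x₀ q.2) = of fun a b => f a b q := by
    filter_upwards [hev, Filter.eventually_all.2 fun i => Filter.eventually_all.2 fun b => h1 i b,
      Filter.eventually_all.2 h2] with q hq hq1 hq2
    have hq' := Set.Ioo_subset_Ico_self hq.1
    refine eq_shapeMat x₀ hq.2 ((contMDiff_slice hF.smooth hq').mdifferentiableAt (by simp))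
      ((contMDiff_slice hF.smooth_normal hq').mdifferentiableAt (by simp))
      (hF.immersed q.1 hq') ?_ ?_
    · ext i b
      simpa [mul_apply] using hq1 i b
    · ext b
      simpa [vecMul, dotProduct, chartFamily] using hq2 b
  have h4 : (fun q : ChartSpace n => shapeMat (X q.1) (ν q.1) (param x₀ q.2) a b)
      =ᶠ[nhds (chartPoint t₀ x₀)] f a b := by
    filter_upwards [h3] with q hq
    rw [hq, of_apply]
  exact ⟨(hf a b).congr_of_eventuallyEq h4, by rw [← hfe a b]; exact germ_congr h4⟩

theorem meanCurvature_germ (ht₀ : t₀ ∈ Set.Ioo 0 T) :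
    ContDiffAt ℝ ∞ (fun q : ChartSpace n => meanCurvature (X q.1) (ν q.1) (param x₀ q.2))
        (chartPoint t₀ x₀) ∧
      germ (chartPoint t₀ x₀)
        (fun q : ChartSpace n => meanCurvature (X q.1) (ν q.1) (param x₀ q.2)) =
        meanCurv (familyGerm t₀ x₀ ν) (familyFrame t₀ x₀ X) := by
  have h := fun a b => hF.shape_germ (x₀ := x₀) ht₀ a b
  refine ⟨ContDiffAt.sum fun a _ => (h a a).1, ?_⟩
  simp only [meanCurvature]
  rw [germ_sum _ fun a _ => (h a a).1]
  exact Finset.sum_congr rfl fun a _ => (h a a).2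

theorem shapeNormSq_germ (ht₀ : t₀ ∈ Set.Ioo 0 T) :
    ContDiffAt ℝ ∞ (fun q : ChartSpace n => shapeNormSq (X q.1) (ν q.1) (param x₀ q.2))
        (chartPoint t₀ x₀) ∧
      germ (chartPoint t₀ x₀)
        (fun q : ChartSpace n => shapeNormSq (X q.1) (ν q.1) (param x₀ q.2)) =
        normSq (familyGerm t₀ x₀ ν) (familyFrame t₀ x₀ X) := by
  have h := fun a b => hF.shape_germ (x₀ := x₀) ht₀ a b
  have h2 := fun a b => (h a b).1.mul (h a b).1
  refine ⟨ContDiffAt.sum fun a _ => ContDiffAt.sum fun b _ => h2 a b, ?_⟩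
  simp only [shapeNormSq]
  rw [germ_sum _ fun a _ => ContDiffAt.sum fun b _ => h2 a b]
  refine Finset.sum_congr rfl fun a _ => ?_
  rw [germ_sum _ fun b _ => h2 a b]
  exact Finset.sum_congr rfl fun b _ => by rw [germ_mul (h a b).1 (h a b).1, (h a b).2]

theorem shapeMat_isSymm_of_pos (ht₀ : t₀ ∈ Set.Ioo 0 T) (x₀ : Sph n) :
    (shapeMat (X t₀) (ν t₀) x₀).IsSymm := by
  refine Matrix.IsSymm.ext fun a b => ?_
  have h := congrArg (ev _) ((hF.isTangentialFrame (x₀ := x₀) ht₀).shape_symm a b)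
  rw [← (hF.shape_germ ht₀ a b).2, ← (hF.shape_germ ht₀ b a).2, ev_germ (hF.shape_germ ht₀ a b).1,
    ev_germ (hF.shape_germ ht₀ b a).1, param_chartPoint] at h
  exact h.symm

end IsSmoothFamily

/-- Germs are taken at interior times only. Freezing a single hypersurface in time makes facts such
as the symmetry of h available at t = 0 too. -/
theorem isSmoothFamily_const {X₀ ν₀ : Sph n → Amb n}
    (hX : ContMDiff (𝓡 n) 𝓘(ℝ, Amb n) ∞ X₀) (hν : ContMDiff (𝓡 n) 𝓘(ℝ, Amb n) ∞ ν₀)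
    (him : IsImmersedWithNormal X₀ ν₀) : IsSmoothFamily 1 (fun _ => X₀) (fun _ => ν₀) where
  smooth := (hX.comp contMDiff_snd).contMDiffOn
  smooth_normal := (hν.comp contMDiff_snd).contMDiffOn
  immersed _ _ := him

theorem shapeMat_isSymm {X₀ ν₀ : Sph n → Amb n}
    (hX : ContMDiff (𝓡 n) 𝓘(ℝ, Amb n) ∞ X₀) (hν : ContMDiff (𝓡 n) 𝓘(ℝ, Amb n) ∞ ν₀)
    (him : IsImmersedWithNormal X₀ ν₀) (x : Sph n) : (shapeMat X₀ ν₀ x).IsSymm :=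
  (isSmoothFamily_const hX hν him).shapeMat_isSymm_of_pos (t₀ := 1 / 2) (by norm_num) x

end GermsOfFamilies

/-! ### Minima in space-time and first zeros. -/

section Touching

/-- A negative second derivative would make the point a local maximum too, hence the function
locally constant with zero second derivative. -/
theorem deriv_deriv_nonneg_of_isLocalMin {g : ℝ → ℝ} {s : ℝ} (hg : ContinuousAt g s)
    (hmin : IsLocalMin g s) : 0 ≤ deriv (deriv g) s := by
  by_contra hneg
  have hmax := isLocalMax_of_deriv_deriv_neg (not_le.1 hneg) hmin.deriv_eq_zero hg
  have hconst : g =ᶠ[nhds s] fun _ => g s := by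
    filter_upwards [hmin, hmax] with y h1 h2
    exact le_antisymm h2 h1
  have h2 : deriv (deriv g) s = 0 := by
    rw [hconst.deriv.deriv_eq]
    simp
  rw [h2] at hneg
  exact hneg le_rfl

theorem deriv_nonpos_of_le_left {g : ℝ → ℝ} {g' s : ℝ} (hg : HasDerivAt g g' s)
    (hle : ∀ᶠ y in nhdsWithin s (Set.Iio s), g s ≤ g y) : g' ≤ 0 := by
  have h := (hasDerivWithinAt_iff_tendsto_slope' (s := Set.Iio s) (by simp)).1
    hg.hasDerivWithinAt
  refine le_of_tendsto h ?_
  filter_upwards [hle, self_mem_nhdsWithin] with y hy hys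
  rw [slope_def_field]
  exact div_nonpos_of_nonneg_of_nonpos (by linarith) (by linarith [Set.mem_Iio.1 hys])

section

variable {E : Type*} [NormedAddCommGroup E] [NormedSpace ℝ E] {p : E}

theorem germDeriv_sum_smul {κ : Type*} [Fintype κ] (w : κ → E) (ξ : κ → ℝ) (f : SmoothGerm p) :
    germDeriv p (∑ i, ξ i • w i) f = ∑ i, algebraMap ℝ _ (ξ i) * germDeriv p (w i) f := by
  obtain ⟨f, hf, rfl⟩ := exists_germ_eq f
  have hs := fun i => contDiffAt_fderiv_apply hf (w i)
  simp only [germDeriv_germ _ hf, ← germ_const, ← fun i =>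
    germ_mul (contDiffAt_const (c := ξ i)) (hs i)]
  rw [← germ_sum _ fun i _ => contDiffAt_const.mul (hs i)]
  simp

theorem ev_germDeriv_germDeriv_nonneg {f : E → ℝ} (hf : ContDiffAt ℝ ∞ f p) (w : E)
    (hmin : IsLocalMin (fun s : ℝ => f (p + s • w)) 0) :
    0 ≤ ev p (germDeriv p w (germDeriv p w (germ p f))) := by
  have hl : ∀ s : ℝ, HasDerivAt (fun s : ℝ => p + s • w) w s := fun s => by
    simpa using ((hasDerivAt_id s).smul_const w).const_add p
  have hp : (fun s : ℝ => p + s • w) 0 = p := by simp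
  have hcont : Filter.Tendsto (fun s : ℝ => p + s • w) (nhds 0) (nhds p) := by
    simpa [ContinuousAt] using (hl 0).continuousAt
  have h1 : deriv (fun s : ℝ => f (p + s • w)) =ᶠ[nhds 0]
      fun s => fderiv ℝ f (p + s • w) w := by
    filter_upwards [hcont.eventually (eventually_differentiableAt hf)] with s hs
    exact (hs.hasFDerivAt.comp_hasDerivAt s (hl s)).deriv
  have h2 : deriv (fun s : ℝ => fderiv ℝ f (p + s • w) w) 0 =
      fderiv ℝ (fun x => fderiv ℝ f x w) p w := by
    have hd : DifferentiableAt ℝ (fun x => fderiv ℝ f x w) p :=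
      (contDiffAt_fderiv_apply hf w).differentiableAt (by simp)
    have hd' : HasFDerivAt (fun x => fderiv ℝ f x w) (fderiv ℝ (fun x => fderiv ℝ f x w) p)
        ((fun s : ℝ => p + s • w) 0) := by rw [hp]; exact hd.hasFDerivAt
    exact (hd'.comp_hasDerivAt 0 (hl 0)).deriv
  have hc : ContinuousAt (fun s : ℝ => f (p + s • w)) 0 := by
    have h3 : ContinuousAt f ((fun s : ℝ => p + s • w) 0) := by rw [hp]; exact hf.continuousAt
    exact ContinuousAt.comp (x := (0 : ℝ)) h3 (hl 0).continuousAt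
  have h4 := deriv_deriv_nonneg_of_isLocalMin hc hmin
  rw [h1.deriv_eq, h2] at h4
  rwa [germDeriv_germ w hf, ev_germDeriv w (contDiffAt_fderiv_apply hf w)]

end

variable {n : ℕ} {t₀ : ℝ} {x₀ : Sph n}

/-- A space-time function in the chart at `x₀`. -/
def chartFunction (x₀ : Sph n) (q : ℝ → Sph n → ℝ) (z : ChartSpace n) : ℝ := q z.1 (param x₀ z.2)

theorem ev_chartFunction {q : ℝ → Sph n → ℝ}
    (hq : ContDiffAt ℝ ∞ (chartFunction x₀ q) (chartPoint t₀ x₀)) :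
    ev _ (germ (chartPoint t₀ x₀) (chartFunction x₀ q)) = q t₀ x₀ := by
  rw [ev_germ hq, chartFunction, param_chartPoint]
  rfl

/-- A function with a space-time minimum on `[0, t₀] × 𝕊ⁿ` at `(t₀, x₀)`. -/
theorem isTouching_of_minimum (X : ℝ → Sph n → Amb n) (ht₀ : 0 < t₀) {q : ℝ → Sph n → ℝ}
    (hq : ContDiffAt ℝ ∞ (chartFunction x₀ q) (chartPoint t₀ x₀))
    (hmin : ∀ t ∈ Set.Icc 0 t₀, ∀ x, q t₀ x₀ ≤ q t x) :
    IsTouching (ev _) (familyFrame t₀ x₀ X) (timeDeriv _)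
      (germ (chartPoint t₀ x₀) (chartFunction x₀ q)) := by
  set p := chartPoint t₀ x₀ with hp
  have hval : chartFunction x₀ q p = q t₀ x₀ := by
    rw [chartFunction, hp, param_chartPoint]; rfl
  have hspace : ∀ v : EuclideanSpace ℝ (Fin n),
      IsLocalMin (fun s : ℝ => chartFunction x₀ q (p + s • ((0 : ℝ), v))) 0 := fun v => by
    -- No neighbourhood is needed: `param x₀` is total with values in the sphere, and q at time t₀
    -- is minimal over the whole sphere.
    refine Filter.Eventually.of_forall fun s => ?_
    have e1 : chartFunction x₀ q (p + (0 : ℝ) • ((0 : ℝ), v)) = q t₀ x₀ := by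
      rw [zero_smul, add_zero, hval]
    have e2 : (p + s • ((0 : ℝ), v)).1 = t₀ := by simp [hp, chartPoint]
    show chartFunction x₀ q (p + (0 : ℝ) • ((0 : ℝ), v)) ≤
      chartFunction x₀ q (p + s • ((0 : ℝ), v))
    rw [e1, chartFunction, e2]
    exact hmin t₀ ⟨ht₀.le, le_rfl⟩ _
  have hcrit : ∀ i, ev p (spaceDeriv p i (germ p (chartFunction x₀ q))) = 0 := fun i => by
    rw [spaceDeriv, ev_germDeriv _ hq]
    have hd : HasFDerivAt (chartFunction x₀ q) (fderiv ℝ (chartFunction x₀ q) p)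
        (p + (0 : ℝ) • ((0 : ℝ), EuclideanSpace.single i (1 : ℝ))) := by
      rw [zero_smul, add_zero]; exact (hq.differentiableAt (by simp)).hasFDerivAt
    have hl : HasDerivAt (fun s : ℝ => p + s • ((0 : ℝ), EuclideanSpace.single i (1 : ℝ)))
        ((0 : ℝ), EuclideanSpace.single i (1 : ℝ)) 0 := by
      simpa using ((hasDerivAt_id (0 : ℝ)).smul_const
        ((0 : ℝ), EuclideanSpace.single i (1 : ℝ))).const_add p
    have h := HasFDerivAt.comp_hasDerivAt (f := fun s : ℝ =>
      p + s • ((0 : ℝ), EuclideanSpace.single i (1 : ℝ))) 0 hd hl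
    exact (hspace (EuclideanSpace.single i 1)).hasDerivAt_eq_zero h
  refine ⟨map_coordFrame_eq_zero _ _ _ hcrit, contract_hessian_nonneg _ _ _ hcrit fun ξ => ?_, ?_⟩
  · have h := ev_germDeriv_germDeriv_nonneg hq
      (∑ i, ξ i • ((0 : ℝ), EuclideanSpace.single i (1 : ℝ))) (by
        have : ∑ i, ξ i • ((0 : ℝ), EuclideanSpace.single i (1 : ℝ)) =
            ((0 : ℝ), ∑ i, ξ i • EuclideanSpace.single i (1 : ℝ)) := by
          ext1
          · simp [Prod.fst_sum]
          · simp [Prod.snd_sum]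
        rw [this]
        exact hspace _)
    simp only [germDeriv_sum_smul, map_sum, Derivation.leibniz, Derivation.map_algebraMap,
      smul_eq_mul, mul_zero, add_zero, map_mul, AlgHom.commutes, Algebra.algebraMap_self,
      RingHom.id_apply, Finset.mul_sum] at h
    refine h.trans_eq ?_
    refine Finset.sum_congr rfl fun i _ => Finset.sum_congr rfl fun j _ => ?_
    rw [← mul_assoc, germDeriv_comm]
    rfl
  · rw [timeDeriv, ev_germDeriv _ hq]
    have hd : HasFDerivAt (chartFunction x₀ q) (fderiv ℝ (chartFunction x₀ q) p)
        ((fun s : ℝ => (s, p.2)) t₀) := (hq.differentiableAt (by simp)).hasFDerivAt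
    have hl : HasDerivAt (fun s : ℝ => (s, p.2)) ((1 : ℝ), (0 : EuclideanSpace ℝ (Fin n))) t₀ :=
      (hasDerivAt_id t₀).prodMk (hasDerivAt_const t₀ p.2)
    refine deriv_nonpos_of_le_left (hd.comp_hasDerivAt t₀ hl) ?_
    have : Set.Ioo 0 t₀ ∈ nhdsWithin t₀ (Set.Iio t₀) := Ioo_mem_nhdsLT ht₀
    filter_upwards [this] with s hs
    show chartFunction x₀ q p ≤ _
    rw [hval]
    exact hmin s ⟨hs.1.le, hs.2.le⟩ _

/-- A continuous function which is positive initially and not positive later has a first zero. -/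
theorem exists_first_zero {T : ℝ} {q : ℝ → Sph n → ℝ}
    (hq : ContinuousOn (fun p : ℝ × Sph n => q p.1 p.2) (Set.Ico 0 T ×ˢ Set.univ))
    (h0 : ∀ x, 0 < q 0 x) {t₁ : ℝ} (ht₁ : t₁ ∈ Set.Ico 0 T) {x₁ : Sph n} (h1 : q t₁ x₁ ≤ 0) :
    ∃ t₀ ∈ Set.Ioc 0 t₁, ∃ x₀, q t₀ x₀ = 0 ∧ ∀ t ∈ Set.Icc 0 t₀, ∀ x, 0 ≤ q t x := by
  have hsub : Set.Icc 0 t₁ ×ˢ (Set.univ : Set (Sph n)) ⊆ Set.Ico 0 T ×ˢ Set.univ :=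
    Set.prod_mono (fun t ht => ⟨ht.1, ht.2.trans_lt ht₁.2⟩) subset_rfl
  have hc := hq.mono hsub
  have hcomp : IsCompact (Set.Icc 0 t₁ ×ˢ (Set.univ : Set (Sph n))) :=
    isCompact_Icc.prod isCompact_univ
  -- Take the earliest time in the compact set where q ≤ 0; the intermediate value theorem on each
  -- time line excludes negative values up to that time.
  set K := (Set.Icc 0 t₁ ×ˢ (Set.univ : Set (Sph n))) ∩
    (fun p : ℝ × Sph n => q p.1 p.2) ⁻¹' Set.Iic 0 with hK
  have hKc : IsCompact K := hcomp.of_isClosed_subset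
    (hc.preimage_isClosed_of_isClosed hcomp.isClosed isClosed_Iic) Set.inter_subset_left
  obtain ⟨⟨t₀, x₀⟩, hmem, hmin⟩ := hKc.exists_isMinOn
    ⟨(t₁, x₁), ⟨⟨⟨ht₁.1, le_rfl⟩, Set.mem_univ _⟩, h1⟩⟩ continuousOn_fst
  have ht₀ : t₀ ∈ Set.Icc 0 t₁ := hmem.1.1
  have hle : q t₀ x₀ ≤ 0 := hmem.2
  have hpos : 0 < t₀ := by
    rcases ht₀.1.lt_or_eq with h | h
    · exact h
    · rw [← h] at hle
      exact absurd hle (not_le.2 (h0 x₀))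
  have hbefore : ∀ t ∈ Set.Icc 0 t₁, ∀ x, q t x ≤ 0 → t₀ ≤ t := fun t ht x hx =>
    hmin (show (t, x) ∈ K from ⟨⟨ht, Set.mem_univ _⟩, hx⟩)
  have hnn : ∀ t ∈ Set.Icc 0 t₀, ∀ x, 0 ≤ q t x := by
    intro t ht x
    by_contra hneg
    rw [not_le] at hneg
    have hct : ContinuousOn (fun s => q s x) (Set.Icc 0 t) := by
      refine hc.comp (f := fun s : ℝ => (s, x)) (by fun_prop) fun s hs =>
        ⟨⟨hs.1, hs.2.trans (ht.2.trans ht₀.2)⟩, Set.mem_univ _⟩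
    obtain ⟨s, hs, hs0⟩ := intermediate_value_Icc' ht.1 hct ⟨hneg.le, (h0 x).le⟩
    have h2 := hbefore s ⟨hs.1, hs.2.trans (ht.2.trans ht₀.2)⟩ x hs0.le
    have h3 : s = t := le_antisymm hs.2 (ht.2.trans h2)
    rw [h3] at hs0
    exact hneg.ne hs0
  exact ⟨t₀, ⟨hpos, ht₀.2⟩, x₀, le_antisymm hle (hnn t₀ ⟨hpos.le, le_rfl⟩ x₀), hnn⟩

end Touching

/-! ### Germs and continuity of the geometric quantities of a solution. -/

section Solutions

open Matrix

variable {n : ℕ}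

/-- The squared distance to the origin. -/
def radiusSq (X : Sph n → Amb n) (x : Sph n) : ℝ := ∑ a, X x a * X x a

/-- The support function. -/
def supportFunction (X ν : Sph n → Amb n) (x : Sph n) : ℝ := ∑ a, X x a * ν x a

theorem radiusSq_eq (X : Sph n → Amb n) (x : Sph n) : radiusSq X x = ‖X x‖ ^ 2 := by
  rw [radiusSq, EuclideanSpace.real_norm_sq_eq]
  exact Finset.sum_congr rfl fun a _ => (sq _).symm

theorem supportFunction_eq (X ν : Sph n → Amb n) (x : Sph n) :
    supportFunction X ν x = inner ℝ (X x) (ν x) := by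
  rw [supportFunction, PiLp.inner_apply]
  exact Finset.sum_congr rfl fun a _ => by simp [mul_comm]

theorem norm_rpow_eq (X : Sph n → Amb n) (x : Sph n) (α : ℝ) :
    ‖X x‖ ^ α = radiusSq X x ^ (α / 2) := by
  rw [radiusSq_eq, ← Real.rpow_natCast, ← Real.rpow_mul (norm_nonneg _)]
  congr 1
  push_cast
  ring

section Hypersurface

variable {X ν : Sph n → Amb n} (hn : 2 ≤ n) (hX : ContMDiff (𝓡 n) 𝓘(ℝ, Amb n) ∞ X)
  (hν : ContMDiff (𝓡 n) 𝓘(ℝ, Amb n) ∞ ν) (him : IsImmersedWithNormal X ν) (h2 : TwoConvex X ν)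
include hn hX hν him h2

theorem meanCurvature_pos (x : Sph n) : 0 < meanCurvature X ν x := by
  have h := (h2 x).1
  rw [sigma_one_eq (shapeMat_isSymm hX hν him x)] at h
  have hn0 : (0 : ℝ) < n := by exact_mod_cast (by omega : 0 < n)
  exact (div_pos_iff_of_pos_right hn0).1 h

theorem shapeNormSq_lt (x : Sph n) : shapeNormSq X ν x < meanCurvature X ν x ^ 2 := by
  have h := (h2 x).2
  rw [sigma_two_eq (shapeMat_isSymm hX hν him x)] at h
  have hn0 : (2 : ℝ) ≤ n := by exact_mod_cast hn
  have := (div_pos_iff_of_pos_right (by nlinarith : (0 : ℝ) < n * (n - 1))).1 h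
  linarith

theorem normA_le_meanCurvature (x : Sph n) : normA X ν x ≤ meanCurvature X ν x := by
  rw [normA_eq (isUnit_det_jac him x) (shapeMat_isSymm hX hν him x)]
  exact Real.sqrt_le_iff.2 ⟨(meanCurvature_pos hn hX hν him h2 x).le,
    (shapeNormSq_lt hn hX hν him h2 x).le⟩

end Hypersurface

namespace IsSolution

variable {α T : ℝ} {X₀ ν₀ : Sph n → Amb n} {X ν : ℝ → Sph n → Amb n}
  (hS : IsSolution α T X₀ ν₀ X ν) {t₀ : ℝ} {x₀ : Sph n}
include hS

theorem isSmoothFamily : IsSmoothFamily T X ν := ⟨hS.smooth, hS.smooth_normal, hS.immersed⟩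

theorem contDiffAt_radiusSq (ht₀ : t₀ ∈ Set.Ioo 0 T) :
    ContDiffAt ℝ ∞ (chartFunction x₀ fun t => radiusSq (X t)) (chartPoint t₀ x₀) := by
  have hs := fun a => contDiffAt_component hS.smooth x₀
    (eventually_mem_domain (x₀ := x₀) ht₀).self_of_nhds a
  exact ContDiffAt.sum (s := Finset.univ) fun a _ => (hs a).mul (hs a)

theorem radiusSq_germ (ht₀ : t₀ ∈ Set.Ioo 0 T) :
    germ (chartPoint t₀ x₀) (chartFunction x₀ fun t => radiusSq (X t)) =
      ∑ a, familyGerm t₀ x₀ X a * familyGerm t₀ x₀ X a := by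
  have hs := fun a => contDiffAt_component hS.smooth x₀
    (eventually_mem_domain (x₀ := x₀) ht₀).self_of_nhds a
  exact (germ_sum Finset.univ fun a _ => (hs a).mul (hs a)).trans
    (Finset.sum_congr rfl fun a _ => germ_mul (hs a) (hs a))

theorem contDiffAt_support (ht₀ : t₀ ∈ Set.Ioo 0 T) :
    ContDiffAt ℝ ∞ (chartFunction x₀ fun t => supportFunction (X t) (ν t))
      (chartPoint t₀ x₀) := by
  have hev := (eventually_mem_domain (x₀ := x₀) ht₀).self_of_nhds
  exact ContDiffAt.sum (s := Finset.univ) fun a _ => (contDiffAt_component hS.smooth x₀ hev a).mul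
    (contDiffAt_component hS.smooth_normal x₀ hev a)

theorem support_germ (ht₀ : t₀ ∈ Set.Ioo 0 T) :
    germ (chartPoint t₀ x₀) (chartFunction x₀ fun t => supportFunction (X t) (ν t)) =
      support (familyGerm t₀ x₀ X) (familyGerm t₀ x₀ ν) := by
  have hev := (eventually_mem_domain (x₀ := x₀) ht₀).self_of_nhds
  have hs := fun a => contDiffAt_component hS.smooth x₀ hev a
  have hs' := fun a => contDiffAt_component hS.smooth_normal x₀ hev a
  exact (germ_sum Finset.univ fun a _ => (hs a).mul (hs' a)).trans
    (Finset.sum_congr rfl fun a _ => germ_mul (hs a) (hs' a))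

theorem speedF_sq (hn : 2 ≤ n) {t : ℝ} (ht : t ∈ Set.Ico 0 T) (x : Sph n) :
    0 < speedF (X t) (ν t) x ∧
      meanCurvature (X t) (ν t) x * meanCurvature (X t) (ν t) x - shapeNormSq (X t) (ν t) x =
        n * (n - 1) * (speedF (X t) (ν t) x * speedF (X t) (ν t) x) ∧
      speedF (X t) (ν t) x =
        √((meanCurvature (X t) (ν t) x ^ 2 - shapeNormSq (X t) (ν t) x) / (n * (n - 1))) := by
  have h := (hS.twoConvex t ht x).2
  have e := sigma_two_eq (shapeMat_isSymm (contMDiff_slice hS.smooth ht)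
    (contMDiff_slice hS.smooth_normal ht) (hS.immersed t ht) x)
  have hn0 : (2 : ℝ) ≤ n := by exact_mod_cast hn
  have hn1 : (n : ℝ) * (n - 1) ≠ 0 := (by nlinarith : (0 : ℝ) < n * (n - 1)).ne'
  refine ⟨Real.sqrt_pos.2 h, ?_, by rw [speedF, e]⟩
  rw [speedF, Real.mul_self_sqrt h.le, e, ← mul_div_assoc, mul_div_cancel_left₀ _ hn1]
  ring

theorem contDiffAt_speedF (hn : 2 ≤ n) (ht₀ : t₀ ∈ Set.Ioo 0 T) :
    ContDiffAt ℝ ∞ (chartFunction x₀ fun t => speedF (X t) (ν t)) (chartPoint t₀ x₀) := by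
  have ht := Set.Ioo_subset_Ico_self ht₀
  have hev := eventually_mem_domain (x₀ := x₀) ht₀
  have h1 := (((hS.isSmoothFamily.meanCurvature_germ (x₀ := x₀) ht₀).1.pow 2).sub
    (hS.isSmoothFamily.shapeNormSq_germ (x₀ := x₀) ht₀).1).div_const ((n : ℝ) * (n - 1))
  refine (h1.sqrt ?_).congr_of_eventuallyEq ?_
  · have h2 := hS.speedF_sq hn ht (param x₀ (chartPoint t₀ x₀).2)
    have h3 := h2.1
    rw [h2.2.2, Real.sqrt_pos] at h3
    exact h3.ne'
  · filter_upwards [hev] with q hq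
    exact (hS.speedF_sq hn (Set.Ioo_subset_Ico_self hq.1) _).2.2

theorem timeDeriv_familyGerm (ht₀ : t₀ ∈ Set.Ioo 0 T) (a : Fin (n + 1)) :
    timeDeriv _ (familyGerm t₀ x₀ X a) = germ (chartPoint t₀ x₀) fun q =>
      chartFamily x₀ X q a - chartFunction x₀ (fun t => speedF (X t) (ν t)) q *
        chartFunction x₀ (fun t x => ‖X t x‖ ^ α) q * chartFamily x₀ ν q a := by
  have hev := eventually_mem_domain (x₀ := x₀) ht₀
  rw [timeDeriv, familyGerm,
    germDeriv_germ _ (contDiffAt_component hS.smooth x₀ hev.self_of_nhds a)]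
  apply germ_congr
  filter_upwards [hev] with q hq
  rw [fderiv_component hS.smooth x₀ hq]
  have h1 : HasFDerivAt (chartFamily x₀ X) (fderiv ℝ (chartFamily x₀ X) q)
      ((fun s : ℝ => (s, q.2)) q.1) :=
    ((contDiffAt_chartFamily hS.smooth x₀ hq).differentiableAt (by simp)).hasFDerivAt
  have h2 : HasDerivAt (fun s : ℝ => (s, q.2)) ((1 : ℝ), (0 : EuclideanSpace ℝ (Fin n))) q.1 :=
    (hasDerivAt_id q.1).prodMk (hasDerivAt_const q.1 q.2)
  have h3 := h1.comp_hasDerivAt q.1 h2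
  have h4 := (hS.evolution q.1 (Set.Ioo_subset_Ico_self hq.1) (param x₀ q.2)).hasDerivAt
    (Ico_mem_nhds hq.1.1 hq.1.2)
  rw [h3.unique h4]
  simp [chartFamily, chartFunction]
  ring

theorem isFlowPoint (hn : 2 ≤ n) (ht₀ : t₀ ∈ Set.Ioo 0 T) (hpos : 0 < radiusSq (X t₀) x₀) :
    ∃ F R s, IsFlowPoint (ev (chartPoint t₀ x₀)) n α (familyGerm t₀ x₀ X) (familyGerm t₀ x₀ ν)
        (familyFrame t₀ x₀ X) (timeDeriv _) F R s ∧
      ev _ R = radiusSq (X t₀) x₀ ^ (α / 2) ∧ ev _ s = (radiusSq (X t₀) x₀)⁻¹ := by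
  set p := chartPoint t₀ x₀ with hp
  have ht := Set.Ioo_subset_Ico_self ht₀
  have hev := eventually_mem_domain (x₀ := x₀) ht₀
  set fQ := chartFunction x₀ fun t => radiusSq (X t) with hfQ
  set fF := chartFunction x₀ fun t => speedF (X t) (ν t) with hfF
  have hQ : ContDiffAt ℝ ∞ fQ p := hS.contDiffAt_radiusSq ht₀
  have hF : ContDiffAt ℝ ∞ fF p := hS.contDiffAt_speedF hn ht₀
  have hval : fQ p = radiusSq (X t₀) x₀ := by
    rw [hfQ, chartFunction, hp, param_chartPoint]; rfl
  have hQ0 : fQ p ≠ 0 := by rw [hval]; exact hpos.ne'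
  have hQpos : ∀ᶠ q in nhds p, 0 < fQ q :=
    hQ.continuousAt.eventually (lt_mem_nhds (by rw [hval]; exact hpos))
  have hR : ContDiffAt ℝ ∞ (fun q => fQ q ^ (α / 2)) p := hQ.rpow_const_of_ne hQ0
  have hi : ContDiffAt ℝ ∞ (fun q => (fQ q)⁻¹) p := hQ.inv hQ0
  have hH := hS.isSmoothFamily.meanCurvature_germ (x₀ := x₀) ht₀
  have hN := hS.isSmoothFamily.shapeNormSq_germ (x₀ := x₀) ht₀
  have hflow : ∀ a, timeDeriv _ (familyGerm t₀ x₀ X a) = familyGerm t₀ x₀ X a -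
      germ p fF * germ p (fun q => fQ q ^ (α / 2)) * familyGerm t₀ x₀ ν a := fun a => by
    rw [hS.timeDeriv_familyGerm ht₀, familyGerm, familyGerm]
    have hX := contDiffAt_component hS.smooth x₀ hev.self_of_nhds a
    have hν := contDiffAt_component hS.smooth_normal x₀ hev.self_of_nhds a
    rw [← germ_mul hF hR, ← germ_mul (hF.mul hR) hν, ← germ_sub hX ((hF.mul hR).mul hν)]
    apply germ_congr
    filter_upwards with q
    simp only [chartFunction, norm_rpow_eq, hfQ]
    rfl
  -- R and s are written as powers of r², which is smooth and positive here; the square root in F is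
  -- smooth because σ₂ > 0.
  refine ⟨germ p fF, germ p (fun q => fQ q ^ (α / 2)), germ p (fun q => (fQ q)⁻¹),
    { toIsFlowFrame := hS.isSmoothFamily.isFlowFrame ht₀ hflow
      card := by simp
      two_le := hn
      two_sigma := ?_
      speed_pos := ?_
      meanCurv_pos := ?_
      weight_pos := ?_
      inv_radiusSq := ?_
      deriv_weight := ?_ }, ?_, ?_⟩
  · rw [← hH.2, ← hN.2, ← germ_mul hH.1 hH.1, ← germ_sub (hH.1.mul hH.1) hN.1, ← germ_mul hF hF,
      ← germ_const, ← germ_mul contDiffAt_const (hF.mul hF)]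
    apply germ_congr
    filter_upwards [hev] with q hq
    exact (hS.speedF_sq hn (Set.Ioo_subset_Ico_self hq.1) _).2.1
  · rw [ev_germ hF]
    exact (hS.speedF_sq hn ht _).1
  · rw [← hH.2, ev_germ hH.1]
    exact meanCurvature_pos hn (contMDiff_slice hS.smooth ht)
      (contMDiff_slice hS.smooth_normal ht) (hS.immersed _ ht) (hS.twoConvex _ ht) _
  · rw [ev_germ hR]
    exact Real.rpow_pos_of_pos hQpos.self_of_nhds _
  · rw [← hS.radiusSq_germ ht₀, ← germ_mul hi hQ, ← map_one (algebraMap ℝ (SmoothGerm p)),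
      ← germ_const]
    apply germ_congr
    filter_upwards [hQpos] with q hq
    exact inv_mul_cancel₀ hq.ne'
  · intro a
    have e1 : germ p (fun q => fQ q ^ (α / 2)) * germ p (fun q => (fQ q)⁻¹) =
        germ p fun q => fQ q ^ (α / 2 - 1) := by
      rw [← germ_mul hR hi]
      apply germ_congr
      filter_upwards [hQpos] with q hq
      exact ((Real.rpow_sub_one hq.ne' _).trans (div_eq_mul_inv _ _)).symm
    rw [e1, ← hS.radiusSq_germ ht₀, familyFrame, coordFrame_apply, coordFrame_apply]
    simp only [mulVec, dotProduct, spaceDeriv, Finset.mul_sum]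
    refine Finset.sum_congr rfl fun i _ => ?_
    rw [germDeriv_rpow _ hQ hQ0]
    ring
  · rw [ev_germ hR]; simp only [hval]
  · rw [ev_germ hi]; simp only [hval]

theorem continuousOn_component (a : Fin (n + 1)) :
    ContinuousOn (fun p : ℝ × Sph n => X p.1 p.2 a) (Set.Ico 0 T ×ˢ Set.univ) :=
  (EuclideanSpace.proj (𝕜 := ℝ) a : Amb n →L[ℝ] ℝ).continuous.comp_continuousOn
    hS.smooth.continuousOn

theorem continuousOn_radiusSq :
    ContinuousOn (fun p : ℝ × Sph n => radiusSq (X p.1) p.2) (Set.Ico 0 T ×ˢ Set.univ) :=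
  continuousOn_finsetSum _ fun a _ => (hS.continuousOn_component a).mul
    (hS.continuousOn_component a)

theorem continuousOn_supportFunction :
    ContinuousOn (fun p : ℝ × Sph n => supportFunction (X p.1) (ν p.1) p.2)
      (Set.Ico 0 T ×ˢ Set.univ) :=
  continuousOn_finsetSum _ fun a _ => (hS.continuousOn_component a).mul
    ((EuclideanSpace.proj (𝕜 := ℝ) a : Amb n →L[ℝ] ℝ).continuous.comp_continuousOn
      hS.smooth_normal.continuousOn)

end IsSolution

theorem IsSmoothFamily.continuousOn_meanCurvature {T : ℝ} {X ν : ℝ → Sph n → Amb n}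
    (hF : IsSmoothFamily T X ν) :
    ContinuousOn (fun p : ℝ × Sph n => meanCurvature (X p.1) (ν p.1) p.2)
      (Set.Ico 0 T ×ˢ Set.univ) :=
  continuousOn_finsetSum _ fun a _ =>
    (continuous_id.matrix_elem a a).comp_continuousOn hF.continuousOn_shapeMat

end Solutions

/-! ### The four a priori estimates. -/

section APrioriEstimates

variable {n : ℕ}

theorem exists_forall_lt {f : Sph n → ℝ} (hf : Continuous f) : ∃ M, 1 ≤ M ∧ ∀ x, f x < M := by
  obtain ⟨M, hM⟩ := (isCompact_range hf).bddAbove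
  refine ⟨max M 0 + 1, by linarith [le_max_right M 0], fun x => ?_⟩
  linarith [hM ⟨x, rfl⟩, le_max_left M 0]

theorem exists_pos_forall_lt {f : Sph n → ℝ} (hf : Continuous f) (hpos : ∀ x, 0 < f x) :
    ∃ c, 0 < c ∧ c ≤ 1 ∧ ∀ x, c < f x := by
  obtain ⟨M, hM1, hM⟩ := exists_forall_lt (hf.inv₀ fun x => (hpos x).ne')
  have hM0 : 0 < M := by linarith
  exact ⟨M⁻¹, inv_pos.2 hM0, inv_le_one_of_one_le₀ hM1, fun x =>
    (inv_lt_comm₀ (hpos x) hM0).1 (hM x)⟩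

/-- The germ of a function which is affine in time and constant in space. -/
theorem affine_germ (t₀ : ℝ) (x₀ : Sph n) (X : ℝ → Sph n → Amb n) (c ε : ℝ) :
    ContDiffAt ℝ ∞ (chartFunction x₀ fun t _ => c + ε * t) (chartPoint t₀ x₀) ∧
      (∀ a, familyFrame t₀ x₀ X a
        (germ (chartPoint t₀ x₀) (chartFunction x₀ fun t _ => c + ε * t)) = 0) ∧
      timeDeriv _ (germ (chartPoint t₀ x₀) (chartFunction x₀ fun t _ => c + ε * t)) =
        algebraMap ℝ _ ε := by
  have hd : ∀ q : ChartSpace n, HasFDerivAt (chartFunction x₀ fun t (_ : Sph n) => c + ε * t)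
      (ε • ContinuousLinearMap.fst ℝ ℝ (EuclideanSpace ℝ (Fin n))) q := fun q =>
    (hasFDerivAt_fst.const_mul ε).const_add c
  have hs : ContDiffAt ℝ ∞ (chartFunction x₀ fun t (_ : Sph n) => c + ε * t)
      (chartPoint t₀ x₀) := by
    show ContDiffAt ℝ ∞ (fun q : ChartSpace n => c + ε * q.1) _
    fun_prop
  refine ⟨hs, fun a => ?_, ?_⟩
  · have h0 : ∀ i, spaceDeriv _ i
        (germ (chartPoint t₀ x₀) (chartFunction x₀ fun t _ => c + ε * t)) = 0 := fun i => by
      rw [spaceDeriv, germDeriv_germ _ hs]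
      simp only [(hd _).fderiv]
      rw [← map_zero (algebraMap ℝ (SmoothGerm (chartPoint t₀ x₀))), ← germ_const]
      simp
    rw [familyFrame, coordFrame_apply]
    simp only [h0]
    exact congrFun (Matrix.mulVec_zero _) a
  · rw [timeDeriv, germDeriv_germ _ hs]
    simp only [(hd _).fderiv]
    rw [← germ_const]
    simp

namespace IsSolution

variable {α T : ℝ} {X₀ ν₀ : Sph n → Amb n} {X ν : ℝ → Sph n → Amb n}
  (hS : IsSolution α T X₀ ν₀ X ν) (hn : 2 ≤ n) (hα : 2 ≤ α)
include hS hn hα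

theorem radiusSq_le {R₁ : ℝ} (hR₁ : 1 ≤ R₁) (h0 : ∀ x, radiusSq X₀ x < R₁) :
    ∀ t ∈ Set.Ico 0 T, ∀ x, radiusSq (X t) x ≤ R₁ := by
  intro t₁ ht₁ x₁
  by_contra! hlt
  have ht1 : 0 < 1 + t₁ := by linarith [ht₁.1]
  -- The barrier R₁ + εt supplies the strictness needed at a touching point; this slope keeps it
  -- below the offending value at time t₁.
  set ε := (radiusSq (X t₁) x₁ - R₁) / (1 + t₁) with hεd
  have hε : 0 < ε := div_pos (by linarith) ht1
  have hεt : ε * (1 + t₁) = radiusSq (X t₁) x₁ - R₁ := div_mul_cancel₀ _ ht1.ne'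
  obtain ⟨t₀, ht₀, x₀, hzero, hnn⟩ := exists_first_zero (T := T)
    (q := fun t x => (R₁ + ε * t) - radiusSq (X t) x)
    (ContinuousOn.sub (by fun_prop) hS.continuousOn_radiusSq)
    (fun x => by simpa [hS.initial] using h0 x) ht₁ (x₁ := x₁) (by linarith)
  have ht : t₀ ∈ Set.Ioo 0 T := ⟨ht₀.1, ht₀.2.trans_lt ht₁.2⟩
  have hQ := hS.contDiffAt_radiusSq (x₀ := x₀) ht
  have hA := affine_germ t₀ x₀ X R₁ ε
  have hgerm : germ (chartPoint t₀ x₀) (chartFunction x₀ fun t x => (R₁ + ε * t) - radiusSq (X t) x)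
      = germ _ (chartFunction x₀ fun t _ => R₁ + ε * t) -
        ∑ a, familyGerm t₀ x₀ X a * familyGerm t₀ x₀ X a := by
    rw [← hS.radiusSq_germ ht]
    exact germ_sub hA.1 hQ
  have hq := isTouching_of_minimum X ht.1 (hA.1.sub hQ)
    (q := fun t x => (R₁ + ε * t) - radiusSq (X t) x)
    fun t ht' x => hzero.le.trans (hnn t ht' x)
  rw [hgerm] at hq
  have hQ1 : 1 ≤ radiusSq (X t₀) x₀ := by
    have := mul_pos hε ht.1
    linarith
  have heQ : ev _ (∑ a, familyGerm t₀ x₀ X a * familyGerm t₀ x₀ X a) = radiusSq (X t₀) x₀ := by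
    rw [← hS.radiusSq_germ ht, ev_chartFunction hQ]
  obtain ⟨F, R, s, hP, hR, -⟩ := hS.isFlowPoint hn ht (zero_lt_one.trans_le hQ1)
  refine hP.false_of_touching_radius_above hq hε (fun a => ?_) ?_ ?_ (by rwa [heQ])
  · rw [map_sub, hA.2.1, zero_sub]
  · rw [map_sub, hA.2.2]
  · rw [heQ, hR]
    exact Real.self_le_rpow_of_one_le hQ1 (by linarith)

theorem le_radiusSq {c₀ : ℝ} (hc₀ : c₀ ≤ 1) (h0 : ∀ x, c₀ < radiusSq X₀ x) :
    ∀ t ∈ Set.Ico 0 T, ∀ x, c₀ ≤ radiusSq (X t) x := by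
  intro t₁ ht₁ x₁
  by_contra! hlt
  have ht1 : 0 < 1 + t₁ := by linarith [ht₁.1]
  have hnonneg : 0 ≤ radiusSq (X t₁) x₁ := by rw [radiusSq_eq]; positivity
  set ε := (c₀ - radiusSq (X t₁) x₁) / (1 + t₁) with hεd
  have hε : 0 < ε := div_pos (by linarith) ht1
  have hεt : ε * (1 + t₁) = c₀ - radiusSq (X t₁) x₁ := div_mul_cancel₀ _ ht1.ne'
  obtain ⟨t₀, ht₀, x₀, hzero, hnn⟩ := exists_first_zero (T := T)
    (q := fun t x => (-c₀ + ε * t) + radiusSq (X t) x)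
    (ContinuousOn.add (by fun_prop) hS.continuousOn_radiusSq)
    (fun x => by simp only [hS.initial]; linarith [h0 x]) ht₁ (x₁ := x₁) (by linarith)
  have ht : t₀ ∈ Set.Ioo 0 T := ⟨ht₀.1, ht₀.2.trans_lt ht₁.2⟩
  have hQ := hS.contDiffAt_radiusSq (x₀ := x₀) ht
  have hA := affine_germ t₀ x₀ X (-c₀) ε
  have hgerm : germ (chartPoint t₀ x₀)
      (chartFunction x₀ fun t x => (-c₀ + ε * t) + radiusSq (X t) x) =
      germ _ (chartFunction x₀ fun t _ => -c₀ + ε * t) +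
        ∑ a, familyGerm t₀ x₀ X a * familyGerm t₀ x₀ X a := by
    rw [← hS.radiusSq_germ ht]
    exact germ_add hA.1 hQ
  have hq := isTouching_of_minimum X ht.1 (hA.1.add hQ)
    (q := fun t x => (-c₀ + ε * t) + radiusSq (X t) x)
    fun t ht' x => hzero.le.trans (hnn t ht' x)
  rw [hgerm] at hq
  have hQ1 : radiusSq (X t₀) x₀ ≤ 1 := by
    have := mul_pos hε ht.1
    linarith
  -- The choice of ε keeps c₀ − εt above the nonnegative value r²(t₁, x₁) for t ≤ t₁, so the
  -- touching point is not the origin.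
  have hQ0 : 0 < radiusSq (X t₀) x₀ := by
    have := mul_le_mul_of_nonneg_left ht₀.2 hε.le
    linarith
  have heQ : ev _ (∑ a, familyGerm t₀ x₀ X a * familyGerm t₀ x₀ X a) = radiusSq (X t₀) x₀ := by
    rw [← hS.radiusSq_germ ht, ev_chartFunction hQ]
  obtain ⟨F, R, s, hP, hR, -⟩ := hS.isFlowPoint hn ht hQ0
  refine hP.false_of_touching_radius_below hq hε (fun a => ?_) ?_ ?_
  · rw [map_add, hA.2.1, zero_add]
  · rw [map_add, hA.2.2]
  · rw [heQ, hR]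
    exact Real.rpow_le_self_of_le_one hQ0.le hQ1 (by linarith)

theorem le_supportFunction {c₀ R₁ c : ℝ} (hc₀ : 0 < c₀)
    (hle : ∀ t ∈ Set.Ico 0 T, ∀ x, c₀ ≤ radiusSq (X t) x)
    (hge : ∀ t ∈ Set.Ico 0 T, ∀ x, radiusSq (X t) x ≤ R₁)
    (hc : 0 < c) (hsmall : α ^ 2 * c ^ 2 * (c₀ ^ (α / 2 - 2) + R₁ ^ (α / 2 - 2)) < 1)
    (h0 : ∀ x, c < supportFunction X₀ ν₀ x) :
    ∀ t ∈ Set.Ico 0 T, ∀ x, c ≤ supportFunction (X t) (ν t) x := by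
  intro t₁ ht₁ x₁
  by_contra! hlt
  obtain ⟨t₀, ht₀, x₀, hzero, hnn⟩ := exists_first_zero (T := T)
    -- Slope zero suffices because the pointwise contradiction is already strict; the form c + 0 * t
    -- lets `affine_germ` supply the constant.
    (q := fun t x => supportFunction (X t) (ν t) x - (c + 0 * t))
    (ContinuousOn.sub hS.continuousOn_supportFunction (by fun_prop))
    (fun x => by simp only [hS.initial, hS.initial_normal]; linarith [h0 x]) ht₁ (x₁ := x₁)
    (by linarith)
  have ht : t₀ ∈ Set.Ioo 0 T := ⟨ht₀.1, ht₀.2.trans_lt ht₁.2⟩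
  have htc := Set.Ioo_subset_Ico_self ht
  have hu := hS.contDiffAt_support (x₀ := x₀) ht
  have hA := affine_germ t₀ x₀ X c 0
  have hgerm : germ (chartPoint t₀ x₀)
      (chartFunction x₀ fun t x => supportFunction (X t) (ν t) x - (c + 0 * t)) =
      support (familyGerm t₀ x₀ X) (familyGerm t₀ x₀ ν) -
        germ _ (chartFunction x₀ fun t _ => c + 0 * t) := by
    rw [← hS.support_germ ht]
    exact germ_sub hu hA.1
  have hq := isTouching_of_minimum X ht.1 (hu.sub hA.1)
    (q := fun t x => supportFunction (X t) (ν t) x - (c + 0 * t))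
    fun t ht' x => hzero.le.trans (hnn t ht' x)
  rw [hgerm] at hq
  have heu : ev _ (support (familyGerm t₀ x₀ X) (familyGerm t₀ x₀ ν)) = c := by
    rw [← hS.support_germ ht, ev_chartFunction hu]
    linarith
  have hQ0 : 0 < radiusSq (X t₀) x₀ := hc₀.trans_le (hle t₀ htc x₀)
  have hR₁ : 0 < R₁ := hQ0.trans_le (hge t₀ htc x₀)
  obtain ⟨F, R, s, hP, hR, hs⟩ := hS.isFlowPoint hn ht hQ0
  refine hP.false_of_touching_support hα hq (fun a => ?_) ?_ (by rwa [heu]) ?_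
  · rw [map_sub, hA.2.1, sub_zero]
  · rw [map_sub, hA.2.2, map_zero, sub_zero]
  · rw [heu, hR, hs]
    refine lt_of_le_of_lt (mul_le_mul_of_nonneg_left ?_ (by positivity)) hsmall
    have e : radiusSq (X t₀) x₀ ^ (α / 2) * (radiusSq (X t₀) x₀)⁻¹ ^ 2 =
        radiusSq (X t₀) x₀ ^ (α / 2 - 2) := by
      rw [Real.rpow_sub hQ0, inv_pow, Real.rpow_two]
      exact (div_eq_mul_inv _ _).symm
    rw [e]
    -- R s² is r² to the power α/2 − 2, whose sign depends on whether α ≥ 4; summing the values at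
    -- both radius bounds covers both cases.
    rcases le_total 0 (α / 2 - 2) with hβ | hβ
    · exact (Real.rpow_le_rpow hQ0.le (hge t₀ htc x₀) hβ).trans
        (le_add_of_nonneg_left (Real.rpow_nonneg hc₀.le _))
    · exact (Real.rpow_le_rpow_of_nonpos hc₀ (hle t₀ htc x₀) hβ).trans
        (le_add_of_nonneg_right (Real.rpow_nonneg hR₁.le _))

theorem meanCurvature_le {c₀ a K : ℝ} (hc₀ : 0 < c₀)
    (hle : ∀ t ∈ Set.Ico 0 T, ∀ x, c₀ ≤ radiusSq (X t) x) (ha : 0 < a)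
    (hu : ∀ t ∈ Set.Ico 0 T, ∀ x, 2 * a ≤ supportFunction (X t) (ν t) x) (hK : 1 ≤ K)
    (hbig : 2 * (n + 1) * (2 + 2 * α + c₀⁻¹ * (α * (α - 2 + n) + α ^ 2)) ≤ K * a ^ 2)
    (h0 : ∀ x, meanCurvature X₀ ν₀ x < K * (supportFunction X₀ ν₀ x - a)) :
    ∀ t ∈ Set.Ico 0 T, ∀ x,
      meanCurvature (X t) (ν t) x ≤ K * (supportFunction (X t) (ν t) x - a) := by
  intro t₁ ht₁ x₁
  by_contra! hlt
  have hF := hS.isSmoothFamily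
  obtain ⟨t₀, ht₀, x₀, hzero, hnn⟩ := exists_first_zero (T := T)
    (q := fun t x => K * (supportFunction (X t) (ν t) x - (a + 0 * t)) -
      meanCurvature (X t) (ν t) x)
    (ContinuousOn.sub (ContinuousOn.mul continuousOn_const
      (ContinuousOn.sub hS.continuousOn_supportFunction (by fun_prop)))
        hF.continuousOn_meanCurvature)
    (fun x => by
      simp only [hS.initial, hS.initial_normal, zero_mul, add_zero]
      linarith [h0 x]) ht₁ (x₁ := x₁)
    (by simp only [zero_mul, add_zero]; linarith)
  have ht : t₀ ∈ Set.Ioo 0 T := ⟨ht₀.1, ht₀.2.trans_lt ht₁.2⟩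
  have htc := Set.Ioo_subset_Ico_self ht
  have hsu := hS.contDiffAt_support (x₀ := x₀) ht
  have hA := affine_germ t₀ x₀ X a 0
  have hH := hF.meanCurvature_germ (x₀ := x₀) ht
  have hgerm : germ (chartPoint t₀ x₀) (chartFunction x₀ fun t x =>
      K * (supportFunction (X t) (ν t) x - (a + 0 * t)) - meanCurvature (X t) (ν t) x) =
      algebraMap ℝ _ K * (support (familyGerm t₀ x₀ X) (familyGerm t₀ x₀ ν) -
        germ _ (chartFunction x₀ fun t _ => a + 0 * t)) -
        meanCurv (familyGerm t₀ x₀ ν) (familyFrame t₀ x₀ X) := by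
    rw [← hS.support_germ ht, ← hH.2, ← germ_sub hsu hA.1, ← germ_const,
      ← germ_mul contDiffAt_const (hsu.sub hA.1),
      ← germ_sub (contDiffAt_const.mul (hsu.sub hA.1)) hH.1]
    rfl
  have hq := isTouching_of_minimum X ht.1 ((contDiffAt_const.mul (hsu.sub hA.1)).sub hH.1)
    (q := fun t x => K * (supportFunction (X t) (ν t) x - (a + 0 * t)) -
      meanCurvature (X t) (ν t) x)
    (fun t ht' x => hzero.le.trans (hnn t ht' x))
  have heu : ev _ (support (familyGerm t₀ x₀ X) (familyGerm t₀ x₀ ν)) =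
      supportFunction (X t₀) (ν t₀) x₀ := by
    rw [← hS.support_germ ht, ev_chartFunction hsu]
  have heH : ev _ (meanCurv (familyGerm t₀ x₀ ν) (familyFrame t₀ x₀ X)) =
      meanCurvature (X t₀) (ν t₀) x₀ := by
    rw [← hH.2]
    exact ev_chartFunction (q := fun t => meanCurvature (X t) (ν t)) hH.1
  have hQ0 : 0 < radiusSq (X t₀) x₀ := hc₀.trans_le (hle t₀ htc x₀)
  obtain ⟨F, R, s, hP, hR, hs⟩ := hS.isFlowPoint hn ht hQ0
  rw [hgerm] at hq
  refine hP.false_of_touching_meanCurv hα hq (K := K) (a := a) (S := c₀⁻¹) (fun c => ?_) ?_ ?_ ha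
    (by rw [heu]; exact hu t₀ htc x₀) hK ?_ hbig
  · simp only [map_sub, Derivation.leibniz, Derivation.map_algebraMap, mul_zero, add_zero,
      hA.2.1, sub_zero, smul_eq_mul]
  · simp only [map_sub, Derivation.leibniz, Derivation.map_algebraMap, mul_zero, add_zero,
      hA.2.2, map_zero, sub_zero, smul_eq_mul]
  · rw [heu, heH]
    linarith
  · rw [hs]
    exact inv_anti₀ hc₀ (hle t₀ htc x₀)

end IsSolution

theorem continuous_supportFunction {X₀ ν₀ : Sph n → Amb n} (hX : Continuous X₀)
    (hν : Continuous ν₀) : Continuous (supportFunction X₀ ν₀) := by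
  simp only [funext (supportFunction_eq X₀ ν₀)]
  exact hX.inner hν

theorem continuous_radiusSq {X₀ : Sph n → Amb n} (hX : Continuous X₀) :
    Continuous (radiusSq X₀) := by
  simp only [funext (radiusSq_eq X₀)]
  exact hX.norm.pow 2

theorem IsInitialHypersurface.continuous_meanCurvature {X₀ ν₀ : Sph n → Amb n}
    (h₀ : IsInitialHypersurface X₀ ν₀) : Continuous (meanCurvature X₀ ν₀) := by
  rw [← continuousOn_univ]
  exact (isSmoothFamily_const h₀.smooth h₀.smooth_normal h₀.immersed)
    |>.continuousOn_meanCurvature.comp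
    (f := fun x : Sph n => ((0 : ℝ), x)) (by fun_prop) fun x _ => ⟨by norm_num, Set.mem_univ _⟩

end APrioriEstimates

end NormalizedFlow

end

/-! ### Choice of constants and conclusion. -/

open NormalizedFlow in
theorem theorem5p1 (n : ℕ) (hn : 2 ≤ n) (α : ℝ) (hα : 2 ≤ α)
    (X₀ ν₀ : NormalizedFlow.Sph n → NormalizedFlow.Amb n)
    (h₀ : NormalizedFlow.IsInitialHypersurface X₀ ν₀) :
    ∃ C : ℝ, ∀ (T : ℝ) (X ν : ℝ → NormalizedFlow.Sph n → NormalizedFlow.Amb n),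
      NormalizedFlow.IsSolution α T X₀ ν₀ X ν →
        ∀ t ∈ Set.Ico 0 T, ∀ x, NormalizedFlow.normA (X t) (ν t) x ≤ C := by
  have hQc := continuous_radiusSq h₀.smooth.continuous
  have huc := continuous_supportFunction h₀.smooth.continuous h₀.smooth_normal.continuous
  have hu0 : ∀ x, 0 < supportFunction X₀ ν₀ x := fun x => by
    rw [supportFunction_eq]; exact h₀.starshaped x
  have hQ0 : ∀ x, 0 < radiusSq X₀ x := fun x => by
    rw [radiusSq_eq]
    refine pow_pos (norm_pos_iff.2 fun h => ?_) 2
    have := h₀.starshaped x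
    rw [h, inner_zero_left] at this
    exact this.false
  obtain ⟨R₁, hR₁, hQR⟩ := exists_forall_lt hQc
  obtain ⟨c₀, hc₀, hc₀1, hcQ⟩ := exists_pos_forall_lt hQc hQ0
  obtain ⟨b, hb, -, hbu⟩ := exists_pos_forall_lt huc hu0
  obtain ⟨M, hM, hHM⟩ := exists_forall_lt h₀.continuous_meanCurvature
  set B := c₀ ^ (α / 2 - 2) + R₁ ^ (α / 2 - 2) with hB
  have hB0 : 0 < B := add_pos (Real.rpow_pos_of_pos hc₀ _) (Real.rpow_pos_of_pos (by linarith) _)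
  -- Below the initial support function, and small enough that α²c²B < 1, where B bounds r^α·r⁻⁴ for
  -- all times.
  set c := min b (1 / (α * (B + 1))) with hcd
  have hαB : 0 < α * (B + 1) := mul_pos (by linarith) (by linarith)
  have hc : 0 < c := lt_min hb (by positivity)
  have hcu : ∀ x, c < supportFunction X₀ ν₀ x := fun x => (min_le_left _ _).trans_lt (hbu x)
  have hsmall : α ^ 2 * c ^ 2 * B < 1 := by
    have h1 : α * (B + 1) * c ≤ 1 := by
      have := mul_le_mul_of_nonneg_left (min_le_right b (1 / (α * (B + 1)))) hαB.le
      rwa [mul_one_div_cancel hαB.ne'] at this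
    have h2 : (α * (B + 1) * c) ^ 2 ≤ 1 := pow_le_one₀ (by positivity) h1
    have h3 : B < (B + 1) ^ 2 := by nlinarith
    calc α ^ 2 * c ^ 2 * B < α ^ 2 * c ^ 2 * (B + 1) ^ 2 :=
          mul_lt_mul_of_pos_left h3 (by positivity)
      _ = (α * (B + 1) * c) ^ 2 := by ring
      _ ≤ 1 := h2
  set a := c / 2 with had
  have ha : 0 < a := by positivity
  set D := 2 * (n + 1) * (2 + 2 * α + c₀⁻¹ * (α * (α - 2 + n) + α ^ 2)) with hD
  -- D/a² makes the cubic term win at a touching point; M/a makes H < K(u − a) hold initially, since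
  -- u − a > a there.
  set K := max 1 (max (D / a ^ 2) (M / a)) with hKd
  have hK1 : 1 ≤ K := le_max_left _ _
  have hKD : D ≤ K * a ^ 2 :=
    (div_le_iff₀ (by positivity)).1 ((le_max_left _ _).trans (le_max_right _ _))
  have hKM : M ≤ K * a := (div_le_iff₀ ha).1 ((le_max_right _ _).trans (le_max_right _ _))
  -- The constant is fixed before T and the solution are introduced; u − a ≤ |X| ≤ √R₁ gives its
  -- value.
  refine ⟨K * √R₁, fun T X ν hS t ht x => ?_⟩
  have hge := hS.radiusSq_le hn hα hR₁ hQR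
  have hle := hS.le_radiusSq hn hα hc₀1 hcQ
  have hu := hS.le_supportFunction hn hα hc₀ hle hge hc hsmall hcu
  have hH := hS.meanCurvature_le hn hα hc₀ hle ha (fun t ht x => by linarith [hu t ht x]) hK1 hKD
    (fun x => by
      have h1 : K * a ≤ K * (supportFunction X₀ ν₀ x - a) :=
        mul_le_mul_of_nonneg_left (by linarith [hcu x])
          (by linarith)
      linarith [hHM x]) t ht x
  have hA := normA_le_meanCurvature hn (contMDiff_slice hS.smooth ht)
    (contMDiff_slice hS.smooth_normal ht) (hS.immersed t ht) (hS.twoConvex t ht) x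
  refine hA.trans (hH.trans (mul_le_mul_of_nonneg_left ?_ (by linarith)))
  have h1 := real_inner_le_norm (X t x) (ν t x)
  rw [(hS.immersed t ht).norm_normal, mul_one, ← supportFunction_eq] at h1
  have h2 : ‖X t x‖ ≤ √R₁ := Real.le_sqrt_of_sq_le (by rw [← radiusSq_eq]; exact hge t ht x)
  linarith
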